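/- **Setting.** Let $X$ be a complete geodesic metric space, $\omega$ an ultrafilter on $\mathbb N$, $d=(d_n)$ a sequence of positive reals with $\omega(\{n : d_n>M\})=1$ for every $M$, $e=(e_n)$ a sequence of points of $X$, and $\varepsilon>0$. The asymptotic cone $\operatorname{Con}^\omega(X,e,d)$ is the set of sequences $x=(x_n)$ in $X$ with $\lim^\omega \mathrm d(x_n,e_n)/d_n<\infty$, with the metric $\mathrm d(x,y)=\lim^\omega \mathrm d(x_n,y_n)/d_n$, where sequences at distance $0$ are identified. **Loops and discs.** A loop is a continuous map $\gamma$ from the unit circle $\partial\mathbb D$; $|\gamma|$ is its arc length. It bounds a disc of diameter $r$ if it extends to a continuous map of the closed unit disc $\mathbb D$ whose image has diameter $r$. **Partitions.** A partition of $\mathbb D$ is a finite collection of closed topological discs $D_1,\dots,D_k$ with union $\mathbb D$ and $D_i\cap D_j=\partial D_i\cap\partial D_j$ for $i\ne j$. Its vertices are the points of the graph $\bigcup_i\partial D_i$ of degree at least $3$; its edges are the arcs of the graph between vertices. A partition of a loop $\gamma$ in $X$ is a map $\Pi$ from the vertices of such a partition to $X$ with $\Pi=\gamma$ at the vertices on $\partial\mathbb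 D$. It is extended to the graph by $\gamma$ on $\partial\mathbb D$ and by geodesic segments on the edges not contained in $\partial\mathbb D$; its mesh is $\max_i|\Pi(\partial D_i)|$. Let $P(\gamma,\delta)$ be the least number $k$ of pieces in a partition of $\gamma$ of mesh less than $\delta$ ($\infty$ if there is none), and for $m\in\mathbb N$ let $$\vartheta(m)=\sup\{P(\alpha,|\alpha|/2) : \alpha \text{ a loop in } X,\ m-1<|\alpha|\le m\}.$$ $X$ is *uniformly $\varepsilon$-coarsely loop divisible* with respect to $(\omega,d)$ if there is a constant $K_0$ such that for every $\delta\in(0,\varepsilon)$ there is $A\subset\mathbb N$ with $\omega(A)=1$ and $\vartheta(m)\le K_0$ for all integers $m\in\bigcup_{n\in A}[\delta d_n,\varepsilon d_n]$. **Theorem.** If $X$ is uniformly $\varepsilon$-coarsely loop divisible with respect to $(\omega,d)$, then $\operatorname{Con}^\omega(X,e,d)$ is uniformly locally simply connected: for every $\eta>0$ there is $\delta>0$ such that every loop in it of diameter at most $\delta$ bounds a disc of diameter at most $\eta$. Moreover, there is a constant $K$ such that every loop in $\operatorname{Con}^\omega(X,e,d)$ of diameter less than $\varepsilon/8$ bounds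 a disc of diameter less than $K\varepsilon$. -/

import Mathlib

/-- A metric space is geodesic if any two points are joined by an isometrically embedded
interval. -/
def IsGeodesicSpace (X : Type*) [MetricSpace X] : Prop :=
  ∀ x y : X, ∃ c : ℝ → X, c 0 = x ∧ c (dist x y) = y ∧
    ∀ s ∈ Set.Icc 0 (dist x y), ∀ t ∈ Set.Icc 0 (dist x y), dist (c s) (c t) = |s - t|

/-! ### Asymptotic cones -/

/-- A sequence of positive real numbers that diverges `ω`-almost surely. -/
structure ScalingSequence (ω : Ultrafilter ℕ) where
  seq : ℕ → ℝ
  pos : ∀ n, 0 < seq n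
  divergent : Filter.Tendsto seq ω Filter.atTop

/-- The sequences `x` in `X` with `lim^ω dist (x n) (e n) / d n < ∞`. -/
def ConeSeq {X : Type*} [MetricSpace X] (ω : Ultrafilter ℕ) (e : ℕ → X)
    (d : ScalingSequence ω) : Type _ :=
  {x : ℕ → X // ∃ M : ℝ, ∀ᶠ n in (ω : Filter ℕ), dist (x n) (e n) / d.seq n < M}

namespace ConeSeq

variable {X : Type*} [MetricSpace X] {ω : Ultrafilter ℕ} {e : ℕ → X} {d : ScalingSequence ω}

/-- The `ω`-limit of the rescaled distances. -/
noncomputable def limDist (x y : ConeSeq ω e d) : ℝ :=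
  Filter.limUnder (ω : Filter ℕ) (fun n => dist (x.1 n) (y.1 n) / d.seq n)

/-- The limit defining `limDist` exists. -/
theorem tendsto_limDist (x y : ConeSeq ω e d) :
    Filter.Tendsto (fun n => dist (x.1 n) (y.1 n) / d.seq n) ω (nhds (limDist x y)) := by
  obtain ⟨M, hM⟩ := x.2
  obtain ⟨N, hN⟩ := y.2
  have hmem : ∀ᶠ n in (ω : Filter ℕ),
      dist (x.1 n) (y.1 n) / d.seq n ∈ Set.Icc (0 : ℝ) (M + N) := by
    filter_upwards [hM, hN] with n h1 h2
    have hd := d.pos n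
    refine ⟨by positivity, ?_⟩
    have h3 : dist (x.1 n) (y.1 n) / d.seq n
        ≤ (dist (x.1 n) (e n) + dist (y.1 n) (e n)) / d.seq n := by
      gcongr
      exact dist_triangle_right _ _ _
    rw [add_div] at h3
    linarith
  obtain ⟨a, -, ha⟩ := isCompact_Icc.ultrafilter_le_nhds
    (ω.map fun n => dist (x.1 n) (y.1 n) / d.seq n)
    (Filter.le_principal_iff.2 hmem)
  exact tendsto_nhds_limUnder ⟨a, ha⟩

noncomputable instance : PseudoMetricSpace (ConeSeq ω e d) where
  dist := limDist
  dist_self x := by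
    refine tendsto_nhds_unique (tendsto_limDist x x) ?_
    simp
  dist_comm x y := by
    refine tendsto_nhds_unique (tendsto_limDist x y) ?_
    simpa only [dist_comm] using tendsto_limDist y x
  dist_triangle x y z := by
    refine le_of_tendsto_of_tendsto' (tendsto_limDist x z)
      ((tendsto_limDist x y).add (tendsto_limDist y z)) fun n => ?_
    have hd := d.pos n
    rw [← add_div]
    gcongr
    exact dist_triangle _ _ _

end ConeSeq

/-- The asymptotic cone `Con^ω(X, e, d)`: the sequences at finite distance from `e`, with the
sequences at distance `0` from each other identified. -/
abbrev AsymptoticCone {X : Type*} [MetricSpace X] (ω : Ultrafilter ℕ) (e : ℕ → X)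
    (d : ScalingSequence ω) : Type _ :=
  SeparationQuotient (ConeSeq ω e d)

/-! ### Loops, discs, local simple connectivity -/

/-- The arc length of a loop. -/
noncomputable def loopLength {X : Type*} [MetricSpace X] (γ : C(Circle, X)) : ENNReal :=
  eVariationOn (fun t : ℝ => γ (Circle.exp t)) (Set.Icc 0 (2 * Real.pi))

/-- The loop `γ` bounds the disc `f`: the restriction of `f` to the boundary circle is `γ`. -/
def BoundsDisc {X : Type*} [TopologicalSpace X] (γ : C(Circle, X))
    (f : C(Metric.closedBall (0 : ℂ) 1, X)) : Prop :=
  ∀ z : Circle, f ⟨z, by simp [Circle.norm_coe]⟩ = γ z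

/-- Every small loop bounds a small disc, uniformly in the loop. -/
def UniformlyLocallySimplyConnected (Y : Type*) [MetricSpace Y] : Prop :=
  ∀ η : ℝ, 0 < η → ∃ δ : ℝ, 0 < δ ∧ ∀ γ : C(Circle, Y),
    Metric.diam (Set.range γ) ≤ δ →
      ∃ f : C(Metric.closedBall (0 : ℂ) 1, Y), BoundsDisc γ f ∧ Metric.diam (Set.range f) ≤ η

/-! ### Partitions of the unit disc -/

/-- A partition of the closed unit disc `𝔻` of the plane into finitely many closed topological
discs `D i`, with its finite cell structure. The disc `D i` is the image of `𝔻` under the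
embedding `cell i`; its boundary is the image of the unit circle. The `1`-skeleton is the union of
the boundaries of the discs. It is a finite graph, made of the vertices, the edges contained in
`∂𝔻` (the arcs of `∂𝔻` between consecutive vertices), and the edges not contained in `∂𝔻`, which
are listed by `edge`. Every vertex has degree at least `3`, so that the vertices are exactly the
points of the `1`-skeleton without a neighbourhood in the `1`-skeleton that is an interval. The
trivial partition, with the single disc `𝔻` and no vertices, is allowed. -/
structure DiscPartition where
  /-- the number of pieces -/
  numPieces : ℕ
  cell : Fin numPieces → ℂ → ℂ
  cell_continuousOn : ∀ i, ContinuousOn (cell i) (Metric.closedBall 0 1)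
  cell_injOn : ∀ i, Set.InjOn (cell i) (Metric.closedBall 0 1)
  /-- the discs cover `𝔻` and lie in `𝔻` -/
  iUnion_cell : ⋃ i, cell i '' Metric.closedBall 0 1 = Metric.closedBall 0 1
  /-- two discs meet only along their boundaries -/
  cell_inter : ∀ i j, i ≠ j →
    cell i '' Metric.closedBall 0 1 ∩ cell j '' Metric.closedBall 0 1 =
      cell i '' Metric.sphere 0 1 ∩ cell j '' Metric.sphere 0 1
  vertices : Finset ℂ
  numEdges : ℕ
  /-- the edges not contained in `∂𝔻`, as arcs parameterized by `[0, 1]` -/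
  edge : Fin numEdges → ℝ → ℂ
  edge_continuousOn : ∀ j, ContinuousOn (edge j) (Set.Icc 0 1)
  edge_injOn : ∀ j, Set.InjOn (edge j) (Set.Icc 0 1)
  edge_zero_mem : ∀ j, edge j 0 ∈ vertices
  edge_one_mem : ∀ j, edge j 1 ∈ vertices
  /-- the interior of such an edge contains no vertex and no point of `∂𝔻` -/
  edge_interior : ∀ j, ∀ t ∈ Set.Ioo (0 : ℝ) 1, edge j t ∉ vertices ∧ ‖edge j t‖ < 1
  /-- different edges have disjoint interiors -/
  edge_disjoint : ∀ j j', j ≠ j' →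
    Disjoint (edge j '' Set.Ioo 0 1) (edge j' '' Set.Ioo 0 1)
  /-- the `1`-skeleton consists of `∂𝔻` and the edges not contained in `∂𝔻` -/
  skeleton_eq : ⋃ i, cell i '' Metric.sphere 0 1 =
    Metric.sphere 0 1 ∪ ⋃ j, edge j '' Set.Icc 0 1
  /-- a vertex on `∂𝔻` lies on two edges in `∂𝔻` and on at least one more edge -/
  degree_boundary : ∀ v ∈ vertices, ‖v‖ = 1 → ∃ j, v = edge j 0 ∨ v = edge j 1
  /-- a vertex off `∂𝔻` has degree at least three -/
  degree_interior : ∀ v ∈ vertices, ‖v‖ ≠ 1 →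
    3 ≤ {j | v = edge j 0 ∨ v = edge j 1}.ncard

namespace DiscPartition

/-- The `1`-skeleton of a partition. -/
def skeleton (P : DiscPartition) : Set ℂ :=
  ⋃ i, P.cell i '' Metric.sphere 0 1

variable {X : Type*} [MetricSpace X]

/-- `φ`, defined on the vertices of `P`, is a partition of the loop `γ`: it agrees with `γ` at the
vertices on the unit circle. -/
def IsPartitionOf (P : DiscPartition) (γ : C(Circle, X)) (φ : P.vertices → X) : Prop :=
  ∀ (v : P.vertices) (z : Circle), (v : ℂ) = z → φ v = γ z

/-- `F` extends the partition `φ` of `γ` to the `1`-skeleton: it is `γ` on `∂𝔻`, and it maps each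
edge not contained in `∂𝔻` to a geodesic segment between the images of its ends, that is, to a
path whose length is the distance of its ends. -/
structure IsGeodesicExtension (P : DiscPartition) (γ : C(Circle, X)) (φ : P.vertices → X)
    (F : ℂ → X) : Prop where
  continuousOn : ContinuousOn F P.skeleton
  eq_vertex : ∀ v : P.vertices, F v = φ v
  eq_loop : ∀ z : Circle, F z = γ z
  geodesic : ∀ j, eVariationOn (fun t => F (P.edge j t)) (Set.Icc 0 1) =
    edist (F (P.edge j 0)) (F (P.edge j 1))

/-- The length of the `i`-th piece: the arc length of the image under `F` of the boundary of the
`i`-th disc. -/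
noncomputable def pieceLength (P : DiscPartition) (F : ℂ → X) (i : Fin P.numPieces) : ENNReal :=
  eVariationOn (fun t : ℝ => F (P.cell i (Circle.exp t))) (Set.Icc 0 (2 * Real.pi))

/-- The mesh: the maximal length of a piece. -/
noncomputable def mesh (P : DiscPartition) (F : ℂ → X) : ENNReal :=
  ⨆ i, P.pieceLength F i

end DiscPartition

/-- `P(γ, δ)`: the minimal number of pieces in a partition of `γ` of mesh less than `δ`, and `⊤`
if there is none. (The mesh does not depend on the choice of the geodesic segments.) -/
noncomputable def partitionNumber {X : Type*} [MetricSpace X] (γ : C(Circle, X))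
    (δ : ENNReal) : ℕ∞ :=
  sInf {k : ℕ∞ | ∃ (P : DiscPartition) (φ : P.vertices → X) (F : ℂ → X),
    P.IsPartitionOf γ φ ∧ P.IsGeodesicExtension γ φ F ∧ P.mesh F < δ ∧ k = P.numPieces}

/-- The divisibility function `ϑ` of `X`: the supremum of `P(α, |α|/2)` over the loops `α` with
`n - 1 < |α| ≤ n`. -/
noncomputable def divisibility (X : Type*) [MetricSpace X] (n : ℕ) : ℕ∞ :=
  ⨆ (α : C(Circle, X)) (_ : (n : ENNReal) < loopLength α + 1 ∧ loopLength α ≤ n),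
    partitionNumber α (loopLength α / 2)

/-- `X` is uniformly `ε`-coarsely loop divisible with respect to `(ω, d)`: there is `K` such that,
for every `δ ∈ (0, ε)`, `ϑ ≤ K` on the union of the intervals `[δ d n, ε d n]` over an `ω`-large
set of indices `n`. -/
def UniformlyCoarselyLoopDivisible (X : Type*) [MetricSpace X] (ω : Ultrafilter ℕ)
    (d : ScalingSequence ω) (ε : ℝ) : Prop :=
  ∃ K : ℕ, ∀ δ ∈ Set.Ioo 0 ε, ∃ A ∈ ω, ∀ n ∈ A, ∀ m : ℕ,
    δ * d.seq n ≤ m → (m : ℝ) ≤ ε * d.seq n → divisibility X m ≤ K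

/-!
The cone is filled in three stages, each of which reduces a filling problem to the next one.

*Limits of loops.* A sequence of loops `α n` in `X` with length at most `l * d n`, where `l < ε`,
has a limit loop in the cone if it is asymptotically equicontinuous. If the lengths are not
negligible with respect to `d n`, then divisibility provides partitions of the `α n` with at most
`K` pieces and mesh less than half the length. The number of edges of a partition is at most three
times the number of its pieces (`DiscPartition.numEdges_le_three_mul`). This is a consequence of
Euler's formula; the inequality that is needed is proved by lifting circle-valued maps. An
assignment of integers to the edges defines a map of the `1`-skeleton to the circle, and if this
map has degree `0` on the boundary of every piece, then it extends to the disc and lifts to the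
real line, so the integers are the differences of a potential on the vertices; a flow that is also
without sources is then orthogonal to itself, and vanishes. Hence there are finitely many
combinatorial types, and one of them occurs for `ω`-almost all `n` (`exists_common_combType`). For a
fixed partition of that type the labels in `X` converge, and divide the limit loop into limits of
loops of length at most `(l / 2) * d n` (`exists_fillStep_of_divisible`). If the lengths are
negligible, the limit loop is constant.

*Recursion.* `exists_filling_of_steps` turns such steps into a continuous map of the disc. The
pieces of the disc need not become small. Continuity holds because at every level finitely many
pieces form a neighbourhood of each point, and the values on a piece lie in a set whose diameter
tends to `0` with the level. The cone is complete (`completeSpace_asymptoticCone`), so that the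
recursion converges. The limit loops of length parameter `l` therefore bound discs of diameter at
most a multiple of `l` (`exists_disc_of_isLoopSeq`).

*Arbitrary loops.* A loop of the cone need not be rectifiable. However, geodesic triangles in `X`
are loops of controlled length, so limits of geodesic triangles with sides at most `D`, `4 D < ε`,
are filled in proportion to `D` (`exists_fillsTriangle`). A loop `γ` is cut dyadically: in the unit
square, the upper half is filled by the triangle on the images of the ends and of the midpoint of
the parameter interval, and the two lower quarters by the same construction on the two halves of
the interval. By uniform continuity of `γ` the triangles become small, and the recursion applies
once more, with the square as domain. On the lower side of the square the limit map is `γ`, and it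
is constant on the rest of the boundary, so that it descends to the disc. The diameter is at most a
fixed multiple of the diameter of `γ` (`exists_boundsDisc_of_divisible`), which contains both
claims.
-/

/-! ### Curves in a system of arcs -/

/-- A finite graph drawn in a space: arcs `arc a`, parameterized by `[0, 1]`, that start and end in
the set `verts` and have pairwise disjoint interiors off `verts`. -/
structure ArcSystem (ι W : Type*) [TopologicalSpace W] where
  arc : ι → ℝ → W
  verts : Set W
  continuousOn : ∀ a, ContinuousOn (arc a) (Set.Icc 0 1)
  injOn : ∀ a, Set.InjOn (arc a) (Set.Icc 0 1)
  zero_mem : ∀ a, arc a 0 ∈ verts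
  one_mem : ∀ a, arc a 1 ∈ verts
  interior_notMem : ∀ a, ∀ t ∈ Set.Ioo (0 : ℝ) 1, arc a t ∉ verts
  disjoint : ∀ a a', a ≠ a' → Disjoint (arc a '' Set.Ioo 0 1) (arc a' '' Set.Ioo 0 1)

namespace ArcSystem

variable {ι W : Type*} [TopologicalSpace W] (S : ArcSystem ι W)

/-- The union of the arcs. -/
def carrier : Set W := ⋃ a, S.arc a '' Set.Icc 0 1

variable {S}

theorem arc_mem_verts_iff {a : ι} {t : ℝ} (ht : t ∈ Set.Icc (0 : ℝ) 1) :
    S.arc a t ∈ S.verts ↔ t = 0 ∨ t = 1 := by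
  constructor
  · intro h
    by_contra! h'
    exact S.interior_notMem a t ⟨lt_of_le_of_ne ht.1 (Ne.symm h'.1), lt_of_le_of_ne ht.2 h'.2⟩ h
  · rintro (rfl | rfl)
    · exact S.zero_mem a
    · exact S.one_mem a

/-- Points of two arcs coincide only if they are equal points of the same arc or vertices. -/
theorem eq_of_arc_eq {a a' : ι} {t t' : ℝ} (ht : t ∈ Set.Ioo (0 : ℝ) 1)
    (ht' : t' ∈ Set.Icc (0 : ℝ) 1) (h : S.arc a t = S.arc a' t') : a = a' ∧ t = t' := by
  have h1 : t' ∈ Set.Ioo (0 : ℝ) 1 := by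
    have h2 : ¬(t' = 0 ∨ t' = 1) := fun h3 =>
      S.interior_notMem a t ht (h ▸ (arc_mem_verts_iff ht').2 h3)
    push Not at h2
    exact ⟨lt_of_le_of_ne ht'.1 (Ne.symm h2.1), lt_of_le_of_ne ht'.2 h2.2⟩
  have h2 : a = a' := by
    by_contra h3
    exact Set.disjoint_left.1 (S.disjoint a a' h3) ⟨t, ht, rfl⟩ ⟨t', h1, h.symm⟩
  subst h2
  exact ⟨rfl, S.injOn a (Set.Ioo_subset_Icc_self ht) ht' h⟩

/-- A curve between two vertices that meets no other vertex runs in a single arc. -/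
theorem exists_arc_of_curve [Finite ι] [T2Space W] {γ : ℝ → W} {p q : ℝ} (hpq : p < q)
    (hγ : ContinuousOn γ (Set.Icc p q)) (hcar : ∀ t ∈ Set.Icc p q, γ t ∈ S.carrier)
    (hV : ∀ t ∈ Set.Ioo p q, γ t ∉ S.verts) :
    ∃ a, ∀ t ∈ Set.Icc p q, γ t ∈ S.arc a '' Set.Icc 0 1 := by
  have hcl : ∀ a, IsClosed (S.arc a '' Set.Icc 0 1) := fun a =>
    (isCompact_Icc.image_of_continuousOn (S.continuousOn a)).isClosed
  set m := (p + q) / 2 with hm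
  have hmI : m ∈ Set.Ioo p q := ⟨by linarith, by linarith⟩
  obtain ⟨a, ha⟩ := Set.mem_iUnion.1 (hcar m (Set.Ioo_subset_Icc_self hmI))
  have hconn : IsPreconnected (γ '' Set.Ioo p q) :=
    isPreconnected_Ioo.image _ (hγ.mono Set.Ioo_subset_Icc_self)
  have key : ∀ t ∈ Set.Ioo p q, γ t ∈ S.arc a '' Set.Icc 0 1 := by
    intro t ht
    by_contra hna
    have hcl2 : IsClosed (⋃ a' ∈ {a' | a' ≠ a}, S.arc a' '' Set.Icc 0 1) :=
      (Set.toFinite _).isClosed_biUnion fun a' _ => hcl a'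
    have hsub : γ '' Set.Ioo p q ⊆ S.arc a '' Set.Icc 0 1 ∪
        ⋃ a' ∈ {a' | a' ≠ a}, S.arc a' '' Set.Icc 0 1 := by
      rintro _ ⟨s, hs, rfl⟩
      obtain ⟨a', ha'⟩ := Set.mem_iUnion.1 (hcar s (Set.Ioo_subset_Icc_self hs))
      by_cases h : a' = a
      · left; exact h ▸ ha'
      · right; exact Set.mem_biUnion (show a' ∈ {a' | a' ≠ a} from h) ha'
    have h2 : (γ '' Set.Ioo p q ∩ ⋃ a' ∈ {a' | a' ≠ a}, S.arc a' '' Set.Icc 0 1).Nonempty := by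
      refine ⟨γ t, ⟨t, ht, rfl⟩, ?_⟩
      rcases hsub ⟨t, ht, rfl⟩ with h | h
      · exact absurd h hna
      · exact h
    obtain ⟨_, ⟨s, hs, rfl⟩, ⟨x, hx, hxs⟩, h4⟩ :=
      isPreconnected_closed_iff.1 hconn _ _ (hcl a) hcl2 hsub ⟨γ m, ⟨m, hmI, rfl⟩, ha⟩ h2
    obtain ⟨a', ha', y, hy, hys⟩ := Set.mem_iUnion₂.1 h4
    have hx' : x ∈ Set.Ioo (0 : ℝ) 1 := by
      have h5 : ¬(x = 0 ∨ x = 1) := fun h6 =>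
        hV s hs (hxs ▸ (arc_mem_verts_iff hx).2 h6)
      push Not at h5
      exact ⟨lt_of_le_of_ne hx.1 (Ne.symm h5.1), lt_of_le_of_ne hx.2 h5.2⟩
    exact ha' (eq_of_arc_eq hx' hy (hxs.trans hys.symm)).1.symm
  refine ⟨a, fun t ht => ?_⟩
  have hmaps : Set.MapsTo γ (closure (Set.Ioo p q)) (S.arc a '' Set.Icc 0 1) := by
    refine Set.MapsTo.closure_of_continuousOn (fun s hs => key s hs) ?_ |>.mono_right ?_
    · rwa [closure_Ioo hpq.ne]
    · rw [(hcl a).closure_eq]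
  exact hmaps (by rwa [closure_Ioo hpq.ne])

/-- A curve in a single arc is the composition of the arc with a continuous change of parameter. -/
theorem exists_continuousOn_arc_comp_eq [T2Space W] {γ : ℝ → W} {p q : ℝ}
    (hγ : ContinuousOn γ (Set.Icc p q)) {a : ι}
    (ha : ∀ t ∈ Set.Icc p q, γ t ∈ S.arc a '' Set.Icc 0 1) :
    ∃ τ : ℝ → ℝ, ContinuousOn τ (Set.Icc p q) ∧ (∀ t ∈ Set.Icc p q, τ t ∈ Set.Icc (0 : ℝ) 1) ∧
      ∀ t ∈ Set.Icc p q, S.arc a (τ t) = γ t := by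
  choose! τ hτI hτ using ha
  have hemb : Topology.IsClosedEmbedding (fun t : Set.Icc (0 : ℝ) 1 => S.arc a t) := by
    refine Continuous.isClosedEmbedding ?_ ?_
    · exact continuousOn_iff_continuous_domRestrict.1 (S.continuousOn a)
    · exact Set.injOn_iff_injective.1 (S.injOn a)
  refine ⟨τ, ?_, hτI, hτ⟩
  rw [continuousOn_iff_continuous_domRestrict]
  have h1 : Continuous (fun t : Set.Icc p q => (⟨τ t, hτI t t.2⟩ : Set.Icc (0 : ℝ) 1)) := by
    rw [hemb.isEmbedding.continuous_iff]
    exact (continuousOn_iff_continuous_domRestrict.1 hγ).congr fun t => (hτ t t.2).symm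
  exact continuous_subtype_val.comp h1

/-- A continuous function on `[p, q]` whose values at the ends agree is not injective on
`[p, q)`. -/
theorem _root_.not_injOn_Ico_of_eq {τ : ℝ → ℝ} {p q : ℝ} (hpq : p < q)
    (hτ : ContinuousOn τ (Set.Icc p q)) (hinj : Set.InjOn τ (Set.Ico p q)) : τ p ≠ τ q := by
  intro heq
  set m := (p + q) / 2 with hm
  have hpm : p < m := by linarith
  have hmq : m < q := by linarith
  have hpm' : τ p ≠ τ m := fun h =>
    hpm.ne (hinj ⟨le_rfl, hpq⟩ ⟨hpm.le, hmq⟩ h)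
  -- a value strictly between `τ p = τ q` and `τ m` is taken on both sides of `m`
  have h1 := intermediate_value_uIcc (a := p) (b := m) (f := τ)
    (hτ.mono (by rw [Set.uIcc_of_le hpm.le]; exact Set.Icc_subset_Icc_right hmq.le))
  have h2 := intermediate_value_uIcc (a := m) (b := q) (f := τ)
    (hτ.mono (by rw [Set.uIcc_of_le hmq.le]; exact Set.Icc_subset_Icc_left hpm.le))
  rw [Set.uIcc_of_le hpm.le] at h1
  rw [Set.uIcc_of_le hmq.le, Set.uIcc_comm, ← heq] at h2
  set v := (τ p + τ m) / 2 with hv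
  have hvI : v ∈ Set.uIcc (τ p) (τ m) := by
    rw [Set.mem_uIcc]
    rcases le_total (τ p) (τ m) with h | h
    · left; constructor <;> linarith
    · right; constructor <;> linarith
  obtain ⟨x, hx, hxv⟩ := h1 hvI
  obtain ⟨y, hy, hyv⟩ := h2 hvI
  have hyq : y ≠ q := by
    rintro rfl
    apply hpm'
    linarith
  have hxm : x ≠ m := by
    rintro rfl
    apply hpm'
    linarith
  have hxy : x = y := hinj ⟨hx.1, hx.2.trans_lt hmq⟩ ⟨hpm.le.trans hy.1, lt_of_le_of_ne hy.2 hyq⟩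
    (hxv.trans hyv.symm)
  exact hxm (le_antisymm hx.2 (hxy ▸ hy.1))

/-- A simple curve between two vertices that meets no other vertex is a reparameterization of an
arc. -/
theorem exists_arc_eVariationOn [Finite ι] [T2Space W] {γ : ℝ → W} {p q : ℝ} (hpq : p < q)
    (hγ : ContinuousOn γ (Set.Icc p q)) (hinj : Set.InjOn γ (Set.Ico p q))
    (hcar : ∀ t ∈ Set.Icc p q, γ t ∈ S.carrier)
    (hV : ∀ t ∈ Set.Ioo p q, γ t ∉ S.verts) (hp : γ p ∈ S.verts) (hq : γ q ∈ S.verts) :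
    ∃ a, S.arc a (1 / 2) ∈ γ '' Set.Ioo p q ∧ ∀ {X : Type*} [PseudoEMetricSpace X] (F : W → X),
      eVariationOn (fun t => F (γ t)) (Set.Icc p q) =
        eVariationOn (fun t => F (S.arc a t)) (Set.Icc 0 1) := by
  obtain ⟨a, ha⟩ := exists_arc_of_curve hpq hγ hcar hV
  obtain ⟨τ, hτc, hτI, hτ⟩ := exists_continuousOn_arc_comp_eq hγ ha
  have hτinj : Set.InjOn τ (Set.Ico p q) := fun x hx y hy h =>
    hinj hx hy (by
      rw [← hτ x (Set.Ico_subset_Icc_self hx), ← hτ y (Set.Ico_subset_Icc_self hy), h])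
  have hpI : p ∈ Set.Icc p q := ⟨le_rfl, hpq.le⟩
  have hqI : q ∈ Set.Icc p q := ⟨hpq.le, le_rfl⟩
  have hp01 : τ p = 0 ∨ τ p = 1 := (arc_mem_verts_iff (hτI p hpI)).1 (by rwa [hτ p hpI])
  have hq01 : τ q = 0 ∨ τ q = 1 := (arc_mem_verts_iff (hτI q hqI)).1 (by rwa [hτ q hqI])
  have hpq' : τ p ≠ τ q := not_injOn_Ico_of_eq hpq hτc hτinj
  -- injectivity at `q` is not assumed, but the ends of the curve are different ends of the arc
  have hτinj' : Set.InjOn τ (Set.Icc p q) := by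
    have hqn : ∀ x ∈ Set.Ico p q, τ x ≠ τ q := by
      intro x hx h
      rcases eq_or_lt_of_le hx.1 with rfl | hx1
      · exact hpq' h
      · apply hV x ⟨hx1, hx.2⟩
        rw [← hτ x (Set.Ico_subset_Icc_self hx), arc_mem_verts_iff (hτI x (Set.Ico_subset_Icc_self hx)), h]
        exact hq01
    intro x hx y hy h
    rcases eq_or_lt_of_le hx.2 with rfl | hx2 <;> rcases eq_or_lt_of_le hy.2 with rfl | hy2
    · rfl
    · exact absurd h.symm (hqn y ⟨hy.1, hy2⟩)
    · exact absurd h (hqn x ⟨hx.1, hx2⟩)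
    · exact hτinj ⟨hx.1, hx2⟩ ⟨hy.1, hy2⟩ h
  have himg : τ '' Set.Icc p q = Set.Icc 0 1 := by
    refine Set.Subset.antisymm (Set.image_subset_iff.2 hτI) ?_
    have h1 := intermediate_value_uIcc (a := p) (b := q) (f := τ) (by rwa [Set.uIcc_of_le hpq.le])
    rw [Set.uIcc_of_le hpq.le] at h1
    rcases hp01 with h | h <;> rcases hq01 with h' | h' <;> rw [h, h'] at h1
    · exact absurd (h.trans h'.symm) hpq'
    · rwa [Set.uIcc_of_le zero_le_one] at h1
    · rwa [Set.uIcc_of_ge zero_le_one] at h1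
    · exact absurd (h.trans h'.symm) hpq'
  refine ⟨a, ?_, fun {X} _ F => ?_⟩
  · obtain ⟨x, hx, hx2⟩ : (1 / 2 : ℝ) ∈ τ '' Set.Icc p q := by rw [himg]; constructor <;> norm_num
    refine ⟨x, ⟨lt_of_le_of_ne hx.1 ?_, lt_of_le_of_ne hx.2 ?_⟩, by rw [← hτ x hx, hx2]⟩
    · rintro rfl
      rcases hp01 with h | h <;> rw [h] at hx2 <;> norm_num at hx2
    · rintro rfl
      rcases hq01 with h | h <;> rw [h] at hx2 <;> norm_num at hx2
  · have h1 : eVariationOn (fun t => F (γ t)) (Set.Icc p q) =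
        eVariationOn ((fun t => F (S.arc a t)) ∘ τ) (Set.Icc p q) :=
      eVariationOn.congr fun t ht => by simp [hτ t ht]
    rw [h1, ← himg]
    rcases hτc.strictMonoOn_of_injOn_Icc' hpq.le hτinj' with h | h
    · exact eVariationOn.comp_eq_of_monotoneOn _ _ h.monotoneOn
    · exact eVariationOn.comp_eq_of_antitoneOn _ _ h.antitoneOn

/-- The length of any image of a simple curve between two vertices is the sum of the lengths of the
images of the arcs that it consists of. -/
theorem exists_finset_eVariationOn [Finite ι] [T2Space W] {γ : ℝ → W} {p q : ℝ} (hpq : p < q)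
    (hγ : ContinuousOn γ (Set.Icc p q)) (hinj : Set.InjOn γ (Set.Ico p q))
    (hinj' : Set.InjOn γ (Set.Ioc p q))
    (hcar : ∀ t ∈ Set.Icc p q, γ t ∈ S.carrier) (hfin : {t ∈ Set.Ioo p q | γ t ∈ S.verts}.Finite)
    (hp : γ p ∈ S.verts) (hq : γ q ∈ S.verts) (X : Type*) [PseudoEMetricSpace X] :
    ∃ I : Finset ι, (∀ a ∈ I, S.arc a (1 / 2) ∈ γ '' Set.Ioo p q) ∧ ∀ (F : W → X),
      eVariationOn (fun t => F (γ t)) (Set.Icc p q) =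
        ∑ a ∈ I, eVariationOn (fun t => F (S.arc a t)) (Set.Icc 0 1) := by
  classical
  induction hn : {t ∈ Set.Ioo p q | γ t ∈ S.verts}.ncard using Nat.strong_induction_on
    generalizing p q with
  | _ n ih =>
  by_cases hV : ∀ t ∈ Set.Ioo p q, γ t ∉ S.verts
  · obtain ⟨a, ha, hF⟩ := exists_arc_eVariationOn hpq hγ hinj hcar hV hp hq
    exact ⟨{a}, by simpa using ha, fun F => by simpa using hF F⟩
  push Not at hV
  obtain ⟨m, hm, hmV⟩ := hV
  have hlt : ∀ p' q', p ≤ p' → q' ≤ q → m ∉ Set.Ioo p' q' →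
      {t ∈ Set.Ioo p' q' | γ t ∈ S.verts}.Finite ∧
      {t ∈ Set.Ioo p' q' | γ t ∈ S.verts}.ncard < n := by
    intro p' q' h1 h2 h3
    have hss : {t ∈ Set.Ioo p' q' | γ t ∈ S.verts} ⊂ {t ∈ Set.Ioo p q | γ t ∈ S.verts} := by
      refine ⟨fun t ht => ⟨Set.Ioo_subset_Ioo h1 h2 ht.1, ht.2⟩, fun h => ?_⟩
      exact h3 (h ⟨hm, hmV⟩).1
    exact ⟨hfin.subset hss.1, hn ▸ Set.ncard_lt_ncard hss hfin⟩
  obtain ⟨hf1, hn1⟩ := hlt p m le_rfl hm.2.le fun h => lt_irrefl _ h.2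
  obtain ⟨hf2, hn2⟩ := hlt m q hm.1.le le_rfl fun h => lt_irrefl _ h.1
  have hs1 : Set.Icc p m ⊆ Set.Icc p q := Set.Icc_subset_Icc_right hm.2.le
  have hs2 : Set.Icc m q ⊆ Set.Icc p q := Set.Icc_subset_Icc_left hm.1.le
  obtain ⟨I, hI, hIF⟩ := ih _ hn1 hm.1 (hγ.mono hs1)
    (hinj.mono (Set.Ico_subset_Ico_right hm.2.le)) (hinj'.mono (Set.Ioc_subset_Ioc_right hm.2.le))
    (fun t ht => hcar t (hs1 ht)) hf1 hp hmV rfl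
  obtain ⟨J, hJ, hJF⟩ := ih _ hn2 hm.2 (hγ.mono hs2)
    (hinj.mono (Set.Ico_subset_Ico_left hm.1.le)) (hinj'.mono (Set.Ioc_subset_Ioc_left hm.1.le))
    (fun t ht => hcar t (hs2 ht)) hf2 hmV hq rfl
  -- the midpoint of an arc tells on which side of `m` the arc is run through
  have hdis : Disjoint I J := by
    rw [Finset.disjoint_left]
    intro a ha ha'
    obtain ⟨x, hx, hxa⟩ := hI a ha
    obtain ⟨y, hy, hya⟩ := hJ a ha'
    have : x = y := hinj ⟨hx.1.le, hx.2.trans hm.2⟩ ⟨hm.1.le.trans hy.1.le, hy.2⟩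
      (hxa.trans hya.symm)
    exact (hx.2.trans (this ▸ hy.1)).false
  refine ⟨I ∪ J, fun a ha => ?_, fun F => ?_⟩
  · rcases Finset.mem_union.1 ha with h | h
    · exact Set.image_mono (Set.Ioo_subset_Ioo_right hm.2.le) (hI a h)
    · exact Set.image_mono (Set.Ioo_subset_Ioo_left hm.1.le) (hJ a h)
  · have h1 := eVariationOn.Icc_add_Icc (fun t => F (γ t)) (s := Set.univ) hm.1.le hm.2.le
      (Set.mem_univ m)
    simp only [Set.univ_inter] at h1
    rw [← h1, hIF F, hJF F, Finset.sum_union hdis]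

/-- The variation of a periodic function over a period does not depend on the starting point. -/
theorem _root_.eVariationOn_Icc_add_period {X : Type*} [PseudoEMetricSpace X] {f : ℝ → X} {T : ℝ}
    (hf : Function.Periodic f T) {c : ℝ} (hc : c ∈ Set.Icc 0 T) :
    eVariationOn f (Set.Icc 0 T) = eVariationOn f (Set.Icc c (c + T)) := by
  have h1 := eVariationOn.Icc_add_Icc f (s := Set.univ) hc.1 hc.2 (Set.mem_univ c)
  have h2 := eVariationOn.Icc_add_Icc f (s := Set.univ) hc.2 (by linarith [hc.1] : T ≤ c + T)
    (Set.mem_univ T)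
  simp only [Set.univ_inter] at h1 h2
  have h3 : eVariationOn f (Set.Icc T (c + T)) = eVariationOn f (Set.Icc 0 c) := by
    have h4 := eVariationOn.comp_eq_of_monotoneOn f (t := Set.Icc 0 c) (fun x => x + T)
      (fun x _ y _ h => by simpa using h)
    rw [Set.image_add_const_Icc, zero_add] at h4
    rw [← h4]
    exact eVariationOn.congr fun x _ => (hf x)
  rw [← h1, ← h2, h3, add_comm]

/-- The length of any image of a simple closed curve in a finite graph is the sum of the lengths of
the images of the arcs that it consists of. -/
theorem exists_finset_eVariationOn_of_periodic [Finite ι] [T2Space W] {γ : ℝ → W} {T : ℝ}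
    (hT : 0 < T) (hper : Function.Periodic γ T) (hγ : Continuous γ)
    (hinj : ∀ c, Set.InjOn γ (Set.Ico c (c + T))) (hcar : ∀ t, γ t ∈ S.carrier)
    (hfin : S.verts.Finite) (X : Type*) [PseudoEMetricSpace X] :
    ∃ I : Finset ι, ∀ (F : W → X), eVariationOn (fun t => F (γ t)) (Set.Icc 0 T) =
        ∑ a ∈ I, eVariationOn (fun t => F (S.arc a t)) (Set.Icc 0 1) := by
  obtain ⟨c, hc, hcV⟩ : ∃ c ∈ Set.Icc 0 T, γ c ∈ S.verts := by
    -- a closed curve without vertices would be embedded in an interval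
    by_contra! hV
    obtain ⟨a, ha⟩ := exists_arc_of_curve hT hγ.continuousOn (fun t _ => hcar t)
      fun t ht => hV t (Set.Ioo_subset_Icc_self ht)
    obtain ⟨τ, hτc, hτI, hτ⟩ := exists_continuousOn_arc_comp_eq hγ.continuousOn ha
    have hi0 := hinj 0
    rw [zero_add] at hi0
    refine not_injOn_Ico_of_eq hT hτc (fun x hx y hy h => hi0 hx hy ?_) ?_
    · rw [← hτ x (Set.Ico_subset_Icc_self hx), ← hτ y (Set.Ico_subset_Icc_self hy), h]
    · have h0 : (0 : ℝ) ∈ Set.Icc 0 T := ⟨le_rfl, hT.le⟩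
      have h1 : T ∈ Set.Icc 0 T := ⟨hT.le, le_rfl⟩
      refine S.injOn a (hτI 0 h0) (hτI T h1) ?_
      rw [hτ 0 h0, hτ T h1]
      simpa using (hper 0).symm
  have hcT : c < c + T := by linarith
  have hinj' : Set.InjOn γ (Set.Ioc c (c + T)) := by
    intro x hx y hy h
    have hx' : x - T ∈ Set.Ioc (c - T) c := ⟨by linarith [hx.1], by linarith [hx.2]⟩
    by_cases hxe : x = c + T <;> by_cases hye : y = c + T
    · rw [hxe, hye]
    · have := hinj c ⟨le_rfl, hcT⟩ ⟨hy.1.le, lt_of_le_of_ne hy.2 hye⟩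
        (by rw [← h, hxe]; exact (hper c).symm)
      exact absurd this hy.1.ne
    · have := hinj c ⟨le_rfl, hcT⟩ ⟨hx.1.le, lt_of_le_of_ne hx.2 hxe⟩
        (by rw [h, hye]; exact (hper c).symm)
      exact absurd this hx.1.ne
    · exact hinj c ⟨hx.1.le, lt_of_le_of_ne hx.2 hxe⟩ ⟨hy.1.le, lt_of_le_of_ne hy.2 hye⟩ h
  have hf : {t ∈ Set.Ioo c (c + T) | γ t ∈ S.verts}.Finite :=
    Set.Finite.of_finite_image (f := γ) (hfin.subset (by rintro _ ⟨t, ht, rfl⟩; exact ht.2))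
      ((hinj c).mono fun t ht => Set.Ioo_subset_Ico_self ht.1)
  obtain ⟨I, -, hI⟩ := exists_finset_eVariationOn hcT hγ.continuousOn (hinj c) hinj'
    (fun t _ => hcar t) hf hcV (by rw [hper c]; exact hcV) X
  refine ⟨I, fun F => ?_⟩
  rw [← hI F]
  exact eVariationOn_Icc_add_period (f := fun t => F (γ t)) (fun t => by simp only [hper t]) hc

end ArcSystem

/-! ### The number of edges of a partition -/

/-- A function on the image of a compact space is continuous if its pullback is. -/
theorem continuousOn_range_of_comp {K W Z : Type*} [TopologicalSpace K] [CompactSpace K]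
    [TopologicalSpace W] [T2Space W] [TopologicalSpace Z] {q : K → W} (hq : Continuous q)
    {G : W → Z} (hG : Continuous fun x => G (q x)) : ContinuousOn G (Set.range q) := by
  rw [continuousOn_iff_continuous_domRestrict]
  have hc : Continuous (Set.rangeFactorization q) := hq.subtype_mk _
  have hq' : Topology.IsQuotientMap (Set.rangeFactorization q) :=
    hc.isClosedMap.isQuotientMap hc Set.rangeFactorization_surjective
  rw [hq'.continuous_iff]
  exact hG

/-- A circle-valued function on a simply connected space has a continuous argument. -/
theorem exists_circleExp_eq {A : Type*} [TopologicalSpace A] [SimplyConnectedSpace A]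
    [LocallyPathConnectedSpace A] (g : C(A, Circle)) : ∃ h : C(A, ℝ), ∀ a, Circle.exp (h a) = g a := by
  obtain ⟨a₀⟩ : Nonempty A := inferInstance
  obtain ⟨e₀, he₀⟩ := Circle.exp_surjective (g a₀)
  obtain ⟨h, hh, -⟩ := Circle.isCoveringMap_exp.existsUnique_continuousMap_lifts g a₀ e₀ he₀
  exact ⟨h, fun a => congrFun hh.2 a⟩

/-- Two continuous arguments of the same function on a connected set differ by a constant. -/
theorem sub_eq_sub_of_circleExp_eq {A : Type*} [TopologicalSpace A] {s : Set A}
    (hs : IsPreconnected s) {f g : A → ℝ} (hf : ContinuousOn f s) (hg : ContinuousOn g s)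
    (h : ∀ x ∈ s, Circle.exp (f x) = Circle.exp (g x)) {x y : A} (hx : x ∈ s) (hy : y ∈ s) :
    f x - f y = g x - g y := by
  obtain ⟨m, hm⟩ := Circle.exp_eq_exp.1 (h y hy)
  have h1 : Set.EqOn f (fun x => g x + m * (2 * Real.pi)) s := by
    refine Circle.isCoveringMap_exp.eqOn_of_comp_eqOn hs hf (hg.add continuousOn_const) ?_ hy hm
    intro x hx
    simp only [Function.comp_apply]
    rw [h x hx]
    exact (Circle.exp_eq_exp.2 ⟨m, rfl⟩).symm
  have h2 : f x = _ := h1 hx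
  rw [h2, hm]
  ring

/-- The retraction of the plane onto the closed unit disc. -/
theorem exists_retraction_closedBall : ∃ ρ : C(ℂ, ℂ), (∀ x, ρ x ∈ Metric.closedBall (0 : ℂ) 1) ∧
    ∀ x ∈ Metric.closedBall (0 : ℂ) 1, ρ x = x := by
  refine ⟨⟨fun x => ((max 1 ‖x‖)⁻¹ : ℝ) • x, ?_⟩, fun x => ?_, fun x hx => ?_⟩
  · refine Continuous.smul (Continuous.inv₀ (continuous_const.max continuous_norm) fun x => ?_)
      continuous_id
    positivity
  · have h1 : 0 < max 1 ‖x‖ := by positivity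
    simp only [ContinuousMap.coe_mk, mem_closedBall_zero_iff, norm_smul, norm_inv, Real.norm_eq_abs,
      abs_of_pos h1]
    rw [inv_mul_le_iff₀ h1, mul_one]
    exact le_max_right _ _
  · rw [mem_closedBall_zero_iff] at hx
    simp [max_eq_left hx]

/-- A periodic function descends to the circle, from where it extends to the plane. -/
theorem exists_extension_of_periodic (H : C(ℝ, ℝ)) (hH : Function.Periodic H (2 * Real.pi)) :
    ∃ R : C(ℂ, ℝ), ∀ t, R (Circle.exp t) = H t := by
  have hc : Continuous (hH.lift : AddCircle (2 * Real.pi) → ℝ) :=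
    continuous_coinduced_dom.2 H.continuous
  have he : Topology.IsClosedEmbedding (fun z : Circle => (z : ℂ)) :=
    Continuous.isClosedEmbedding continuous_subtype_val Subtype.val_injective
  obtain ⟨R, hR⟩ := ContinuousMap.exists_extension he
    ((⟨hH.lift, hc⟩ : C(AddCircle (2 * Real.pi), ℝ)).comp
      ⟨AddCircle.homeomorphCircle'.symm, AddCircle.homeomorphCircle'.symm.continuous⟩)
  refine ⟨R, fun t => ?_⟩
  have h1 := congrArg (fun f => f (Circle.exp t)) hR
  simp only [ContinuousMap.comp_apply, ContinuousMap.coe_mk] at h1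
  rw [h1, ← AddCircle.homeomorphCircle'_apply_mk, Homeomorph.symm_apply_apply]
  exact Function.Periodic.lift_coe hH t

namespace DiscPartition

variable (P : DiscPartition)

theorem cell_eq_cell {P : DiscPartition} {i j : Fin P.numPieces} (hij : i ≠ j) {x y : ℂ}
    (hx : x ∈ Metric.closedBall (0 : ℂ) 1) (hy : y ∈ Metric.closedBall (0 : ℂ) 1)
    (h : P.cell i x = P.cell j y) : x ∈ Metric.sphere (0 : ℂ) 1 := by
  have h1 : P.cell i x ∈ P.cell i '' Metric.sphere 0 1 ∩ P.cell j '' Metric.sphere 0 1 := by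
    rw [← P.cell_inter i j hij]
    exact ⟨⟨x, hx, rfl⟩, ⟨y, hy, h.symm⟩⟩
  obtain ⟨⟨z, hz, hzx⟩, -⟩ := h1
  rwa [← P.cell_injOn i (Metric.sphere_subset_closedBall hz) hx hzx]

theorem circle_mem_closedBall (t : ℝ) : (Circle.exp t : ℂ) ∈ Metric.closedBall (0 : ℂ) 1 := by
  simp

theorem mem_sphere_iff_exists_exp {x : ℂ} :
    x ∈ Metric.sphere (0 : ℂ) 1 ↔ ∃ t : ℝ, (Circle.exp t : ℂ) = x := by
  constructor
  · intro h
    obtain ⟨t, ht⟩ := Circle.exp_surjective ⟨x, by simpa [Submonoid.unitSphere] using h⟩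
    exact ⟨t, by rw [ht]⟩
  · rintro ⟨t, rfl⟩
    simp

theorem continuous_cell_exp (i : Fin P.numPieces) :
    Continuous fun t : ℝ => P.cell i (Circle.exp t) :=
  (P.cell_continuousOn i).comp_continuous (by fun_prop) circle_mem_closedBall

theorem cell_exp_mem_skeleton (i : Fin P.numPieces) (t : ℝ) :
    P.cell i (Circle.exp t) ∈ P.skeleton :=
  Set.mem_iUnion.2 ⟨i, _, mem_sphere_iff_exists_exp.2 ⟨t, rfl⟩, rfl⟩

theorem skeleton_eq' : P.skeleton =
    Metric.sphere 0 1 ∪ ⋃ j, P.edge j '' Set.Icc 0 1 := P.skeleton_eq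

theorem edge_mem_skeleton (j : Fin P.numEdges) {t : ℝ} (ht : t ∈ Set.Icc (0 : ℝ) 1) :
    P.edge j t ∈ P.skeleton := by
  rw [skeleton_eq']
  exact Or.inr (Set.mem_iUnion.2 ⟨j, t, ht, rfl⟩)

theorem sphere_subset_skeleton : Metric.sphere 0 1 ⊆ P.skeleton := by
  rw [skeleton_eq']
  exact Set.subset_union_left

open Classical in
/-- The map from the `1`-skeleton to the circle that is `1` on the unit circle and winds `w j`
times around the circle on the edge `j`. -/
noncomputable def windingMap (w : Fin P.numEdges → ℤ) (x : ℂ) : Circle :=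
  if h : ∃ p : Fin P.numEdges × ℝ, p.2 ∈ Set.Ioo (0 : ℝ) 1 ∧ P.edge p.1 p.2 = x then
    Circle.exp (2 * Real.pi * (w h.choose.1 * h.choose.2)) else 1

theorem windingMap_add (w w' : Fin P.numEdges → ℤ) (x : ℂ) :
    P.windingMap (w + w') x = P.windingMap w x * P.windingMap w' x := by
  unfold windingMap
  split_ifs with h
  · rw [← Circle.exp_add]
    congr 1
    push_cast [Pi.add_apply]
    ring
  · simp

theorem windingMap_edge (w : Fin P.numEdges → ℤ) (j : Fin P.numEdges) {t : ℝ}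
    (ht : t ∈ Set.Icc (0 : ℝ) 1) :
    P.windingMap w (P.edge j t) = Circle.exp (2 * Real.pi * (w j * t)) := by
  unfold windingMap
  split_ifs with h
  · obtain ⟨h1, h2⟩ := h.choose_spec
    have hne : P.edge j t ∉ P.vertices := by
      rw [← h2]
      exact (P.edge_interior _ _ h1).1
    have ht' : t ∈ Set.Ioo (0 : ℝ) 1 := by
      refine ⟨lt_of_le_of_ne ht.1 ?_, lt_of_le_of_ne ht.2 ?_⟩
      · rintro rfl; exact hne (P.edge_zero_mem j)
      · rintro rfl; exact hne (P.edge_one_mem j)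
    have h3 : h.choose.1 = j := by
      by_contra h4
      exact Set.disjoint_left.1 (P.edge_disjoint _ _ h4) ⟨_, h1, h2⟩ ⟨t, ht', rfl⟩
    have h4 : h.choose.2 = t := by
      refine P.edge_injOn j (Set.Ioo_subset_Icc_self h1) ht ?_
      exact (congrArg (fun i => P.edge i h.choose.2) h3).symm.trans h2
    rw [h3, h4]
  · have ht' : t = 0 ∨ t = 1 := by
      by_contra! h1
      exact h ⟨(j, t), ⟨lt_of_le_of_ne ht.1 (Ne.symm h1.1), lt_of_le_of_ne ht.2 h1.2⟩, rfl⟩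
    rcases ht' with rfl | rfl
    · simp
    · rw [← Circle.exp_zero]
      exact Circle.exp_eq_exp.2 ⟨-w j, by push_cast; ring⟩

theorem windingMap_sphere (w : Fin P.numEdges → ℤ) {x : ℂ} (hx : x ∈ Metric.sphere (0 : ℂ) 1) :
    P.windingMap w x = 1 := by
  unfold windingMap
  rw [dif_neg]
  rintro ⟨p, hp, rfl⟩
  have := (P.edge_interior p.1 p.2 hp).2
  rw [mem_sphere_zero_iff_norm] at hx
  linarith

theorem continuousOn_windingMap (w : Fin P.numEdges → ℤ) :
    ContinuousOn (P.windingMap w) P.skeleton := by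
  have hK : CompactSpace ((Fin P.numEdges × Set.Icc (0 : ℝ) 1) ⊕ Metric.sphere (0 : ℂ) 1) := by
    have : CompactSpace (Metric.sphere (0 : ℂ) 1) := isCompact_iff_compactSpace.1 (isCompact_sphere 0 1)
    infer_instance
  let q : (Fin P.numEdges × Set.Icc (0 : ℝ) 1) ⊕ Metric.sphere (0 : ℂ) 1 → ℂ :=
    Sum.elim (fun p => P.edge p.1 p.2) Subtype.val
  have hq : Continuous q := by
    refine Continuous.sumElim ?_ continuous_subtype_val
    refine continuous_prod_of_discrete_left.2 fun j => ?_
    exact continuousOn_iff_continuous_domRestrict.1 (P.edge_continuousOn j)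
  have hr : Set.range q = P.skeleton := by
    rw [skeleton_eq', Set.Sum.elim_range, Set.union_comm]
    congr 1
    · exact Subtype.range_coe
    · ext x
      simp [Set.mem_iUnion]
  rw [← hr]
  refine continuousOn_range_of_comp hq ?_
  rw [continuous_sum_dom]
  constructor
  · refine (continuous_prod_of_discrete_left.2 fun j => ?_ :
      Continuous fun p : Fin P.numEdges × Set.Icc (0 : ℝ) 1 => P.windingMap w (P.edge p.1 p.2))
    have : (fun t : Set.Icc (0 : ℝ) 1 => P.windingMap w (P.edge j t)) =
        fun t : Set.Icc (0 : ℝ) 1 => Circle.exp (2 * Real.pi * (w j * t)) :=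
      funext fun t => P.windingMap_edge w j t.2
    show Continuous fun t : Set.Icc (0 : ℝ) 1 => P.windingMap w (P.edge j t)
    rw [this]
    fun_prop
  · have : (fun x : Metric.sphere (0 : ℂ) 1 => P.windingMap w x) = fun _ => 1 :=
      funext fun x => P.windingMap_sphere w x.2
    show Continuous fun x : Metric.sphere (0 : ℂ) 1 => P.windingMap w x
    rw [this]
    exact continuous_const

/-- A continuous argument of the winding map along the boundary of a piece. -/
theorem exists_lift_windingMap (w : Fin P.numEdges → ℤ) (i : Fin P.numPieces) :
    ∃ H : C(ℝ, ℝ), ∀ t, Circle.exp (H t) = P.windingMap w (P.cell i (Circle.exp t)) :=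
  exists_circleExp_eq ⟨fun t => P.windingMap w (P.cell i (Circle.exp t)),
    (P.continuousOn_windingMap w).comp_continuous (P.continuous_cell_exp i)
      (P.cell_exp_mem_skeleton i)⟩

/-- The chosen argument of the winding map along the boundary of a piece. -/
noncomputable def windingLift (w : Fin P.numEdges → ℤ) (i : Fin P.numPieces) : C(ℝ, ℝ) :=
  (P.exists_lift_windingMap w i).choose

theorem exp_windingLift (w : Fin P.numEdges → ℤ) (i : Fin P.numPieces) (t : ℝ) :
    Circle.exp (P.windingLift w i t) = P.windingMap w (P.cell i (Circle.exp t)) :=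
  (P.exists_lift_windingMap w i).choose_spec t

theorem exists_degree (w : Fin P.numEdges → ℤ) (i : Fin P.numPieces) :
    ∃ m : ℤ, P.windingLift w i (2 * Real.pi) = P.windingLift w i 0 + m * (2 * Real.pi) := by
  rw [← Circle.exp_eq_exp, exp_windingLift, exp_windingLift, Circle.exp_two_pi, Circle.exp_zero]

/-- The degree of the winding map on the boundary of a piece. -/
noncomputable def degree (w : Fin P.numEdges → ℤ) (i : Fin P.numPieces) : ℤ :=
  (P.exists_degree w i).choose

theorem windingLift_two_pi (w : Fin P.numEdges → ℤ) (i : Fin P.numPieces) :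
    P.windingLift w i (2 * Real.pi) = P.windingLift w i 0 + P.degree w i * (2 * Real.pi) :=
  (P.exists_degree w i).choose_spec

theorem degree_add (w w' : Fin P.numEdges → ℤ) (i : Fin P.numPieces) :
    P.degree (w + w') i = P.degree w i + P.degree w' i := by
  have h := sub_eq_sub_of_circleExp_eq (s := Set.univ) isPreconnected_univ
    (f := P.windingLift (w + w') i) (g := fun t => P.windingLift w i t + P.windingLift w' i t)
    (by fun_prop) (by fun_prop) (fun t _ => by
      rw [Circle.exp_add, exp_windingLift, exp_windingLift, exp_windingLift, windingMap_add])
    (Set.mem_univ (2 * Real.pi)) (Set.mem_univ 0)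
  rw [windingLift_two_pi, windingLift_two_pi, windingLift_two_pi] at h
  have h2 : ((P.degree (w + w') i : ℤ) : ℝ) * (2 * Real.pi) =
      ((P.degree w i : ℝ) + P.degree w' i) * (2 * Real.pi) := by linarith
  exact_mod_cast mul_right_cancel₀ (by positivity) h2

/-- If the winding map has degree `0` on the boundaries of all pieces, it extends over the pieces
to the disc, and thus it has a continuous argument; so the winding numbers are the differences of
the values at the vertices of a function that vanishes at the vertices on the unit circle. -/
theorem exists_potential (w : Fin P.numEdges → ℤ) (hw : ∀ i, P.degree w i = 0) :
    ∃ h : ℂ → ℝ, (∀ x ∈ Metric.sphere (0 : ℂ) 1, h x = 0) ∧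
      ∀ j, h (P.edge j 1) - h (P.edge j 0) = 2 * Real.pi * w j := by
  have hper : ∀ i, Function.Periodic (P.windingLift w i) (2 * Real.pi) := by
    intro i t
    have h := sub_eq_sub_of_circleExp_eq (s := Set.univ) isPreconnected_univ
      (f := fun t => P.windingLift w i (t + 2 * Real.pi)) (g := P.windingLift w i)
      (by fun_prop) (by fun_prop) (fun t _ => by
        rw [exp_windingLift, exp_windingLift, Circle.exp_add_two_pi])
      (Set.mem_univ t) (Set.mem_univ 0)
    simp only [zero_add] at h
    rw [windingLift_two_pi, hw i] at h
    simpa using h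
  -- the lifts along the boundaries of the pieces are extended to the pieces, and glued to a map `G`
  -- of the disc to the circle
  choose R hR using fun i => exists_extension_of_periodic _ (hper i)
  let q : (Fin P.numPieces × Metric.closedBall (0 : ℂ) 1) → ℂ := fun p => P.cell p.1 p.2
  let v : (Fin P.numPieces × Metric.closedBall (0 : ℂ) 1) → Circle :=
    fun p => Circle.exp (R p.1 p.2)
  have hvs : ∀ i (x : Metric.closedBall (0 : ℂ) 1), (x : ℂ) ∈ Metric.sphere (0 : ℂ) 1 →
      v (i, x) = P.windingMap w (P.cell i x) := by
    rintro i ⟨x, hx'⟩ hx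
    obtain ⟨t, rfl⟩ := mem_sphere_iff_exists_exp.1 hx
    simp only [v, hR, exp_windingLift]
  have hfac : Function.FactorsThrough v q := by
    rintro ⟨i, x⟩ ⟨j, y⟩ hxy
    by_cases hij : i = j
    · subst hij
      rw [Subtype.ext (P.cell_injOn i x.2 y.2 hxy)]
    · rw [hvs i x (cell_eq_cell hij x.2 y.2 hxy),
        hvs j y (cell_eq_cell (Ne.symm hij) y.2 x.2 hxy.symm)]
      exact congrArg _ hxy
  have hK : CompactSpace (Metric.closedBall (0 : ℂ) 1) :=
    isCompact_iff_compactSpace.1 (isCompact_closedBall 0 1)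
  have hq : Continuous q := continuous_prod_of_discrete_left.2 fun i =>
    continuousOn_iff_continuous_domRestrict.1 (P.cell_continuousOn i)
  let G : ℂ → Circle := Function.extend q v 1
  have hGq : ∀ p, G (q p) = v p := fun p => hfac.extend_apply _ p
  have hG : ContinuousOn G (Metric.closedBall 0 1) := by
    have hr : Set.range q = Metric.closedBall 0 1 := by
      refine Eq.trans ?_ P.iUnion_cell
      ext x
      simp [q, Set.mem_iUnion]
    rw [← hr]
    refine continuousOn_range_of_comp hq ?_
    simp only [hGq]
    refine continuous_prod_of_discrete_left.2 fun i => ?_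
    exact Circle.exp.continuous.comp ((R i).continuous.comp continuous_subtype_val)
  have hGs : ∀ x ∈ P.skeleton, G x = P.windingMap w x := by
    intro x hx
    obtain ⟨i, y, hy, rfl⟩ := Set.mem_iUnion.1 hx
    rw [← hvs i ⟨y, Metric.sphere_subset_closedBall hy⟩ hy]
    exact hGq (i, ⟨y, Metric.sphere_subset_closedBall hy⟩)
  -- `G` lifts to the real line, where the plane, retracted to the disc, serves as a simply
  -- connected domain
  obtain ⟨ρ, hρ, hρ'⟩ := exists_retraction_closedBall
  obtain ⟨L, hL⟩ := exists_circleExp_eq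
    (⟨fun x => G (ρ x), hG.comp_continuous ρ.continuous hρ⟩ : C(ℂ, Circle))
  have hskel : P.skeleton ⊆ Metric.closedBall 0 1 := by
    rw [← P.iUnion_cell]
    exact Set.iUnion_mono fun i => Set.image_mono Metric.sphere_subset_closedBall
  have hLs : ∀ x ∈ P.skeleton, Circle.exp (L x) = P.windingMap w x := by
    intro x hx
    rw [hL, ← hGs x hx]
    simp only [ContinuousMap.coe_mk, hρ' x (hskel hx)]
  refine ⟨fun x => L x - L (Circle.exp 0), fun x hx => ?_, fun j => ?_⟩
  · obtain ⟨t, rfl⟩ := mem_sphere_iff_exists_exp.1 hx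
    have h := sub_eq_sub_of_circleExp_eq (s := Set.univ) isPreconnected_univ
      (f := fun t : ℝ => L (Circle.exp t)) (g := fun _ => 0) (by fun_prop) (by fun_prop)
      (fun t _ => by
        have h1 : (Circle.exp t : ℂ) ∈ Metric.sphere (0 : ℂ) 1 :=
          mem_sphere_iff_exists_exp.2 ⟨t, rfl⟩
        rw [hLs _ (P.sphere_subset_skeleton h1), P.windingMap_sphere w h1, Circle.exp_zero])
      (Set.mem_univ t) (Set.mem_univ 0)
    simpa using h
  · have h := sub_eq_sub_of_circleExp_eq (s := Set.Icc (0 : ℝ) 1) isPreconnected_Icc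
      (f := fun t : ℝ => L (P.edge j t)) (g := fun t => 2 * Real.pi * (w j * t))
      (L.continuous.comp_continuousOn (P.edge_continuousOn j)) (by fun_prop)
      (fun t ht => by rw [hLs _ (P.edge_mem_skeleton j ht), P.windingMap_edge w j ht])
      (Set.right_mem_Icc.2 zero_le_one) (Set.left_mem_Icc.2 zero_le_one)
    simp only [mul_one, mul_zero, sub_zero] at h
    rw [← h]
    ring

/-- The vertices off the unit circle. -/
noncomputable def interiorVertices : Finset ℂ := P.vertices.filter fun v => ‖v‖ ≠ 1

/-- The half of Euler's formula that bounds the number of edges: an integral flow on the edges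
without sources off the unit circle whose winding map has degree `0` on all pieces is a gradient,
hence orthogonal to itself. -/
theorem numEdges_le : P.numEdges ≤ P.numPieces + P.interiorVertices.card := by
  classical
  let div : (Fin P.numEdges → ℤ) → ℂ → ℤ := fun w v =>
    ∑ j, ((if P.edge j 1 = v then w j else 0) - (if P.edge j 0 = v then w j else 0))
  have hdiv : ∀ w w' v, div (w + w') v = div w v + div w' v := by
    intro w w' v
    simp only [div, ← Finset.sum_add_distrib]
    refine Finset.sum_congr rfl fun j _ => ?_
    simp only [Pi.add_apply]
    split_ifs <;> ring
  let Φ : (Fin P.numEdges → ℤ) →+ (Fin P.numPieces ⊕ P.interiorVertices → ℤ) :=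
    AddMonoidHom.mk' (fun w => Sum.elim (P.degree w) fun v => div w v) (by
      intro w w'
      ext (i | v)
      · exact P.degree_add w w' i
      · exact hdiv w w' v)
  -- as `Φ` is injective, the rank of its domain is at most the rank of its codomain
  have hinj : Function.Injective Φ := by
    rw [injective_iff_map_eq_zero]
    intro w hw
    have hd : ∀ i, P.degree w i = 0 := fun i => congrFun hw (Sum.inl i)
    have hv : ∀ v ∈ P.interiorVertices, div w v = 0 := fun v hv => congrFun hw (Sum.inr ⟨v, hv⟩)
    obtain ⟨h, h0, h1⟩ := P.exists_potential w hd
    -- summation by parts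
    have hsum : ∑ j, (w j : ℝ) * (2 * Real.pi * w j) = 0 := by
      have h2 : ∀ j, (w j : ℝ) * (2 * Real.pi * w j) = ∑ v ∈ P.vertices,
          h v * (((if P.edge j 1 = v then w j else 0) -
            (if P.edge j 0 = v then w j else 0) : ℤ) : ℝ) := by
        intro j
        rw [← h1 j]
        push_cast
        simp only [mul_sub, Finset.sum_sub_distrib, mul_ite, mul_zero, Finset.sum_ite_eq,
          P.edge_one_mem j, P.edge_zero_mem j, if_true]
        ring
      rw [Finset.sum_congr rfl fun j _ => h2 j, Finset.sum_comm]
      refine Finset.sum_eq_zero fun v hv' => ?_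
      rw [← Finset.mul_sum]
      by_cases hn : ‖v‖ = 1
      · rw [h0 v (by simpa using hn), zero_mul]
      · have h3 := hv v (Finset.mem_filter.2 ⟨hv', hn⟩)
        have h4 : (∑ j, (((if P.edge j 1 = v then w j else 0) -
            (if P.edge j 0 = v then w j else 0) : ℤ) : ℝ)) = ((div w v : ℤ) : ℝ) := by
          simp only [div]
          push_cast
          rfl
        rw [h4, h3]
        simp
    ext j
    have h5 := (Finset.sum_eq_zero_iff_of_nonneg (fun j _ => by
      have : (w j : ℝ) * (2 * Real.pi * w j) = 2 * Real.pi * (w j : ℝ) ^ 2 := by ring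
      rw [this]
      positivity)).1 hsum j (Finset.mem_univ j)
    have h6 : (w j : ℝ) = 0 := by
      rcases mul_eq_zero.1 h5 with h | h
      · exact h
      · exact (mul_eq_zero.1 h).resolve_left (by positivity)
    exact_mod_cast h6
  have h := card_le_of_injective ℤ Φ.toIntLinearMap hinj
  simpa using h

/-- Each edge off the unit circle has at most two ends, while a vertex off the unit circle is an end
of at least three such edges, and a vertex on the unit circle of at least one. -/
theorem two_mul_card_interiorVertices_add_card_vertices_le :
    2 * P.interiorVertices.card + P.vertices.card ≤ 2 * P.numEdges := by
  classical
  have h1 : ∑ v ∈ P.vertices, ((Finset.univ : Finset (Fin P.numEdges)).filter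
      fun j => v = P.edge j 0 ∨ v = P.edge j 1).card =
      ∑ j : Fin P.numEdges, (P.vertices.filter fun v => v = P.edge j 0 ∨ v = P.edge j 1).card :=
    Finset.sum_card_bipartiteAbove_eq_sum_card_bipartiteBelow _
  have h2 : ∑ j : Fin P.numEdges, (P.vertices.filter
      fun v => v = P.edge j 0 ∨ v = P.edge j 1).card ≤ ∑ _j : Fin P.numEdges, 2 := by
    refine Finset.sum_le_sum fun j _ => ?_
    refine (Finset.card_le_card (t := {P.edge j 0, P.edge j 1}) fun v hv => ?_).trans
      Finset.card_le_two
    simpa using (Finset.mem_filter.1 hv).2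
  have h3 : ∑ v ∈ P.vertices, (1 + if ‖v‖ ≠ 1 then 2 else 0) ≤
      ∑ v ∈ P.vertices, ((Finset.univ : Finset (Fin P.numEdges)).filter
      fun j => v = P.edge j 0 ∨ v = P.edge j 1).card := by
    refine Finset.sum_le_sum fun v hv => ?_
    by_cases hn : ‖v‖ = 1
    · obtain ⟨j, hj⟩ := P.degree_boundary v hv hn
      have : 0 < ((Finset.univ : Finset (Fin P.numEdges)).filter
        fun j => v = P.edge j 0 ∨ v = P.edge j 1).card := Finset.card_pos.2 ⟨j, by simpa using hj⟩
      simpa [hn] using this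
    · have := P.degree_interior v hv hn
      have h4 : {j | v = P.edge j 0 ∨ v = P.edge j 1} =
          ((Finset.univ.filter fun j => v = P.edge j 0 ∨ v = P.edge j 1 :
            Finset (Fin P.numEdges)) : Set (Fin P.numEdges)) := by
        ext j
        simp
      rw [h4, Set.ncard_coe_finset] at this
      simpa [hn] using this
  have h4 : ∑ v ∈ P.vertices, (1 + if ‖v‖ ≠ 1 then 2 else 0) =
      P.vertices.card + 2 * P.interiorVertices.card := by
    rw [Finset.sum_add_distrib, ← Finset.sum_filter]
    simp only [Finset.sum_const, interiorVertices]
    simp [mul_comm]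
  have h5 : ∑ _j : Fin P.numEdges, 2 = 2 * P.numEdges := by simp [mul_comm]
  omega

/-- The number of edges is bounded in terms of the number of pieces, so that there are finitely many
combinatorial types of partitions with a given number of pieces. -/
theorem numEdges_le_three_mul : P.numEdges ≤ 3 * P.numPieces := by
  have h1 := P.numEdges_le
  have h2 := P.two_mul_card_interiorVertices_add_card_vertices_le
  have h3 : P.interiorVertices.card ≤ P.vertices.card := Finset.card_filter_le _ _
  omega

theorem card_vertices_le : P.vertices.card ≤ 6 * P.numPieces := by
  have h1 := P.numEdges_le_three_mul
  have h2 := P.two_mul_card_interiorVertices_add_card_vertices_le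
  omega

end DiscPartition

/-! ### Marked partitions and their combinatorial types -/

namespace DiscPartition

/-- A subdivision of the unit circle by the points `exp (i mark a)`, which include all vertices of
the partition on the unit circle. The bound `gap` makes the arcs between consecutive marks
embedded, also if the partition has no vertices. -/
structure Marking (P : DiscPartition) (b : ℕ) where
  mark : Fin (b + 1) → ℝ
  strictMono : StrictMono mark
  mark_zero : mark 0 = 0
  mark_last : mark (Fin.last b) = 2 * Real.pi
  gap : ∀ a : Fin b, mark a.succ - mark a.castSucc ≤ Real.pi
  exists_mark : ∀ v ∈ P.vertices, ‖v‖ = 1 → ∃ a, v = Circle.exp (mark a)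

/-- The angles of the vertices on the unit circle, together with `0`, `π`, `2 π`, form a marking. -/
theorem exists_marking (P : DiscPartition) : ∃ b ≤ P.vertices.card + 2, Nonempty (P.Marking b) := by
  classical
  have hangle : ∀ v : ℂ, ∃ t : ℝ, t ∈ Set.Ico 0 (2 * Real.pi) ∧
      (‖v‖ = 1 → v = Circle.exp t) := by
    intro v
    by_cases hv : ‖v‖ = 1
    · obtain ⟨t, ht⟩ := mem_sphere_iff_exists_exp.1 (mem_sphere_zero_iff_norm.2 hv)
      obtain ⟨s, hs, hst⟩ := Circle.periodic_exp.exists_mem_Ico₀ Real.two_pi_pos t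
      exact ⟨s, hs, fun _ => by rw [← hst, ht]⟩
    · exact ⟨0, ⟨le_rfl, Real.two_pi_pos⟩, fun h => absurd h hv⟩
  choose ang hang hang' using hangle
  let s : Finset ℝ := P.vertices.image ang ∪ {0, Real.pi, 2 * Real.pi}
  have hs0 : (0 : ℝ) ∈ s := by simp [s]
  have hsp : Real.pi ∈ s := by simp [s]
  have hs2 : 2 * Real.pi ∈ s := by simp [s]
  have hsI : ∀ t ∈ s, t ∈ Set.Icc 0 (2 * Real.pi) := by
    intro t ht
    simp only [s, Finset.mem_union, Finset.mem_image, Finset.mem_insert,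
      Finset.mem_singleton] at ht
    have := Real.pi_pos
    rcases ht with ⟨v, -, rfl⟩ | rfl | rfl | rfl
    · exact Set.Ico_subset_Icc_self (hang v)
    all_goals constructor <;> linarith
  obtain ⟨b, hb⟩ : ∃ b, s.card = b + 1 :=
    Nat.exists_eq_add_one.2 (Finset.card_pos.2 ⟨0, hs0⟩)
  have hbcard : b ≤ P.vertices.card + 2 := by
    have h1 : s.card ≤ P.vertices.card + 3 :=
      (Finset.card_union_le _ _).trans (add_le_add Finset.card_image_le Finset.card_le_three)
    omega
  let f := s.orderIsoOfFin hb
  have hsurj : ∀ t ∈ s, ∃ a, (f a : ℝ) = t := fun t ht =>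
    ⟨f.symm ⟨t, ht⟩, by simp⟩
  have hmono : StrictMono fun a => (f a : ℝ) := fun a a' h => f.strictMono h
  refine ⟨b, hbcard, ⟨⟨fun a => f a, hmono, ?_, ?_, fun a => ?_, fun v hv hv1 => ?_⟩⟩⟩
  · obtain ⟨a, ha⟩ := hsurj 0 hs0
    exact le_antisymm ((hmono.monotone (Fin.zero_le a)).trans_eq ha) (hsI _ (f 0).2).1
  · obtain ⟨a, ha⟩ := hsurj _ hs2
    exact le_antisymm (hsI _ (f _).2).2 (ha.symm.trans_le (hmono.monotone (Fin.le_last a)))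
  · obtain ⟨c, hc⟩ := hsurj _ hsp
    have h1 := (hsI _ (f a.succ).2).2
    have h2 := (hsI _ (f a.castSucc).2).1
    rcases le_or_gt c a.castSucc with h | h
    · have := hmono.monotone h
      simp only [hc] at this
      linarith
    · have := hmono.monotone (Fin.castSucc_lt_iff_succ_le.1 h)
      simp only [hc] at this
      linarith
  · obtain ⟨a, ha⟩ := hsurj (ang v) (Finset.mem_union_left _ (Finset.mem_image_of_mem _ hv))
    exact ⟨a, by rw [ha]; exact hang' v hv1⟩

namespace Marking

variable {P : DiscPartition} {b : ℕ} (M : P.Marking b)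

theorem mark_mem (a : Fin (b + 1)) : M.mark a ∈ Set.Icc 0 (2 * Real.pi) :=
  ⟨M.mark_zero.symm.trans_le (M.strictMono.monotone (Fin.zero_le a)),
    (M.strictMono.monotone (Fin.le_last a)).trans_eq M.mark_last⟩

/-- The angle at time `t` on the arc between the marks `a` and `a + 1`. -/
def angle (a : Fin b) (t : ℝ) : ℝ :=
  M.mark a.castSucc + t * (M.mark a.succ - M.mark a.castSucc)

theorem mark_lt (a : Fin b) : M.mark a.castSucc < M.mark a.succ :=
  M.strictMono a.castSucc_lt_succ

theorem angle_mem {a : Fin b} {t : ℝ} (ht : t ∈ Set.Ioo (0 : ℝ) 1) :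
    M.angle a t ∈ Set.Ioo (M.mark a.castSucc) (M.mark a.succ) := by
  have h := M.mark_lt a
  constructor
  · have := mul_pos ht.1 (sub_pos.2 h)
    unfold angle; linarith
  · have := mul_lt_mul_of_pos_right ht.2 (sub_pos.2 h)
    unfold angle; linarith

theorem angle_image (a : Fin b) :
    M.angle a '' Set.Icc 0 1 = Set.Icc (M.mark a.castSucc) (M.mark a.succ) := by
  have h := M.mark_lt a
  ext θ
  constructor
  · rintro ⟨t, ht, rfl⟩
    have h1 := mul_nonneg ht.1 (sub_pos.2 h).le
    have h2 := mul_le_mul_of_nonneg_right ht.2 (sub_pos.2 h).le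
    constructor <;> unfold angle <;> linarith
  · intro hθ
    refine ⟨(θ - M.mark a.castSucc) / (M.mark a.succ - M.mark a.castSucc), ⟨?_, ?_⟩, ?_⟩
    · exact div_nonneg (sub_nonneg.2 hθ.1) (sub_nonneg.2 h.le)
    · rw [div_le_one (sub_pos.2 h)]
      linarith [hθ.2]
    · rw [angle, div_mul_cancel₀ _ (sub_pos.2 h).ne']
      ring

theorem monotone_angle (a : Fin b) : Monotone (M.angle a) := fun s t hst => by
  unfold angle
  have := mul_le_mul_of_nonneg_right hst (sub_pos.2 (M.mark_lt a)).le
  linarith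

theorem _root_.eq_of_circleExp_eq {x y : ℝ} (hxy : |x - y| < 2 * Real.pi)
    (h : (Circle.exp x : ℂ) = Circle.exp y) : x = y := by
  obtain ⟨m, hm⟩ := Circle.exp_eq_exp.1 (Subtype.ext h)
  have h1 : |(m : ℝ)| < 1 := by
    have h2 : x - y = m * (2 * Real.pi) := by linarith
    rw [h2, abs_mul, abs_of_pos Real.two_pi_pos] at hxy
    have := Real.two_pi_pos
    by_contra! h3
    nlinarith
  have h2 : m = 0 := by
    have : |m| < 1 := by exact_mod_cast h1
    exact Int.abs_lt_one_iff.1 this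
  simpa [h2] using hm

/-- An angle between two marks is between two consecutive marks. -/
theorem exists_angle_eq {θ : ℝ} (hθ : θ ∈ Set.Icc 0 (2 * Real.pi)) :
    ∃ a : Fin b, ∃ t ∈ Set.Icc (0 : ℝ) 1, M.angle a t = θ := by
  obtain ⟨a, ha⟩ : ∃ a : Fin b, θ ∈ Set.Icc (M.mark a.castSucc) (M.mark a.succ) := by
    by_contra! h
    have h1 : ∀ c : Fin (b + 1), M.mark c ≤ θ := by
      intro c
      induction c using Fin.induction with
      | zero => rw [M.mark_zero]; exact hθ.1
      | succ c ih =>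
        by_contra! h2
        exact h c ⟨ih, h2.le⟩
    have hb : b ≠ 0 := by
      rintro rfl
      have h2 := M.mark_zero
      have h3 := M.mark_last
      rw [show Fin.last 0 = 0 from rfl, h2] at h3
      exact Real.two_pi_pos.ne h3
    obtain ⟨c, rfl⟩ := Nat.exists_eq_succ_of_ne_zero hb
    refine h (Fin.last c) ⟨h1 _, ?_⟩
    rw [Fin.succ_last, M.mark_last]
    exact hθ.2
  rw [← M.angle_image a] at ha
  exact ⟨a, ha⟩

/-- The graph formed by the unit circle, subdivided at the marks, and the edges. -/
noncomputable def arcSystem : ArcSystem (Fin P.numEdges ⊕ Fin b) ℂ where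
  arc := Sum.elim P.edge fun a t => Circle.exp (M.angle a t)
  verts := P.vertices ∪ Set.range fun a => (Circle.exp (M.mark a) : ℂ)
  continuousOn := by
    rintro (j | a)
    · exact P.edge_continuousOn j
    · refine Continuous.continuousOn ?_
      simp only [Sum.elim_inr, angle]
      fun_prop
  injOn := by
    rintro (j | a)
    · exact P.edge_injOn j
    · intro t ht t' ht' h
      have hlt := M.mark_lt a
      have hgap := M.gap a
      have h1 : M.angle a t = M.angle a t' := by
        refine eq_of_circleExp_eq ?_ h
        have h2 : M.angle a t - M.angle a t' =
            (t - t') * (M.mark a.succ - M.mark a.castSucc) := by unfold angle; ring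
        rw [h2, abs_mul, abs_of_pos (sub_pos.2 hlt)]
        have h3 : |t - t'| ≤ 1 := abs_sub_le_iff.2 ⟨by linarith [ht.2, ht'.1], by linarith [ht'.2, ht.1]⟩
        have := Real.pi_pos
        calc |t - t'| * (M.mark a.succ - M.mark a.castSucc)
            ≤ 1 * Real.pi := mul_le_mul h3 hgap (sub_pos.2 hlt).le zero_le_one
          _ < 2 * Real.pi := by linarith
      unfold angle at h1
      exact mul_right_cancel₀ (sub_pos.2 hlt).ne' (add_left_cancel h1)
  zero_mem := by
    rintro (j | a)
    · exact Or.inl (P.edge_zero_mem j)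
    · exact Or.inr ⟨a.castSucc, by simp [angle]⟩
  one_mem := by
    rintro (j | a)
    · exact Or.inl (P.edge_one_mem j)
    · exact Or.inr ⟨a.succ, congrArg (fun θ : ℝ => (Circle.exp θ : ℂ))
        (show M.mark a.succ = M.angle a 1 by unfold angle; ring)⟩
  interior_notMem := by
    have key : ∀ (a : Fin b), ∀ t ∈ Set.Ioo (0 : ℝ) 1, ∀ c,
        (Circle.exp (M.angle a t) : ℂ) ≠ Circle.exp (M.mark c) := by
      intro a t ht c h
      have h1 := M.angle_mem (a := a) ht
      have h2 := M.mark_mem c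
      have h3 := M.mark_mem a.castSucc
      have h4 := M.mark_mem a.succ
      have h5 : M.angle a t = M.mark c := by
        refine eq_of_circleExp_eq ?_ h
        rw [abs_lt]
        constructor <;> linarith [h1.1, h1.2, h2.1, h2.2, h3.1, h4.2]
      rw [h5] at h1
      have h6 := M.strictMono.lt_iff_lt.1 h1.1
      have h7 := M.strictMono.lt_iff_lt.1 h1.2
      exact (Fin.castSucc_lt_iff_succ_le.1 h6).not_gt h7
    rintro (j | a) t ht (h | ⟨c, hc⟩)
    · exact (P.edge_interior j t ht).1 h
    · have h1 := (P.edge_interior j t ht).2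
      have h2 : ‖P.edge j t‖ = 1 := by
        have : P.edge j t = Circle.exp (M.mark c) := hc.symm
        rw [this, Circle.norm_coe]
      linarith
    · obtain ⟨c, hc⟩ := M.exists_mark _ h (Circle.norm_coe _)
      exact key a t ht c hc
    · exact key a t ht c hc.symm
  disjoint := by
    have key : ∀ (j : Fin P.numEdges) (a : Fin b), Disjoint (P.edge j '' Set.Ioo 0 1)
        ((fun t => (Circle.exp (M.angle a t) : ℂ)) '' Set.Ioo 0 1) := by
      intro j a
      rw [Set.disjoint_left]
      rintro _ ⟨t, ht, rfl⟩ ⟨t', -, h⟩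
      have h1 := (P.edge_interior j t ht).2
      rw [← h] at h1
      simp at h1
    rintro (j | a) (j' | a') h
    · exact P.edge_disjoint j j' fun h' => h (congrArg _ h')
    · exact key j a'
    · exact (key j' a).symm
    · rw [Set.disjoint_left]
      rintro _ ⟨t, ht, rfl⟩ ⟨t', ht', h'⟩
      have h1 := M.angle_mem (a := a) ht
      have h1' := M.angle_mem (a := a') ht'
      have h3 := M.mark_mem a.castSucc
      have h4 := M.mark_mem a.succ
      have h3' := M.mark_mem a'.castSucc
      have h4' := M.mark_mem a'.succ
      have h5 : M.angle a' t' = M.angle a t := by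
        refine eq_of_circleExp_eq ?_ h'
        rw [abs_lt]
        constructor <;> linarith [h1.1, h1.2, h1'.1, h1'.2, h3.1, h4.2, h3'.1, h4'.2]
      rw [h5] at h1'
      have h6 := M.strictMono.lt_iff_lt.1 (h1.1.trans h1'.2)
      have h7 := M.strictMono.lt_iff_lt.1 (h1'.1.trans h1.2)
      rw [Fin.castSucc_lt_iff_succ_le, Fin.succ_le_succ_iff] at h6 h7
      exact h (congrArg _ (le_antisymm h6 h7))

theorem skeleton_subset_carrier : P.skeleton ⊆ M.arcSystem.carrier := by
  rw [skeleton_eq']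
  rintro x (hx | hx)
  · obtain ⟨t, rfl⟩ := mem_sphere_iff_exists_exp.1 hx
    obtain ⟨s, hs, hst⟩ := Circle.periodic_exp.exists_mem_Ico₀ Real.two_pi_pos t
    obtain ⟨a, r, hr, hrs⟩ := M.exists_angle_eq (Set.Ico_subset_Icc_self hs)
    refine Set.mem_iUnion.2 ⟨Sum.inr a, r, hr, ?_⟩
    simp only [arcSystem, Sum.elim_inr, hrs, hst]
  · obtain ⟨j, hj⟩ := Set.mem_iUnion.1 hx
    exact Set.mem_iUnion.2 ⟨Sum.inl j, hj⟩

/-- The boundary of each piece consists of arcs of the marked partition. -/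
theorem exists_incidence (X : Type*) [MetricSpace X] :
    ∃ I : Fin P.numPieces → Finset (Fin P.numEdges ⊕ Fin b), ∀ i (F : ℂ → X),
      P.pieceLength F i =
        ∑ c ∈ I i, eVariationOn (fun t => F (M.arcSystem.arc c t)) (Set.Icc 0 1) := by
  have h : ∀ i, ∃ I : Finset (Fin P.numEdges ⊕ Fin b), ∀ F : ℂ → X, P.pieceLength F i =
      ∑ c ∈ I, eVariationOn (fun t => F (M.arcSystem.arc c t)) (Set.Icc 0 1) := by
    intro i
    refine ArcSystem.exists_finset_eVariationOn_of_periodic (S := M.arcSystem)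
      (γ := fun t : ℝ => P.cell i (Circle.exp t)) Real.two_pi_pos ?_ (P.continuous_cell_exp i) ?_
      (fun t => M.skeleton_subset_carrier (P.cell_exp_mem_skeleton i t)) ?_ X
    · intro t
      simp only [Circle.exp_add_two_pi]
    · intro c x hx y hy h
      refine eq_of_circleExp_eq ?_
        (P.cell_injOn i (circle_mem_closedBall x) (circle_mem_closedBall y) h)
      rw [abs_lt]
      constructor <;> linarith [hx.1, hx.2, hy.1, hy.2]
    · exact (Finset.finite_toSet _).union (Set.finite_range _)
  choose I hI using h
  exact ⟨I, hI⟩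

end Marking

variable {X : Type*} [MetricSpace X]

/-- Two points on the boundary of the same piece are at most the length of the piece apart. -/
theorem edist_le_pieceLength (P : DiscPartition) (F : ℂ → X) (i : Fin P.numPieces) {x y : ℂ}
    (hx : x ∈ P.cell i '' Metric.sphere 0 1) (hy : y ∈ P.cell i '' Metric.sphere 0 1) :
    edist (F x) (F y) ≤ P.pieceLength F i := by
  have h : ∀ x ∈ P.cell i '' Metric.sphere 0 1, ∃ t ∈ Set.Icc 0 (2 * Real.pi),
      P.cell i (Circle.exp t) = x := by
    rintro _ ⟨z, hz, rfl⟩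
    obtain ⟨t, rfl⟩ := mem_sphere_iff_exists_exp.1 hz
    obtain ⟨s, hs, hst⟩ := Circle.periodic_exp.exists_mem_Ico₀ Real.two_pi_pos t
    exact ⟨s, Set.Ico_subset_Icc_self hs, by rw [hst]⟩
  obtain ⟨s, hs, rfl⟩ := h x hx
  obtain ⟨t, ht, rfl⟩ := h y hy
  exact eVariationOn.edist_le (fun t : ℝ => F (P.cell i (Circle.exp t))) hs ht

/-- The graph of pieces, with two pieces adjacent if they meet. -/
def pieceGraph (P : DiscPartition) : SimpleGraph (Fin P.numPieces) where
  Adj i j := i ≠ j ∧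
    (P.cell i '' Metric.closedBall 0 1 ∩ P.cell j '' Metric.closedBall 0 1).Nonempty
  symm := ⟨fun i j h => ⟨h.1.symm, by rw [Set.inter_comm]; exact h.2⟩⟩
  loopless := ⟨fun i h => h.1 rfl⟩

theorem pieceGraph_preconnected (P : DiscPartition) : P.pieceGraph.Preconnected := by
  intro i j
  by_contra hij
  have hcl : ∀ i, IsClosed (P.cell i '' Metric.closedBall 0 1) := fun i =>
    ((isCompact_closedBall 0 1).image_of_continuousOn (P.cell_continuousOn i)).isClosed
  have hconn : IsPreconnected (Metric.closedBall (0 : ℂ) 1) :=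
    (convex_closedBall 0 1).isPreconnected
  have hcov := P.iUnion_cell
  have hmem : ∀ i, P.cell i 0 ∈ Metric.closedBall (0 : ℂ) 1 := fun i => by
    rw [← hcov]
    exact Set.mem_iUnion.2 ⟨i, 0, by simp, rfl⟩
  let C : Set (Fin P.numPieces) := {c | P.pieceGraph.Reachable i c}
  -- otherwise the disc is the disjoint union of two closed sets, made of the pieces reachable from
  -- `i` and of the other pieces
  obtain ⟨x, -, hx1, hx2⟩ := isPreconnected_closed_iff.1 hconn
    (⋃ c ∈ C, P.cell c '' Metric.closedBall 0 1) (⋃ c ∈ Cᶜ, P.cell c '' Metric.closedBall 0 1)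
    ((Set.toFinite _).isClosed_biUnion fun c _ => hcl c)
    ((Set.toFinite _).isClosed_biUnion fun c _ => hcl c)
    (fun x hx => by
      rw [← hcov] at hx
      obtain ⟨c, hc⟩ := Set.mem_iUnion.1 hx
      by_cases h : c ∈ C
      · exact Or.inl (Set.mem_biUnion h hc)
      · exact Or.inr (Set.mem_biUnion (show c ∈ Cᶜ from h) hc))
    ⟨P.cell i 0, hmem i, Set.mem_biUnion (show i ∈ C from SimpleGraph.Reachable.refl i)
      ⟨0, by simp, rfl⟩⟩
    ⟨P.cell j 0, hmem j, Set.mem_biUnion (show j ∈ Cᶜ from hij) ⟨0, by simp, rfl⟩⟩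
  obtain ⟨c, hc, hxc⟩ := Set.mem_iUnion₂.1 hx1
  obtain ⟨c', hc', hxc'⟩ := Set.mem_iUnion₂.1 hx2
  have hne : c ≠ c' := by
    rintro rfl
    exact hc' hc
  have hadj : P.pieceGraph.Adj c c' := ⟨hne, x, hxc, hxc'⟩
  exact hc' (SimpleGraph.Reachable.trans hc hadj.reachable)

/-- As the pieces form a connected graph, the image of the skeleton has diameter at most the number
of pieces times the mesh. -/
theorem edist_le_numPieces_mul (P : DiscPartition) (F : ℂ → X) {L : ENNReal} (hL : P.mesh F ≤ L)
    {x y : ℂ} (hx : x ∈ P.skeleton) (hy : y ∈ P.skeleton) :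
    edist (F x) (F y) ≤ P.numPieces * L := by
  have hpiece : ∀ i, P.pieceLength F i ≤ L := fun i =>
    (le_iSup (fun i => P.pieceLength F i) i).trans hL
  -- along a path of pieces, each piece contributes at most `L`
  have hwalk : ∀ {i j} (p : P.pieceGraph.Walk i j), ∀ x ∈ P.cell i '' Metric.sphere 0 1,
      ∀ y ∈ P.cell j '' Metric.sphere 0 1, edist (F x) (F y) ≤ (p.length + 1 : ℕ) * L := by
    intro i j p
    induction p with
    | nil =>
      intro x hx y hy
      simpa using (P.edist_le_pieceLength F _ hx hy).trans (hpiece _)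
    | cons h p ih =>
      intro x hx y hy
      have hz := h.2
      rw [P.cell_inter _ _ h.1] at hz
      obtain ⟨z, hz1, hz2⟩ := hz
      refine (edist_triangle _ (F z) _).trans ?_
      refine (add_le_add ((P.edist_le_pieceLength F _ hx hz1).trans (hpiece _))
        (ih z hz2 y hy)).trans_eq ?_
      rw [SimpleGraph.Walk.length_cons]
      push_cast
      ring
  obtain ⟨i, hi⟩ := Set.mem_iUnion.1 hx
  obtain ⟨j, hj⟩ := Set.mem_iUnion.1 hy
  classical
  obtain ⟨p⟩ := P.pieceGraph_preconnected i j
  have hlen := p.toPath.2.length_lt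
  rw [Fintype.card_fin] at hlen
  refine (hwalk p.toPath.1 x hi y hj).trans ?_
  gcongr
  exact hlen

end DiscPartition

/-- The combinatorial data of a marked partition with a loop: the numbers of pieces, edges and
marks; which ends of edges agree with each other or with marks; and the arcs in the boundaries of
the pieces. The end `(j, false)` of the edge `j` is the point at time `0`, and `(j, true)` is the
point at time `1`. -/
structure CombType where
  pieces : ℕ
  edges : ℕ
  arcs : ℕ
  endsAgree : Fin edges × Bool → Fin edges × Bool → Prop
  endAtMark : Fin edges × Bool → Fin (arcs + 1) → Prop
  boundary : Fin pieces → Finset (Fin edges ⊕ Fin arcs)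

namespace CombType

theorem finite_setOf_le (N : ℕ) :
    {τ : CombType | τ.pieces ≤ N ∧ τ.edges ≤ N ∧ τ.arcs ≤ N}.Finite := by
  let T := Σ (k : Fin (N + 1)) (E : Fin (N + 1)) (b : Fin (N + 1)),
    (Fin E × Bool → Fin E × Bool → Prop) × (Fin E × Bool → Fin (b + 1) → Prop) ×
      (Fin k → Finset (Fin E ⊕ Fin b))
  let f : T → CombType := fun t => ⟨t.1, t.2.1, t.2.2.1, t.2.2.2.1, t.2.2.2.2.1, t.2.2.2.2.2⟩
  refine (Set.finite_range f).subset ?_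
  rintro ⟨k, E, b, R, S, I⟩ ⟨h1, h2, h3⟩
  exact ⟨⟨⟨k, Nat.lt_succ_of_le h1⟩, ⟨E, Nat.lt_succ_of_le h2⟩, ⟨b, Nat.lt_succ_of_le h3⟩, R, S, I⟩,
    rfl⟩

/-- The time at which an edge passes through its end. -/
def endTime (s : Bool) : ℝ := if s then 1 else 0

/-- The metric data that a partition of the loop `α` of the combinatorial type `τ` determines:
angles of the marks and positions in `X` of the ends of the edges such that all pieces have length
at most half the length of `α`. -/
structure Labelling (τ : CombType) {X : Type*} [MetricSpace X] (α : C(Circle, X)) where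
  mark : Fin (τ.arcs + 1) → ℝ
  monotone : Monotone mark
  mark_zero : mark 0 = 0
  mark_last : mark (Fin.last _) = 2 * Real.pi
  pos : Fin τ.edges × Bool → X
  pos_eq_pos : ∀ x y, τ.endsAgree x y → pos x = pos y
  pos_eq_loop : ∀ x a, τ.endAtMark x a → pos x = α (Circle.exp (mark a))
  length_le : ∀ i, ∑ c ∈ τ.boundary i, Sum.elim
    (fun j => edist (pos (j, false)) (pos (j, true)))
    (fun a => eVariationOn (fun t : ℝ => α (Circle.exp t))
      (Set.Icc (mark a.castSucc) (mark a.succ))) c ≤ loopLength α / 2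
  edist_pos_le : ∀ x, edist (pos x) (α 1) ≤ τ.pieces * loopLength α

end CombType

namespace DiscPartition

variable {X : Type*} [MetricSpace X] (P : DiscPartition)

/-- The combinatorial type of a marked partition. -/
abbrev combType {b : ℕ} (M : P.Marking b)
    (I : Fin P.numPieces → Finset (Fin P.numEdges ⊕ Fin b)) : CombType where
  pieces := P.numPieces
  edges := P.numEdges
  arcs := b
  endsAgree x y := P.edge x.1 (CombType.endTime x.2) = P.edge y.1 (CombType.endTime y.2)
  endAtMark x a := P.edge x.1 (CombType.endTime x.2) = Circle.exp (M.mark a)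
  boundary := I

theorem _root_.CombType.endTime_mem (s : Bool) : CombType.endTime s ∈ Set.Icc (0 : ℝ) 1 := by
  cases s <;> simp [CombType.endTime]

/-- A partition of a loop of mesh less than half its length labels its combinatorial type. -/
theorem nonempty_labelling {b : ℕ} (M : P.Marking b)
    {I : Fin P.numPieces → Finset (Fin P.numEdges ⊕ Fin b)}
    (hI : ∀ i (F : ℂ → X), P.pieceLength F i =
      ∑ c ∈ I i, eVariationOn (fun t => F (M.arcSystem.arc c t)) (Set.Icc 0 1))
    {γ : C(Circle, X)} {φ : P.vertices → X} {F : ℂ → X} (hF : P.IsGeodesicExtension γ φ F)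
    (hmesh : P.mesh F < loopLength γ / 2) : Nonempty ((P.combType M I).Labelling γ) := by
  refine ⟨⟨M.mark, M.strictMono.monotone, M.mark_zero, M.mark_last,
    fun x => F (P.edge x.1 (CombType.endTime x.2)), fun x y h => congrArg F h, fun x a h => ?_,
    fun i => ?_, fun x => ?_⟩⟩
  · rw [show P.edge x.1 (CombType.endTime x.2) = Circle.exp (M.mark a) from h, hF.eq_loop]
  · refine le_trans (le_of_eq ?_)
      ((le_iSup (fun i => P.pieceLength F i) i).trans hmesh.le)
    rw [hI i F]
    refine Finset.sum_congr rfl fun c _ => ?_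
    rcases c with j | a
    · exact (hF.geodesic j).symm
    · have h1 := eVariationOn.comp_eq_of_monotoneOn (fun t : ℝ => γ (Circle.exp t)) _
        (M.monotone_angle a |>.monotoneOn (Set.Icc 0 1))
      rw [M.angle_image a] at h1
      refine h1.symm.trans (eVariationOn.congr fun t _ => ?_)
      exact (hF.eq_loop (Circle.exp (M.angle a t))).symm
  · have h1 : (1 : ℂ) ∈ P.skeleton := P.sphere_subset_skeleton (by simp)
    have h2 := P.edist_le_numPieces_mul F (hmesh.le.trans ENNReal.half_le_self)
      (P.edge_mem_skeleton x.1 (CombType.endTime_mem x.2)) h1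
    have h3 := hF.eq_loop 1
    rw [Circle.coe_one] at h3
    rwa [h3] at h2

end DiscPartition

/-! ### Limits in the asymptotic cone -/

section Cone

open Filter Topology

variable {X : Type*} [MetricSpace X] {ω : Ultrafilter ℕ} {e : ℕ → X} {d : ScalingSequence ω}

/-- The ultrafilter is not principal, as the scaling sequence diverges. -/
theorem ScalingSequence.eventually_ge (d : ScalingSequence ω) (N : ℕ) :
    ∀ᶠ n in (ω : Filter ℕ), N ≤ n := by
  have h : (ω : Filter ℕ) ≤ cofinite := by
    rw [le_cofinite_iff_eventually_ne]
    intro n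
    filter_upwards [d.divergent.eventually_gt_atTop (d.seq n)] with m hm
    rintro rfl
    exact lt_irrefl _ hm
  rw [Nat.cofinite_eq_atTop] at h
  exact h (eventually_ge_atTop N)

/-- A diagonal argument: countably many events that hold `ω`-almost surely hold in the order of
their numbers up to a bound that tends to infinity. -/
theorem ScalingSequence.exists_diagonal (d : ScalingSequence ω) {A : ℕ → ℕ → Prop}
    (hA : ∀ k, ∀ᶠ n in (ω : Filter ℕ), A k n) :
    ∃ κ : ℕ → ℕ, Tendsto κ ω atTop ∧ ∀ᶠ n in (ω : Filter ℕ), A (κ n) n := by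
  classical
  refine ⟨fun n => Nat.findGreatest (fun k => A k n) n, tendsto_atTop.2 fun k => ?_, ?_⟩
  · filter_upwards [hA k, d.eventually_ge k] with n h1 h2
    exact Nat.le_findGreatest h2 h1
  · filter_upwards [hA 0] with n h1
    exact Nat.findGreatest_spec (P := fun k => A k n) (Nat.zero_le n) h1

variable (e d) in
/-- The sequence `x` represents a point of the asymptotic cone. -/
def IsConeSeq (x : ℕ → X) : Prop :=
  ∃ M : ℝ, ∀ᶠ n in (ω : Filter ℕ), dist (x n) (e n) / d.seq n < M

/-- The sequence as a representative of a point of the cone. -/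
def IsConeSeq.toConeSeq {x : ℕ → X} (h : IsConeSeq e d x) : ConeSeq ω e d := ⟨x, h⟩

theorem isConeSeq_base : IsConeSeq e d e := ⟨1, by simp⟩

/-- A sequence at bounded rescaled distance from a point of the cone represents a point. -/
theorem IsConeSeq.of_dist_le {x y : ℕ → X} (hx : IsConeSeq e d x) {r : ℝ}
    (h : ∀ᶠ n in (ω : Filter ℕ), dist (y n) (x n) ≤ r * d.seq n) : IsConeSeq e d y := by
  obtain ⟨M, hM⟩ := hx
  refine ⟨r + M, ?_⟩
  filter_upwards [h, hM] with n h1 h2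
  have hd := d.pos n
  rw [div_lt_iff₀ hd] at h2 ⊢
  calc dist (y n) (e n) ≤ dist (y n) (x n) + dist (x n) (e n) := dist_triangle _ _ _
    _ < (r + M) * d.seq n := by linarith

open Classical in
variable (e d) in
/-- The point of the asymptotic cone represented by a sequence; it is the base point for sequences
that represent no point. -/
noncomputable def coneMk (x : ℕ → X) : AsymptoticCone ω e d :=
  SeparationQuotient.mk
    (if h : IsConeSeq e d x then h.toConeSeq else isConeSeq_base.toConeSeq)

theorem coneMk_of_isConeSeq {x : ℕ → X} (hx : IsConeSeq e d x) :
    coneMk e d x = SeparationQuotient.mk hx.toConeSeq :=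
  congrArg SeparationQuotient.mk (dif_pos hx)

theorem coneMk_of_not_isConeSeq {x : ℕ → X} (hx : ¬ IsConeSeq e d x) :
    coneMk e d x = SeparationQuotient.mk (isConeSeq_base (e := e) (d := d)).toConeSeq :=
  congrArg SeparationQuotient.mk (dif_neg hx)

theorem exists_coneMk_eq (p : AsymptoticCone ω e d) : ∃ x, IsConeSeq e d x ∧ coneMk e d x = p := by
  obtain ⟨⟨x, hx⟩, rfl⟩ := SeparationQuotient.surjective_mk p
  exact ⟨x, hx, coneMk_of_isConeSeq hx⟩

theorem tendsto_dist_coneMk {x y : ℕ → X} (hx : IsConeSeq e d x) (hy : IsConeSeq e d y) :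
    Tendsto (fun n => dist (x n) (y n) / d.seq n) ω (𝓝 (dist (coneMk e d x) (coneMk e d y))) := by
  rw [coneMk_of_isConeSeq hx, coneMk_of_isConeSeq hy]
  exact ConeSeq.tendsto_limDist hx.toConeSeq hy.toConeSeq

theorem dist_coneMk_le {x y : ℕ → X} (hx : IsConeSeq e d x) (hy : IsConeSeq e d y) {r : ℝ}
    (h : ∀ᶠ n in (ω : Filter ℕ), dist (x n) (y n) ≤ r * d.seq n) :
    dist (coneMk e d x) (coneMk e d y) ≤ r := by
  refine le_of_tendsto (tendsto_dist_coneMk hx hy) ?_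
  filter_upwards [h] with n hn
  rwa [div_le_iff₀ (d.pos n)]

theorem coneMk_eq_coneMk {x y : ℕ → X} (hx : IsConeSeq e d x) (hy : IsConeSeq e d y)
    (h : Tendsto (fun n => dist (x n) (y n) / d.seq n) ω (𝓝 0)) : coneMk e d x = coneMk e d y :=
  dist_eq_zero.1 (tendsto_nhds_unique (tendsto_dist_coneMk hx hy) h)

theorem coneMk_congr {x y : ℕ → X} (h : ∀ᶠ n in (ω : Filter ℕ), x n = y n) :
    coneMk e d x = coneMk e d y := by
  have hiff : ∀ {x y : ℕ → X}, (∀ᶠ n in (ω : Filter ℕ), x n = y n) → IsConeSeq e d x →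
      IsConeSeq e d y := fun h hx => hx.of_dist_le (r := 0) <| by
    filter_upwards [h] with n hn
    simp [hn]
  by_cases hx : IsConeSeq e d x
  · refine coneMk_eq_coneMk hx (hiff h hx) (tendsto_const_nhds.congr' ?_)
    filter_upwards [h] with n hn
    simp [hn]
  · have hy : ¬ IsConeSeq e d y := fun hy => hx (hiff (h.mono fun n hn => hn.symm) hy)
    rw [coneMk_of_not_isConeSeq hx, coneMk_of_not_isConeSeq hy]

/-- A Cauchy sequence converges to the diagonal sequence of its representatives; the space `X` itself
need not be complete. -/
theorem completeSpace_asymptoticCone : CompleteSpace (AsymptoticCone ω e d) := by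
  refine Metric.complete_of_convergent_controlled_sequences (fun N => (1 / 2 : ℝ) ^ N)
    (fun N => by positivity) fun u hu => ?_
  choose x hx hxu using fun k => exists_coneMk_eq (u k)
  have hA : ∀ k, ∀ᶠ n in (ω : Filter ℕ), ∀ N ≤ k,
      dist (x k n) (x N n) ≤ (1 / 2 : ℝ) ^ N * d.seq n := by
    intro k
    refine (Set.finite_le_nat k).eventually_all.2 fun N hN => ?_
    have h1 : dist (coneMk e d (x k)) (coneMk e d (x N)) < (1 / 2 : ℝ) ^ N := by
      rw [hxu, hxu]
      exact hu N k N hN le_rfl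
    filter_upwards [(tendsto_dist_coneMk (hx k) (hx N)).eventually_lt_const h1] with n hn
    exact ((div_lt_iff₀ (d.pos n)).1 hn).le
  obtain ⟨κ, hκ, hκA⟩ := d.exists_diagonal hA
  have hy : ∀ N, ∀ᶠ n in (ω : Filter ℕ),
      dist (x (κ n) n) (x N n) ≤ (1 / 2 : ℝ) ^ N * d.seq n := by
    intro N
    filter_upwards [hκA, hκ.eventually_ge_atTop N] with n h1 h2
    exact h1 N h2
  have hyc : IsConeSeq e d fun n => x (κ n) n := (hx 0).of_dist_le (hy 0)
  refine ⟨coneMk e d fun n => x (κ n) n, ?_⟩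
  rw [tendsto_iff_dist_tendsto_zero]
  refine squeeze_zero (fun _ => dist_nonneg) (fun N => ?_)
    (tendsto_pow_atTop_nhds_zero_of_lt_one (r := (1 / 2 : ℝ)) (by norm_num) (by norm_num))
  rw [← hxu N, dist_comm]
  exact dist_coneMk_le hyc (hx N) (hy N)

variable (d) in
/-- The maps `G n`, rescaled by `d n`, are asymptotically equicontinuous on `s`. -/
def AsympEquicontinuousOn {Z : Type*} [TopologicalSpace Z] (G : ℕ → Z → X) (s : Set Z) : Prop :=
  ∀ (z : ℕ → Z) (w : Z), w ∈ s → (∀ᶠ n in (ω : Filter ℕ), z n ∈ s) → Tendsto z ω (𝓝 w) →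
    Tendsto (fun n => dist (G n (z n)) (G n w) / d.seq n) ω (𝓝 0)

/-- The limit of an asymptotically equicontinuous sequence of maps is continuous. -/
theorem AsympEquicontinuousOn.continuousOn_coneMk {Z : Type*} [MetricSpace Z] {G : ℕ → Z → X}
    {s : Set Z} (hG : AsympEquicontinuousOn d G s)
    (hb : ∀ z ∈ s, IsConeSeq e d fun n => G n z) :
    ContinuousOn (fun z => coneMk e d fun n => G n z) s := by
  refine Metric.continuousOn_iff.2 fun w hw η hη => ?_
  by_contra! hcon
  choose z hz using fun k : ℕ => hcon (1 / (k + 1)) (by positivity)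
  have hA : ∀ k, ∀ᶠ n in (ω : Filter ℕ), η / 2 * d.seq n < dist (G n (z k)) (G n w) := by
    intro k
    have h1 := tendsto_dist_coneMk (hb _ (hz k).1) (hb w hw)
    filter_upwards [h1.eventually_const_lt ((half_lt_self hη).trans_le (hz k).2.2)] with n hn
    rwa [lt_div_iff₀ (d.pos n)] at hn
  obtain ⟨κ, hκ, hκA⟩ := d.exists_diagonal hA
  have hzw : Tendsto (fun n => z (κ n)) ω (𝓝 w) := by
    refine Tendsto.comp ?_ hκ
    rw [tendsto_iff_dist_tendsto_zero]
    exact squeeze_zero (fun _ => dist_nonneg) (fun k => (hz k).2.1.le)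
      tendsto_one_div_add_atTop_nhds_zero_nat
  have h1 := hG _ w hw (Eventually.of_forall fun n => (hz (κ n)).1) hzw
  obtain ⟨n, h2, h3⟩ := (hκA.and (h1.eventually_lt_const (half_pos hη))).exists
  rw [div_lt_iff₀ (d.pos n)] at h3
  exact lt_asymm h2 h3

theorem AsympEquicontinuousOn.comp {Z W : Type*} [TopologicalSpace Z] [TopologicalSpace W]
    {G : ℕ → Z → X} {s : Set Z} (hG : AsympEquicontinuousOn d G s) {h : W → Z}
    (hh : Continuous h) (hs : ∀ w, h w ∈ s) :
    AsympEquicontinuousOn d (fun n w => G n (h w)) Set.univ := fun z w _ _ hzw =>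
  hG (fun n => h (z n)) (h w) (hs w) (Eventually.of_forall fun _ => hs _)
    ((hh.tendsto w).comp hzw)

/-- Asymptotic equicontinuity on a compact quotient can be checked upstairs. -/
theorem AsympEquicontinuousOn.of_comp {K W : Type*} [TopologicalSpace K] [CompactSpace K]
    [TopologicalSpace W] [T2Space W] {q : K → W} (hq : Continuous q) {G : ℕ → W → X}
    (hG : AsympEquicontinuousOn d (fun n x => G n (q x)) Set.univ) :
    AsympEquicontinuousOn d G (Set.range q) := by
  rintro z _ ⟨w, rfl⟩ hz hzw
  have hz' : ∀ n, ∃ y, z n ∈ Set.range q → q y = z n := fun n => by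
    by_cases h : z n ∈ Set.range q
    · obtain ⟨y, hy⟩ := h
      exact ⟨y, fun _ => hy⟩
    · exact ⟨w, fun h' => absurd h' h⟩
  choose y hy using hz'
  -- the lifts of the `z n` converge by compactness, to a point over the limit of the `z n`
  obtain ⟨y₀, -, hy₀⟩ := isCompact_univ.ultrafilter_le_nhds (ω.map y) (by simp)
  have hyt : Tendsto y ω (𝓝 y₀) := hy₀
  have hqy : q y₀ = q w := by
    refine tendsto_nhds_unique ((hq.tendsto y₀).comp hyt) (hzw.congr' ?_)
    filter_upwards [hz] with n hn
    exact (hy n hn).symm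
  have h1 := hG y y₀ (Set.mem_univ _) (by simp) hyt
  refine h1.congr' ?_
  filter_upwards [hz] with n hn
  rw [hy n hn, hqy]

/-- Two sequences with the same limit in a compact space have asymptotically equal images. -/
theorem AsympEquicontinuousOn.tendsto_of_tendsto {Z : Type*} [TopologicalSpace Z]
    {G : ℕ → Z → X} (hG : AsympEquicontinuousOn d G Set.univ) {z z' : ℕ → Z} {w : Z}
    (hz : Tendsto z ω (𝓝 w)) (hz' : Tendsto z' ω (𝓝 w)) :
    Tendsto (fun n => dist (G n (z n)) (G n (z' n)) / d.seq n) ω (𝓝 0) := by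
  have h1 := hG z w (Set.mem_univ _) (by simp) hz
  have h2 := hG z' w (Set.mem_univ _) (by simp) hz'
  have h3 := h1.add h2
  rw [add_zero] at h3
  refine squeeze_zero (fun n => div_nonneg dist_nonneg (d.pos n).le) (fun n => ?_) h3
  rw [← add_div]
  have := d.pos n
  gcongr
  exact dist_triangle_right _ _ _

end Cone

/-! ### Recursive fillings -/

theorem dist_le_of_mem_closure {Y : Type*} [MetricSpace Y] {s : Set Y} {η : ℝ}
    (h : ∀ y ∈ s, ∀ y' ∈ s, dist y y' ≤ η) {y y' : Y} (hy : y ∈ closure s) (hy' : y' ∈ closure s) :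
    dist y y' ≤ η := by
  have h2 : (y, y') ∈ closure (s ×ˢ s) := by
    rw [closure_prod_eq]
    exact ⟨hy, hy'⟩
  have h3 : IsClosed {p : Y × Y | dist p.1 p.2 ≤ η} := isClosed_le (by fun_prop) (by fun_prop)
  exact closure_minimal (fun p hp => h _ hp.1 _ hp.2) h3 h2

/-- One step of a recursive construction of a map from `D` to `Y`: the space `D` is the union of a
closed set `A`, on which the map is `F`, and of finitely many copies of `D`, on which the map is
given by the states `child i`. The copies meet `A` and each other only in the images of `bd`. -/
structure FillStep {D : Type*} [TopologicalSpace D] (bd : Set D) (S Y : Type*)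
    [TopologicalSpace Y] where
  k : ℕ
  A : Set D
  F : D → Y
  c : Fin k → D → D
  child : Fin k → S
  isClosed_A : IsClosed A
  continuousOn_F : ContinuousOn F A
  isEmbedding_c : ∀ i, Topology.IsClosedEmbedding (c i)
  cover : ∀ x, x ∈ A ∨ ∃ i y, c i y = x
  bd_subset : bd ⊆ A
  c_mem_A : ∀ i y, c i y ∈ A ↔ y ∈ bd
  overlap : ∀ i i' y y', i ≠ i' → c i y = c i' y' → y ∈ bd

/-- If every state of level `j` with boundary values `e σ` admits a step whose children are states
of level `j + 1`, and the values at level `j` are confined to nested sets `B j σ` whose diameters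
tend to `0`, then the recursion converges to a continuous map. The copies of `D` need not shrink:
finitely many copies of level `j` form a neighbourhood of each point, which the map sends to a set
of small diameter. -/
theorem exists_filling_of_steps {D S Y : Type*} [TopologicalSpace D] {bd : Set D} [MetricSpace Y]
    [CompleteSpace Y] (good : ℕ → S → Prop) (e : S → D → Y) (B : ℕ → S → Set Y)
    (step : ∀ j σ, good j σ → ∃ T : FillStep bd S Y, (∀ x ∈ bd, T.F x = e σ x) ∧
      (∀ x, T.F x ∈ B j σ) ∧ ∀ i, good (j + 1) (T.child i) ∧ B (j + 1) (T.child i) ⊆ B j σ ∧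
        ∀ y ∈ bd, e (T.child i) y = T.F (T.c i y))
    (hdiam : ∀ η > 0, ∃ M, ∀ j ≥ M, ∀ σ, good j σ → ∀ y ∈ B j σ, ∀ y' ∈ B j σ, dist y y' ≤ η)
    {σ : S} (hσ : good 0 σ) :
    ∃ f : C(D, Y), (∀ x ∈ bd, f x = e σ x) ∧ ∀ x, f x ∈ closure (B 0 σ) := by
  classical
  let G := {p : ℕ × S // good p.1 p.2}
  choose T hTe hTB hTc using fun g : G => step g.1.1 g.1.2 g.2
  choose hTg hTsub hTbd using hTc
  let child : (g : G) → Fin (T g).k → G := fun g i => ⟨(g.1.1 + 1, (T g).child i), hTg g i⟩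
  -- `approx m g` is the map after `m` recursive calls
  obtain ⟨approx, happrox0, happroxS⟩ : ∃ approx : ℕ → G → D → Y,
      (∀ g x, approx 0 g x = (T g).F x) ∧ ∀ m g x, approx (m + 1) g x =
        if x ∈ (T g).A then (T g).F x else
        if h : ∃ p : Fin (T g).k × D, (T g).c p.1 p.2 = x then
          approx m (child g h.choose.1) h.choose.2
        else (T g).F x :=
    ⟨fun m => Nat.rec (fun g x => (T g).F x)
      (fun _ f g x => if x ∈ (T g).A then (T g).F x else
        if h : ∃ p : Fin (T g).k × D, (T g).c p.1 p.2 = x then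
          f (child g h.choose.1) h.choose.2 else (T g).F x) m,
      fun _ _ => rfl, fun _ _ _ => rfl⟩
  have happroxA : ∀ m g, ∀ x ∈ (T g).A, approx m g x = (T g).F x := by
    rintro (_ | m) g x hx
    · exact happrox0 g x
    · rw [happroxS, if_pos hx]
  have happroxc : ∀ m g i y, approx (m + 1) g ((T g).c i y) = approx m (child g i) y := by
    intro m g i y
    by_cases hy : y ∈ bd
    · rw [happroxA _ _ _ (((T g).c_mem_A i y).2 hy), happroxA _ _ _ ((T _).bd_subset hy),
        hTe _ _ hy]
      exact (hTbd g i y hy).symm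
    · have hn : (T g).c i y ∉ (T g).A := fun h => hy (((T g).c_mem_A i y).1 h)
      have h : ∃ p : Fin (T g).k × D, (T g).c p.1 p.2 = (T g).c i y := ⟨(i, y), rfl⟩
      have h1 : approx (m + 1) g ((T g).c i y) = approx m (child g h.choose.1) h.choose.2 :=
        (happroxS _ _ _).trans ((if_neg hn).trans (dif_pos h))
      rw [h1]
      have h2 : h.choose.1 = i := by
        by_contra h3
        exact hy ((T g).overlap _ _ _ _ (Ne.symm h3) h.choose_spec.symm)
      have h3 : h.choose.2 = y := by
        refine ((T g).isEmbedding_c i).injective ?_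
        exact (congrArg (fun a => (T g).c a h.choose.2) h2).symm.trans h.choose_spec
      rw [h2, h3]
  have hcases : ∀ (g : G) (p : D → Prop), (∀ x ∈ (T g).A, p x) → (∀ i y, p ((T g).c i y)) →
      ∀ x, p x := by
    intro g p h1 h2 x
    rcases (T g).cover x with h | ⟨i, y, rfl⟩
    · exact h1 x h
    · exact h2 i y
  have happroxB : ∀ m g x, approx m g x ∈ B g.1.1 g.1.2 := by
    intro m
    induction m with
    | zero =>
      intro g x
      rw [happrox0]
      exact hTB g x
    | succ m ih =>
      intro g
      refine hcases g _ (fun x hx => ?_) fun i y => ?_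
      · rw [happroxA _ _ _ hx]
        exact hTB g x
      · rw [happroxc]
        exact hTsub g i (ih (child g i) y)
  -- at levels beyond `M`, further calls move no value by more than `η`
  have hcauchy : ∀ M η, (∀ j ≥ M, ∀ σ, good j σ → ∀ y ∈ B j σ, ∀ y' ∈ B j σ, dist y y' ≤ η) →
      ∀ m (g : G) p x, M ≤ g.1.1 + m → 0 ≤ η → dist (approx m g x) (approx (m + p) g x) ≤ η := by
    intro M η hM m
    induction m with
    | zero => exact fun g p x hg _ => hM _ hg _ g.2 _ (happroxB _ _ _) _ (happroxB _ _ _)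
    | succ m ih =>
      intro g p x hg hη
      revert x
      refine hcases g _ (fun x hx => ?_) fun i y => ?_
      · rw [happroxA _ _ _ hx, happroxA _ _ _ hx, dist_self]
        exact hη
      · rw [show m + 1 + p = m + p + 1 by ring, happroxc, happroxc]
        exact ih (child g i) p y (by show M ≤ g.1.1 + 1 + m; omega) hη
  have hlim : ∀ g x, ∃ y, Filter.Tendsto (fun m => approx m g x) Filter.atTop (nhds y) := by
    intro g x
    refine cauchySeq_tendsto_of_complete (Metric.cauchySeq_iff'.2 fun η hη => ?_)
    obtain ⟨M, hM⟩ := hdiam (η / 2) (half_pos hη)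
    refine ⟨M, fun n hn => ?_⟩
    obtain ⟨p, rfl⟩ := Nat.exists_eq_add_of_le hn
    rw [dist_comm]
    exact (hcauchy M _ hM M g p x (Nat.le_add_left _ _) (half_pos hη).le).trans_lt (half_lt_self hη)
  choose f hf using hlim
  have hfA : ∀ g, ∀ x ∈ (T g).A, f g x = (T g).F x := fun g x hx =>
    tendsto_nhds_unique (hf g x) (by simp only [happroxA _ _ _ hx]; exact tendsto_const_nhds)
  have hfc : ∀ g i y, f g ((T g).c i y) = f (child g i) y := fun g i y => by
    refine tendsto_nhds_unique ((Filter.tendsto_add_atTop_iff_nat 1).2 (hf g _)) ?_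
    simp only [happroxc]
    exact hf _ _
  have hfB : ∀ g x, f g x ∈ closure (B g.1.1 g.1.2) := fun g x =>
    mem_closure_of_tendsto (hf g x) (Filter.Eventually.of_forall fun m => happroxB m g x)
  -- the oscillation of the limit at a point is controlled after `m` levels, as `A` and the finitely
  -- many copies of the domain form a finite closed cover
  have hosc : ∀ M η, 0 < η →
      (∀ j ≥ M, ∀ σ, good j σ → ∀ y ∈ B j σ, ∀ y' ∈ B j σ, dist y y' ≤ η) →
      ∀ m (g : G) x, M ≤ g.1.1 + m → ∀ᶠ x' in nhds x, dist (f g x') (f g x) ≤ η := by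
    intro M η hη hM m
    induction m with
    | zero =>
      intro g x hg
      exact Filter.Eventually.of_forall fun x' =>
        dist_le_of_mem_closure (hM _ hg _ g.2) (hfB _ _) (hfB _ _)
    | succ m ih =>
      intro g x hg
      have hcov : (Set.univ : Set D) = (T g).A ∪ ⋃ i, Set.range ((T g).c i) := by
        refine (Set.eq_univ_of_forall fun x => ?_).symm
        rcases (T g).cover x with h | ⟨i, y, h⟩
        · exact Or.inl h
        · exact Or.inr (Set.mem_iUnion.2 ⟨i, y, h⟩)
      rw [← nhdsWithin_univ, hcov, nhdsWithin_union, Filter.eventually_sup, nhdsWithin_iUnion,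
        Filter.eventually_iSup]
      constructor
      · by_cases hx : x ∈ (T g).A
        · have h1 : ∀ᶠ x' in nhdsWithin x (T g).A, dist ((T g).F x') ((T g).F x) < η :=
            (T g).continuousOn_F x hx (Metric.ball_mem_nhds _ hη)
          filter_upwards [h1, self_mem_nhdsWithin] with x' h2 h3
          rw [hfA g x' h3, hfA g x hx]
          exact h2.le
        · rw [← (T g).isClosed_A.closure_eq, mem_closure_iff_nhdsWithin_neBot,
            Filter.not_neBot] at hx
          rw [hx]
          exact Filter.eventually_bot
      · intro i
        by_cases hx : x ∈ Set.range ((T g).c i)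
        · obtain ⟨y, rfl⟩ := hx
          rw [← ((T g).isEmbedding_c i).isEmbedding.map_nhds_eq, Filter.eventually_map]
          filter_upwards [ih (child g i) y (by show M ≤ g.1.1 + 1 + m; omega)] with y' hy'
          rwa [hfc, hfc]
        · rw [← ((T g).isEmbedding_c i).isClosed_range.closure_eq, mem_closure_iff_nhdsWithin_neBot,
            Filter.not_neBot] at hx
          rw [hx]
          exact Filter.eventually_bot
  let g₀ : G := ⟨(0, σ), hσ⟩
  refine ⟨⟨f g₀, continuous_iff_continuousAt.2 fun x => ?_⟩, fun x hx => ?_, fun x => hfB g₀ x⟩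
  · refine Metric.tendsto_nhds.2 fun η hη => ?_
    obtain ⟨M, hM⟩ := hdiam (η / 2) (half_pos hη)
    filter_upwards [hosc M _ (half_pos hη) hM M g₀ x (Nat.le_add_left _ _)] with x' hx'
    exact hx'.trans_lt (half_lt_self hη)
  · exact (hfA g₀ x ((T g₀).bd_subset hx)).trans (hTe g₀ x hx)

/-! ### Dividing a sequence of loops -/

open Filter Topology

section

variable {X : Type*} [MetricSpace X] {ω : Ultrafilter ℕ} {e : ℕ → X} {d : ScalingSequence ω}

theorem AsympEquicontinuousOn.iUnion {ι Z : Type*} [Finite ι] [TopologicalSpace Z] {G : ℕ → Z → X}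
    {s : ι → Set Z} (hs : ∀ i, IsClosed (s i)) (hG : ∀ i, AsympEquicontinuousOn d G (s i)) :
    AsympEquicontinuousOn d G (⋃ i, s i) := by
  intro z w _ hz hzw
  simp only [Set.mem_iUnion] at hz
  obtain ⟨i, hi⟩ := Ultrafilter.eventually_exists_iff.1 hz
  exact hG i z w ((hs i).mem_of_tendsto hzw hi) hi hzw

/-- A choice of a constant speed geodesic between any two points. -/
structure GeodesicChoice (X : Type*) [MetricSpace X] where
  path : X → X → ℝ → X
  path_zero : ∀ x y, path x y 0 = x
  path_one : ∀ x y, path x y 1 = y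
  dist_path : ∀ x y, ∀ s ∈ Set.Icc (0 : ℝ) 1, ∀ t ∈ Set.Icc (0 : ℝ) 1,
    dist (path x y s) (path x y t) = |s - t| * dist x y

theorem IsGeodesicSpace.nonempty_geodesicChoice (hX : IsGeodesicSpace X) :
    Nonempty (GeodesicChoice X) := by
  choose c h0 h1 hc using hX
  refine ⟨⟨fun x y t => c x y (dist x y * t), fun x y => by simp [h0], fun x y => by simp [h1],
    fun x y s hs t ht => ?_⟩⟩
  have hmem : ∀ s ∈ Set.Icc (0 : ℝ) 1, dist x y * s ∈ Set.Icc 0 (dist x y) := fun s hs =>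
    ⟨mul_nonneg dist_nonneg hs.1, mul_le_of_le_one_right dist_nonneg hs.2⟩
  rw [hc x y _ (hmem s hs) _ (hmem t ht), ← mul_sub, abs_mul, abs_of_nonneg dist_nonneg, mul_comm]

namespace GeodesicChoice

variable (c : GeodesicChoice X)

theorem path_endTime (y : Bool → X) (s : Bool) :
    c.path (y false) (y true) (CombType.endTime s) = y s := by
  cases s
  · exact c.path_zero _ _
  · exact c.path_one _ _

theorem lipschitzOnWith_path (x y : X) :
    LipschitzOnWith (nndist x y) (c.path x y) (Set.Icc 0 1) :=
  LipschitzOnWith.of_dist_le_mul fun s hs t ht => by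
    rw [c.dist_path x y s hs t ht, Real.dist_eq, mul_comm, coe_nndist]

theorem continuousOn_path (x y : X) : ContinuousOn (c.path x y) (Set.Icc 0 1) :=
  (c.lipschitzOnWith_path x y).continuousOn

theorem eVariationOn_path_le (x y : X) :
    eVariationOn (c.path x y) (Set.Icc 0 1) ≤ edist x y := by
  have h1 := (c.lipschitzOnWith_path x y).comp_eVariationOn_le (Set.mapsTo_id (Set.Icc (0 : ℝ) 1))
  have h2 := (monotone_id (α := ℝ)).monotoneOn Set.univ |>.eVariationOn_eq
    (Set.mem_univ (0 : ℝ)) (Set.mem_univ 1)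
  simp only [Set.univ_inter, id, sub_zero, ENNReal.ofReal_one] at h2
  refine h1.trans ((mul_le_mul_right h2.le _).trans_eq ?_)
  rw [mul_one, edist_nndist]

theorem dist_path_left_le (x y : X) {t : ℝ} (ht : t ∈ Set.Icc (0 : ℝ) 1) :
    dist (c.path x y t) x ≤ dist x y := by
  have h := c.dist_path x y t ht 0 ⟨le_rfl, zero_le_one⟩
  rw [c.path_zero] at h
  rw [h, sub_zero, abs_of_nonneg ht.1]
  exact mul_le_of_le_one_left dist_nonneg ht.2

end GeodesicChoice

/-- Two points of a loop are at most its length apart. -/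
theorem edist_le_loopLength (γ : C(Circle, X)) (z w : Circle) :
    edist (γ z) (γ w) ≤ loopLength γ := by
  have h : ∀ z : Circle, ∃ t ∈ Set.Icc 0 (2 * Real.pi), Circle.exp t = z := by
    intro z
    obtain ⟨t, rfl⟩ := Circle.exp_surjective z
    obtain ⟨s, hs, hst⟩ := Circle.periodic_exp.exists_mem_Ico₀ Real.two_pi_pos t
    exact ⟨s, Set.Ico_subset_Icc_self hs, hst.symm⟩
  obtain ⟨s, hs, rfl⟩ := h z
  obtain ⟨t, ht, rfl⟩ := h w
  exact eVariationOn.edist_le (fun t : ℝ => γ (Circle.exp t)) hs ht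

theorem dist_le_of_edist_le_ofReal {x y : X} {r : ℝ} (hr : 0 ≤ r)
    (h : edist x y ≤ ENNReal.ofReal r) : dist x y ≤ r := by
  rw [edist_dist] at h
  exact (ENNReal.ofReal_le_ofReal_iff hr).1 h

end

namespace DiscPartition

variable {P : DiscPartition} {b : ℕ}

namespace Marking

variable (M : P.Marking b)

/-- The piecewise linear map that sends the marks of `M` to the numbers `m a - m 0`. -/
noncomputable def reparam (m : Fin (b + 1) → ℝ) (θ : ℝ) : ℝ :=
  ∑ a : Fin b, (m a.succ - m a.castSucc) *
    max 0 (min 1 ((θ - M.mark a.castSucc) / (M.mark a.succ - M.mark a.castSucc)))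

theorem sum_ite_lt (m : Fin (b + 1) → ℝ) (c : Fin (b + 1)) :
    ∑ a : Fin b, (if a.castSucc < c then m a.succ - m a.castSucc else 0) = m c - m 0 := by
  induction c using Fin.induction with
  | zero => simp
  | succ c ih =>
    have h1 : ∀ a : Fin b, (if a.castSucc < c.succ then m a.succ - m a.castSucc else 0) =
        (if a.castSucc < c.castSucc then m a.succ - m a.castSucc else 0) +
          if a = c then m a.succ - m a.castSucc else 0 := by
      intro a
      rcases lt_trichotomy a c with h | rfl | h
      · have h2 : a.castSucc < c.castSucc := h
        rw [if_pos h2, if_pos (h2.trans c.castSucc_lt_succ), if_neg h.ne, add_zero]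
      · rw [if_pos a.castSucc_lt_succ, if_neg (lt_irrefl _), if_pos rfl, zero_add]
      · rw [if_neg, if_neg, if_neg h.ne', add_zero]
        · exact fun h2 => lt_asymm h h2
        · rw [Fin.castSucc_lt_succ_iff]
          exact not_le.2 h
    rw [Finset.sum_congr rfl fun a _ => h1 a, Finset.sum_add_distrib, ih]
    simp

theorem reparam_angle (m : Fin (b + 1) → ℝ) (a : Fin b) {t : ℝ} (ht : t ∈ Set.Icc (0 : ℝ) 1) :
    M.reparam m (M.angle a t) =
      m a.castSucc - m 0 + t * (m a.succ - m a.castSucc) := by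
  have hI : M.angle a t ∈ Set.Icc (M.mark a.castSucc) (M.mark a.succ) := by
    rw [← M.angle_image a]
    exact ⟨t, ht, rfl⟩
  have h1 : ∀ a' : Fin b, (m a'.succ - m a'.castSucc) * max 0 (min 1 ((M.angle a t -
      M.mark a'.castSucc) / (M.mark a'.succ - M.mark a'.castSucc))) =
      (if a'.castSucc < a.castSucc then m a'.succ - m a'.castSucc else 0) +
        if a' = a then t * (m a'.succ - m a'.castSucc) else 0 := by
    intro a'
    have hpos := sub_pos.2 (M.mark_lt a')
    rcases lt_trichotomy a' a with h | rfl | h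
    · have h2 : a'.castSucc < a.castSucc := h
      have h3 : M.mark a'.succ ≤ M.mark a.castSucc :=
        M.strictMono.monotone (Fin.castSucc_lt_iff_succ_le.1 h2)
      rw [if_pos h2, if_neg h.ne, add_zero, min_eq_left, max_eq_right zero_le_one, mul_one]
      rw [one_le_div hpos]
      linarith [hI.1]
    · have h2 : (M.angle a' t - M.mark a'.castSucc) / (M.mark a'.succ - M.mark a'.castSucc) = t := by
        rw [div_eq_iff hpos.ne', angle]
        ring
      rw [h2, if_neg (lt_irrefl _), if_pos rfl, zero_add, min_eq_right ht.2, max_eq_right ht.1,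
        mul_comm]
    · have h2 : a.castSucc < a'.castSucc := h
      have h3 : M.mark a.succ ≤ M.mark a'.castSucc :=
        M.strictMono.monotone (Fin.castSucc_lt_iff_succ_le.1 h2)
      rw [if_neg (lt_asymm h2), if_neg h.ne', add_zero, max_eq_left, mul_zero]
      refine (min_le_right _ _).trans (div_nonpos_of_nonpos_of_nonneg ?_ hpos.le)
      linarith [hI.2]
  rw [reparam, Finset.sum_congr rfl fun a' _ => h1 a', Finset.sum_add_distrib, sum_ite_lt]
  simp

theorem reparam_mark (m : Fin (b + 1) → ℝ) (c : Fin (b + 1)) :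
    M.reparam m (M.mark c) = m c - m 0 := by
  rw [reparam, ← sum_ite_lt]
  refine Finset.sum_congr rfl fun a _ => ?_
  have hpos := sub_pos.2 (M.mark_lt a)
  split_ifs with h
  · have h1 := M.strictMono.monotone (Fin.castSucc_lt_iff_succ_le.1 h)
    rw [min_eq_left, max_eq_right zero_le_one, mul_one]
    rw [one_le_div hpos]
    linarith
  · have h1 := M.strictMono.monotone (not_lt.1 h)
    rw [max_eq_left, mul_zero]
    refine (min_le_right _ _).trans (div_nonpos_of_nonpos_of_nonneg ?_ hpos.le)
    linarith

/-- The maps `reparam` to markings of the interval `[0, 2 π]` have a common Lipschitz constant. -/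
theorem exists_abs_reparam_sub_le : ∃ C : ℝ, ∀ m : Fin (b + 1) → ℝ, Monotone m → m 0 = 0 →
    m (Fin.last b) = 2 * Real.pi → ∀ θ θ', |M.reparam m θ - M.reparam m θ'| ≤ C * |θ - θ'| := by
  refine ⟨∑ a : Fin b, 2 * Real.pi * (M.mark a.succ - M.mark a.castSucc)⁻¹,
    fun m hm h0 h1 θ θ' => ?_⟩
  rw [reparam, reparam, ← Finset.sum_sub_distrib, Finset.sum_mul]
  refine (Finset.abs_sum_le_sum_abs _ _).trans (Finset.sum_le_sum fun a _ => ?_)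
  have hpos := sub_pos.2 (M.mark_lt a)
  have h2 : 0 ≤ m a.succ - m a.castSucc := sub_nonneg.2 (hm a.castSucc_lt_succ.le)
  have h3 : m a.succ - m a.castSucc ≤ 2 * Real.pi := by
    have h4 := hm (Fin.zero_le a.castSucc)
    have h5 := hm (Fin.le_last a.succ)
    linarith
  have hclamp : ∀ x y : ℝ, |max 0 (min 1 x) - max 0 (min 1 y)| ≤ |x - y| := fun x y =>
    (abs_max_sub_max_le_max 0 (min 1 x) 0 (min 1 y)).trans
      (max_le (by simp) ((abs_min_sub_min_le_max 1 x 1 y).trans (max_le (by simp) le_rfl)))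
  rw [← mul_sub, abs_mul, abs_of_nonneg h2, mul_assoc]
  refine mul_le_mul h3 ((hclamp _ _).trans_eq ?_) (abs_nonneg _) Real.two_pi_pos.le
  rw [← sub_div, sub_sub_sub_cancel_right, abs_div, abs_of_pos hpos, div_eq_inv_mul]

theorem reparam_zero (m : Fin (b + 1) → ℝ) : M.reparam m 0 = 0 := by
  have h := M.reparam_mark m 0
  rwa [M.mark_zero, sub_self] at h

theorem reparam_two_pi {m : Fin (b + 1) → ℝ} (h0 : m 0 = 0) (h1 : m (Fin.last b) = 2 * Real.pi) :
    M.reparam m (2 * Real.pi) = 2 * Real.pi := by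
  have h := M.reparam_mark m (Fin.last b)
  rwa [M.mark_last, h0, h1, sub_zero] at h

/-- The homotopy from `reparam` to the identity is compatible with the identification of the ends
of `[0, 2 π]`. -/
theorem circleExp_reparam_eq {m : Fin (b + 1) → ℝ} (h0 : m 0 = 0)
    (h1 : m (Fin.last b) = 2 * Real.pi) {θ θ' : ℝ} (hθ : θ ∈ Set.Icc 0 (2 * Real.pi))
    (hθ' : θ' ∈ Set.Icc 0 (2 * Real.pi)) (h : (Circle.exp θ : ℂ) = Circle.exp θ') (s : ℝ) :
    Circle.exp ((1 - s) * M.reparam m θ + s * θ) =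
      Circle.exp ((1 - s) * M.reparam m θ' + s * θ') := by
  have key : Circle.exp ((1 - s) * M.reparam m 0 + s * 0) =
      Circle.exp ((1 - s) * M.reparam m (2 * Real.pi) + s * (2 * Real.pi)) := by
    rw [reparam_zero, M.reparam_two_pi h0 h1]
    rw [show (1 - s) * (2 * Real.pi) + s * (2 * Real.pi) = 2 * Real.pi by ring]
    simp
  by_cases hlt : |θ - θ'| < 2 * Real.pi
  · rw [eq_of_circleExp_eq hlt h]
  · rw [not_lt, le_abs] at hlt
    rcases hlt with h2 | h2
    · rw [show θ = 2 * Real.pi by linarith [hθ.2, hθ'.1], show θ' = 0 by linarith [hθ.2, hθ'.1]]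
      exact key.symm
    · rw [show θ' = 2 * Real.pi by linarith [hθ'.2, hθ.1], show θ = 0 by linarith [hθ'.2, hθ.1]]
      exact key

end Marking

/-- The parameters of the part of the unit disc on which a step of the filling is defined
explicitly: the edges and an annulus. -/
abbrev StepParam (P : DiscPartition) : Type :=
  (Fin P.numEdges × Set.Icc (0 : ℝ) 1) ⊕ (Set.Icc (0 : ℝ) 1 × Set.Icc (0 : ℝ) (2 * Real.pi))

/-- The partition is drawn in the disc of radius `1 / 2`, surrounded by an annulus. -/
noncomputable def stepPoint (P : DiscPartition) : P.StepParam → ℂ :=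
  Sum.elim (fun p => (1 / 2 : ℝ) * P.edge p.1 p.2)
    (fun p => ((1 + p.1) / 2 : ℝ) * (Circle.exp p.2 : ℂ))

theorem continuous_stepPoint (P : DiscPartition) : Continuous P.stepPoint := by
  refine Continuous.sumElim (continuous_prod_of_discrete_left.2 fun j => ?_) (by fun_prop)
  exact continuous_const.mul (continuousOn_iff_continuous_domRestrict.1 (P.edge_continuousOn j))

theorem norm_edge_le (P : DiscPartition) (j : Fin P.numEdges) {t : ℝ}
    (ht : t ∈ Set.Icc (0 : ℝ) 1) : ‖P.edge j t‖ ≤ 1 := by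
  have h := P.edge_mem_skeleton j ht
  obtain ⟨i, y, hy, h1⟩ := Set.mem_iUnion.1 h
  have h2 : P.edge j t ∈ Metric.closedBall (0 : ℂ) 1 := by
    rw [← P.iUnion_cell]
    exact Set.mem_iUnion.2 ⟨i, y, Metric.sphere_subset_closedBall hy, h1⟩
  simpa using h2

theorem norm_annulus {s θ : ℝ} (hs : 0 ≤ s) :
    ‖(((1 + s) / 2 : ℝ) : ℂ) * (Circle.exp θ : ℂ)‖ = (1 + s) / 2 := by
  rw [norm_mul, Circle.norm_coe, mul_one, Complex.norm_real, Real.norm_eq_abs, abs_of_nonneg]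
  linarith

theorem exists_endTime_eq {t : ℝ} (ht : t ∈ Set.Icc (0 : ℝ) 1) (h : t ∉ Set.Ioo (0 : ℝ) 1) :
    ∃ s, t = CombType.endTime s := by
  by_cases h0 : t = 0
  · exact ⟨false, h0⟩
  · refine ⟨true, ?_⟩
    by_contra h1
    exact h ⟨lt_of_le_of_ne ht.1 (Ne.symm h0), lt_of_le_of_ne ht.2 h1⟩

section Step

variable {X : Type*} [MetricSpace X] (c : GeodesicChoice X) (M : P.Marking b)
  {I : Fin P.numPieces → Finset (Fin P.numEdges ⊕ Fin b)} {α : C(Circle, X)}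
  (L : (P.combType M I).Labelling α)

/-- The edges are sent to geodesics between the labels of their ends; the annulus is sent to the
loop `α` by the homotopy from `reparam` to the identity. -/
noncomputable def stepValue : P.StepParam → X :=
  Sum.elim (fun p => c.path (L.pos (p.1, false)) (L.pos (p.1, true)) p.2)
    (fun p => α (Circle.exp ((1 - p.1) * M.reparam L.mark p.2 + p.1 * p.2)))

theorem stepValue_edge_end (j : Fin P.numEdges) (s : Bool)
    (h : CombType.endTime s ∈ Set.Icc (0 : ℝ) 1) :
    stepValue c M L (Sum.inl (j, ⟨CombType.endTime s, h⟩)) = L.pos (j, s) :=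
  c.path_endTime (fun s => L.pos (j, s)) s

/-- The values on the edges and on the annulus are compatible: edges meet each other in common ends,
and they meet the annulus in ends at marks. -/
theorem stepValue_factorsThrough : Function.FactorsThrough (stepValue c M L) P.stepPoint := by
  have hmix : ∀ (p : Fin P.numEdges × Set.Icc (0 : ℝ) 1)
      (r : Set.Icc (0 : ℝ) 1 × Set.Icc (0 : ℝ) (2 * Real.pi)),
      P.stepPoint (Sum.inl p) = P.stepPoint (Sum.inr r) →
      stepValue c M L (Sum.inl p) = stepValue c M L (Sum.inr r) := by
    rintro ⟨j, t, ht⟩ ⟨⟨s, hs⟩, ⟨θ, hθ⟩⟩ h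
    simp only [stepPoint, Sum.elim_inl, Sum.elim_inr] at h
    have hn := congrArg norm h
    rw [norm_annulus hs.1, norm_mul, Complex.norm_real] at hn
    have hle := P.norm_edge_le j ht
    have hs0 : s = 0 := by
      norm_num at hn
      linarith [hs.1]
    subst hs0
    have h1 : P.edge j t = Circle.exp θ := by
      rw [add_zero] at h
      exact mul_left_cancel₀ (by norm_num) h
    have hn1 : ‖P.edge j t‖ = 1 := by rw [h1, Circle.norm_coe]
    obtain ⟨s', rfl⟩ := exists_endTime_eq ht fun h2 => (P.edge_interior j t h2).2.ne hn1
    have hv : P.edge j (CombType.endTime s') ∈ P.vertices := by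
      cases s'
      · exact P.edge_zero_mem j
      · exact P.edge_one_mem j
    obtain ⟨a, ha⟩ := M.exists_mark _ hv hn1
    rw [stepValue_edge_end, L.pos_eq_loop (j, s') a ha]
    have h2 := M.circleExp_reparam_eq L.mark_zero L.mark_last hθ (M.mark_mem a)
      (h1.symm.trans ha) 0
    rw [M.reparam_mark, L.mark_zero] at h2
    simp only [stepValue, Sum.elim_inr]
    rw [h2]
    congr 2
    ring
  rintro (p | r) (p' | r') h
  · obtain ⟨j, t, ht⟩ := p
    obtain ⟨j', t', ht'⟩ := p'
    simp only [stepPoint, Sum.elim_inl] at h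
    have h1 : P.edge j t = P.edge j' t' := mul_left_cancel₀ (by norm_num) h
    by_cases hI : t ∈ Set.Ioo (0 : ℝ) 1
    · obtain ⟨h2, rfl⟩ := M.arcSystem.eq_of_arc_eq (a := Sum.inl j) (a' := Sum.inl j') hI ht' h1
      rw [Sum.inl_injective h2]
    · have hI' : t' ∉ Set.Ioo (0 : ℝ) 1 := by
        intro h2
        obtain ⟨-, rfl⟩ := M.arcSystem.eq_of_arc_eq (a := Sum.inl j') (a' := Sum.inl j) h2 ht h1.symm
        exact hI h2
      obtain ⟨s, rfl⟩ := exists_endTime_eq ht hI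
      obtain ⟨s', rfl⟩ := exists_endTime_eq ht' hI'
      rw [stepValue_edge_end, stepValue_edge_end]
      exact L.pos_eq_pos _ _ h1
  · exact hmix p r' h
  · exact (hmix p' r h.symm).symm
  · obtain ⟨⟨s, hs⟩, ⟨θ, hθ⟩⟩ := r
    obtain ⟨⟨s', hs'⟩, ⟨θ', hθ'⟩⟩ := r'
    simp only [stepPoint, Sum.elim_inr] at h
    have hn := congrArg norm h
    rw [norm_annulus hs.1, norm_annulus hs'.1] at hn
    have hss : s = s' := by linarith
    subst hss
    have h1 : (Circle.exp θ : ℂ) = Circle.exp θ' := by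
      refine mul_left_cancel₀ ?_ h
      have : (1 + s) / 2 ≠ 0 := by linarith [hs.1]
      exact_mod_cast this
    simp only [stepValue, Sum.elim_inr]
    rw [M.circleExp_reparam_eq L.mark_zero L.mark_last hθ hθ' h1 s]

theorem continuous_stepValue : Continuous (stepValue c M L) := by
  refine Continuous.sumElim (continuous_prod_of_discrete_left.2 fun j => ?_) ?_
  · exact continuousOn_iff_continuous_domRestrict.1 (c.continuousOn_path (L.pos (j, false)) (L.pos (j, true)))
  · have : Continuous (M.reparam L.mark) := by
      unfold Marking.reparam
      fun_prop
    fun_prop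

/-- The map on the edges and the annulus; its value elsewhere is irrelevant. -/
noncomputable def stepMap : ℂ → X :=
  Function.extend P.stepPoint (stepValue c M L) fun _ => α 1

theorem stepMap_stepPoint (p : P.StepParam) :
    stepMap c M L (P.stepPoint p) = stepValue c M L p :=
  (stepValue_factorsThrough c M L).extend_apply _ p

theorem continuousOn_stepMap : ContinuousOn (stepMap c M L) (Set.range P.stepPoint) := by
  refine continuousOn_range_of_comp P.continuous_stepPoint ?_
  simp only [stepMap_stepPoint]
  exact continuous_stepValue c M L

theorem dist_stepValue_le {l : ℝ} (hl : 0 ≤ l) (hα : loopLength α ≤ ENNReal.ofReal l)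
    (p : P.StepParam) : dist (stepValue c M L p) (α 1) ≤ (3 * P.numPieces + 1) * l := by
  have hpos : ∀ x, dist (L.pos x) (α 1) ≤ P.numPieces * l := by
    intro x
    refine dist_le_of_edist_le_ofReal (by positivity) ((L.edist_pos_le x).trans ?_)
    rw [ENNReal.ofReal_mul (by positivity), ENNReal.ofReal_natCast]
    gcongr
  rcases p with ⟨j, t⟩ | p
  · have h1 := c.dist_path_left_le (L.pos (j, false)) (L.pos (j, true)) t.2
    have h2 := dist_triangle_right (L.pos (j, false)) (L.pos (j, true)) (α 1)
    have h3 := dist_triangle (stepValue c M L (Sum.inl (j, t))) (L.pos (j, false)) (α 1)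
    have h4 : dist (stepValue c M L (Sum.inl (j, t))) (L.pos (j, false)) ≤ _ := h1
    have := hpos (j, false)
    have := hpos (j, true)
    linarith
  · have h1 := dist_le_of_edist_le_ofReal hl ((edist_le_loopLength α
      (Circle.exp ((1 - p.1) * M.reparam L.mark p.2 + p.1 * p.2)) 1).trans hα)
    have h2 : 0 ≤ 3 * (P.numPieces : ℝ) * l := by positivity
    have h3 : dist (stepValue c M L (Sum.inr p)) (α 1) ≤ l := h1
    linarith

theorem dist_stepMap_le {l : ℝ} (hl : 0 ≤ l) (hα : loopLength α ≤ ENNReal.ofReal l)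
    (x : ℂ) : dist (stepMap c M L x) (α 1) ≤ (3 * P.numPieces + 1) * l := by
  by_cases hx : ∃ p, P.stepPoint p = x
  · obtain ⟨p, rfl⟩ := hx
    rw [stepMap_stepPoint]
    exact dist_stepValue_le c M L hl hα p
  · rw [stepMap, Function.extend_apply' _ _ _ hx, dist_self]
    positivity

/-- The images of the boundaries of the pieces are at most half as long as the loop. -/
theorem pieceLength_stepMap_le
    (hI : ∀ i (F : ℂ → X), P.pieceLength F i =
      ∑ c ∈ I i, eVariationOn (fun t => F (M.arcSystem.arc c t)) (Set.Icc 0 1))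
    (i : Fin P.numPieces) :
    P.pieceLength (fun x => stepMap c M L ((1 / 2 : ℝ) * x)) i ≤ loopLength α / 2 := by
  rw [hI]
  refine le_trans (Finset.sum_le_sum fun x _ => ?_) (L.length_le i)
  rcases x with j | a
  · refine le_trans (le_of_eq ?_) (c.eVariationOn_path_le (L.pos (j, false)) (L.pos (j, true)))
    refine eVariationOn.congr fun t ht => ?_
    exact stepMap_stepPoint c M L (Sum.inl (j, ⟨t, ht⟩))
  · have hm : MonotoneOn (fun t : ℝ => L.mark a.castSucc + t * (L.mark a.succ - L.mark a.castSucc))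
        (Set.Icc 0 1) := by
      intro s _ t _ hst
      have := mul_le_mul_of_nonneg_right hst (sub_nonneg.2 (L.monotone a.castSucc_lt_succ.le))
      simp only
      linarith
    refine le_trans (le_of_eq ?_) (eVariationOn.comp_le_of_monotoneOn
      (fun t : ℝ => α (Circle.exp t)) (t := Set.Icc 0 1) _ hm fun t ht => ?_)
    · refine eVariationOn.congr fun t ht => ?_
      have hθ : M.angle a t ∈ Set.Icc 0 (2 * Real.pi) := by
        have h1 : M.angle a t ∈ Set.Icc (M.mark a.castSucc) (M.mark a.succ) := by
          rw [← M.angle_image a]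
          exact ⟨t, ht, rfl⟩
        exact ⟨(M.mark_mem _).1.trans h1.1, h1.2.trans (M.mark_mem _).2⟩
      have h1 := stepMap_stepPoint c M L (Sum.inr (⟨0, le_rfl, zero_le_one⟩, ⟨M.angle a t, hθ⟩))
      simp only [stepPoint, stepValue, Sum.elim_inr, M.reparam_angle L.mark a ht, L.mark_zero] at h1
      simp only [Function.comp_apply]
      rw [show (1 - 0) * (L.mark a.castSucc - 0 + t * (L.mark a.succ - L.mark a.castSucc)) +
        0 * M.angle a t = L.mark a.castSucc + t * (L.mark a.succ - L.mark a.castSucc) by ring,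
        add_zero] at h1
      exact h1
    · have h1 := sub_nonneg.2 (L.monotone a.castSucc_lt_succ.le)
      have h2 := mul_nonneg ht.1 h1
      have h3 := mul_le_mul_of_nonneg_right ht.2 h1
      constructor <;> simp only <;> linarith

end Step

end DiscPartition

/-! ### Filling limits of loops -/

open Filter Topology

section LoopSeq

variable {X : Type*} [MetricSpace X] {ω : Ultrafilter ℕ} {e : ℕ → X} {d : ScalingSequence ω}

variable (e d) in
/-- The loops `α n`, which have length at most `l * d n`, converge to a loop in the asymptotic
cone. -/
structure IsLoopSeq (l : ℝ) (α : ℕ → C(Circle, X)) : Prop where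
  equicontinuous : AsympEquicontinuousOn d (fun n => α n) Set.univ
  isConeSeq : IsConeSeq e d fun n => α n 1
  length_le : ∀ᶠ n in (ω : Filter ℕ), loopLength (α n) ≤ ENNReal.ofReal (l * d.seq n)

/-- The radial projection to the circle; its value at `0` is irrelevant. -/
noncomputable def toCircle (x : ℂ) : Circle := Circle.exp x.arg

theorem coe_toCircle {x : ℂ} (hx : ‖x‖ = 1) : (toCircle x : ℂ) = x := by
  have h := Complex.norm_mul_exp_arg_mul_I x
  rw [hx] at h
  simpa [toCircle] using h

theorem toCircle_coe (z : Circle) : toCircle z = z := Circle.exp_arg z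

variable (e d) in
/-- The limit of the loops `α n`, as a function on the unit disc whose values off the unit circle
are irrelevant. -/
noncomputable def limitLoop (α : ℕ → C(Circle, X)) (x : Metric.closedBall (0 : ℂ) 1) :
    AsymptoticCone ω e d :=
  coneMk e d fun n => α n (toCircle x)

theorem IsLoopSeq.dist_le {l : ℝ} {α : ℕ → C(Circle, X)} (h : IsLoopSeq e d l α) (hl : 0 ≤ l)
    (z : Circle) : ∀ᶠ n in (ω : Filter ℕ), dist (α n z) (α n 1) ≤ l * d.seq n := by
  filter_upwards [h.length_le] with n hn
  exact dist_le_of_edist_le_ofReal (mul_nonneg hl (d.pos n).le)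
    ((edist_le_loopLength _ _ _).trans hn)

theorem IsLoopSeq.isConeSeq' {l : ℝ} {α : ℕ → C(Circle, X)} (h : IsLoopSeq e d l α) (hl : 0 ≤ l)
    (z : Circle) : IsConeSeq e d fun n => α n z :=
  h.isConeSeq.of_dist_le (h.dist_le hl z)

/-- The unit circle as a subset of the unit disc. -/
def discBoundary : Set (Metric.closedBall (0 : ℂ) 1) := {x | ‖(x : ℂ)‖ = 1}

namespace DiscPartition

variable {P : DiscPartition} {b : ℕ} (M : P.Marking b)
  {I : Fin P.numPieces → Finset (Fin P.numEdges ⊕ Fin b)} (c : GeodesicChoice X)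
  {α : ℕ → C(Circle, X)} (L : ∀ n, (P.combType M I).Labelling (α n)) {l : ℝ}

/-- The maps on the edges and the annulus are asymptotically equicontinuous. -/
theorem asympEquicontinuousOn_stepMap (hl : 0 ≤ l)
    (hα : AsympEquicontinuousOn d (fun n => α n) Set.univ)
    (hlen : ∀ n, loopLength (α n) ≤ ENNReal.ofReal (l * d.seq n)) :
    AsympEquicontinuousOn d (fun n => stepMap c M (L n)) (Set.range P.stepPoint) := by
  have hpos : ∀ n x, dist ((L n).pos x) (α n 1) ≤ P.numPieces * l * d.seq n := by
    intro n x
    have hd := d.pos n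
    refine dist_le_of_edist_le_ofReal (by positivity) (((L n).edist_pos_le x).trans ?_)
    rw [mul_assoc, ENNReal.ofReal_mul (by positivity), ENNReal.ofReal_natCast]
    have := hlen n
    gcongr
  -- asymptotic equicontinuity is checked on the annulus and on each edge
  let Q : Option (Fin P.numEdges) → Set ℂ := fun o => o.elim
    (Set.range fun p => P.stepPoint (Sum.inr p)) (fun j => Set.range fun t => P.stepPoint (Sum.inl (j, t)))
  have hQ : Set.range P.stepPoint = ⋃ o, Q o := by
    ext x
    rw [Set.mem_iUnion]
    constructor
    · rintro ⟨⟨j, t⟩ | p, rfl⟩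
      · exact ⟨some j, t, rfl⟩
      · exact ⟨none, p, rfl⟩
    · rintro ⟨_ | j, p, rfl⟩
      · exact ⟨Sum.inr p, rfl⟩
      · exact ⟨Sum.inl (j, p), rfl⟩
  have hc1 : Continuous fun p => P.stepPoint (Sum.inr p) := P.continuous_stepPoint.comp continuous_inr
  have hc2 : ∀ j, Continuous fun t => P.stepPoint (Sum.inl (j, t)) := fun j =>
    P.continuous_stepPoint.comp (continuous_inl.comp (Continuous.prodMk_right j))
  rw [hQ]
  refine AsympEquicontinuousOn.iUnion ?_ ?_
  · rintro (_ | j)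
    · exact (isCompact_range hc1).isClosed
    · exact (isCompact_range (hc2 j)).isClosed
  rintro (_ | j)
  · refine AsympEquicontinuousOn.of_comp hc1 ?_
    intro z w _ _ hzw
    simp only [stepMap_stepPoint, stepValue, Sum.elim_inr]
    obtain ⟨C, hC⟩ := M.exists_abs_reparam_sub_le
    have hs : Tendsto (fun n => ((z n).1 : ℝ)) ω (𝓝 w.1) :=
      (continuous_subtype_val.tendsto _).comp ((continuous_fst.tendsto _).comp hzw)
    have hθ : Tendsto (fun n => ((z n).2 : ℝ)) ω (𝓝 w.2) :=
      (continuous_subtype_val.tendsto _).comp ((continuous_snd.tendsto _).comp hzw)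
    -- the angles `u n` and `v n` approach each other, by the common Lipschitz constant of the maps
    -- `reparam`, although they need not converge
    set u : ℕ → ℝ := fun n => (1 - (z n).1) * M.reparam (L n).mark (z n).2 + (z n).1 * (z n).2 with hu
    set v : ℕ → ℝ := fun n => (1 - w.1) * M.reparam (L n).mark w.2 + w.1 * w.2 with hv
    have hφ : ∀ n, ∀ θ θ', |M.reparam (L n).mark θ - M.reparam (L n).mark θ'| ≤ C * |θ - θ'| :=
      fun n => hC _ (L n).monotone (L n).mark_zero (L n).mark_last
    have huv : Tendsto (fun n => u n - v n) ω (𝓝 0) := by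
      have h1 : Tendsto (fun n => C * |((z n).2 : ℝ) - w.2| +
          |(w.1 : ℝ) - (z n).1| * (C * |(w.2 : ℝ)|) +
          |((z n).1 : ℝ) * (z n).2 - w.1 * w.2|) ω (𝓝 0) := by
        have h2 := ((hθ.sub_const (w.2 : ℝ)).abs.const_mul C).add
          (((hs.const_sub (w.1 : ℝ)).abs.mul_const (C * |(w.2 : ℝ)|))) |>.add
          ((hs.mul hθ).sub_const ((w.1 : ℝ) * w.2)).abs
        simpa using h2
      refine squeeze_zero_norm (fun n => ?_) h1
      have h3 : u n - v n = (1 - (z n).1) * (M.reparam (L n).mark (z n).2 -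
          M.reparam (L n).mark w.2) + (w.1 - (z n).1) * M.reparam (L n).mark w.2 +
          ((z n).1 * (z n).2 - w.1 * w.2) := by
        simp only [hu, hv]
        ring
      rw [h3, Real.norm_eq_abs]
      refine (abs_add_three _ _ _).trans ?_
      have h4 : |(1 - ((z n).1 : ℝ)) * (M.reparam (L n).mark (z n).2 -
          M.reparam (L n).mark w.2)| ≤ C * |((z n).2 : ℝ) - w.2| := by
        rw [abs_mul]
        refine le_trans (mul_le_of_le_one_left (abs_nonneg _) ?_) (hφ n _ _)
        rw [abs_le]
        constructor <;> linarith [(z n).1.2.1, (z n).1.2.2]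
      have h5 : |M.reparam (L n).mark w.2| ≤ C * |(w.2 : ℝ)| := by
        have h6 := hφ n w.2 0
        rwa [M.reparam_zero, sub_zero, sub_zero] at h6
      have h6 : |((w.1 : ℝ) - (z n).1) * M.reparam (L n).mark w.2| ≤
          |(w.1 : ℝ) - (z n).1| * (C * |(w.2 : ℝ)|) := by
        rw [abs_mul]
        gcongr
      linarith
    obtain ⟨ζ, -, hζ⟩ := isCompact_univ.ultrafilter_le_nhds (ω.map fun n => Circle.exp (v n))
      (by simp)
    have hvζ : Tendsto (fun n => Circle.exp (v n)) ω (𝓝 ζ) := hζ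
    have huζ : Tendsto (fun n => Circle.exp (u n)) ω (𝓝 ζ) := by
      have h1 := ((Circle.exp.continuous.tendsto 0).comp huv).mul hvζ
      rw [Circle.exp_zero, one_mul] at h1
      refine h1.congr fun n => ?_
      rw [Function.comp_apply, ← Circle.exp_add, sub_add_cancel]
    exact hα.tendsto_of_tendsto huζ hvζ
  · refine AsympEquicontinuousOn.of_comp (hc2 j) ?_
    intro z w _ _ hzw
    simp only [stepMap_stepPoint, stepValue, Sum.elim_inl]
    have ht : Tendsto (fun n => ((z n : ℝ) - w)) ω (𝓝 0) := by
      have := ((continuous_subtype_val.tendsto _).comp hzw).sub_const (w : ℝ)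
      simpa using this
    have h1 := ht.abs.mul_const (2 * P.numPieces * l)
    rw [abs_zero, zero_mul] at h1
    refine squeeze_zero (fun n => div_nonneg dist_nonneg (d.pos n).le) (fun n => ?_) h1
    rw [div_le_iff₀ (d.pos n), c.dist_path _ _ _ (z n).2 _ w.2, mul_assoc]
    have h2 := dist_triangle_right ((L n).pos (j, false)) ((L n).pos (j, true)) (α n 1)
    have h3 := hpos n (j, false)
    have h4 := hpos n (j, true)
    gcongr
    linarith

theorem half_mul_mem (x : ℂ) (hx : x ∈ Metric.closedBall (0 : ℂ) 1) :
    ((1 / 2 : ℝ) : ℂ) * x ∈ Metric.closedBall (0 : ℂ) 1 := by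
  rw [mem_closedBall_zero_iff] at hx ⊢
  rw [norm_mul, Complex.norm_real]
  norm_num
  linarith

theorem cell_mem (i : Fin P.numPieces) {x : ℂ} (hx : x ∈ Metric.closedBall (0 : ℂ) 1) :
    P.cell i x ∈ Metric.closedBall (0 : ℂ) 1 := by
  rw [← P.iUnion_cell]
  exact Set.mem_iUnion.2 ⟨i, x, hx, rfl⟩

/-- Only boundary points of a piece are on the `1`-skeleton. -/
theorem mem_sphere_of_cell_mem_skeleton (i : Fin P.numPieces) {x : ℂ}
    (hx : x ∈ Metric.closedBall (0 : ℂ) 1) (h : P.cell i x ∈ P.skeleton) :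
    x ∈ Metric.sphere (0 : ℂ) 1 := by
  obtain ⟨i', y, hy, hxy⟩ := Set.mem_iUnion.1 h
  by_cases hi : i = i'
  · subst hi
    rwa [← P.cell_injOn i (Metric.sphere_subset_closedBall hy) hx hxy]
  · exact cell_eq_cell hi hx (Metric.sphere_subset_closedBall hy) hxy.symm

theorem half_mul_skeleton_mem {x : ℂ} (hx : x ∈ P.skeleton) :
    ((1 / 2 : ℝ) : ℂ) * x ∈ Set.range P.stepPoint := by
  rw [skeleton_eq'] at hx
  rcases hx with hx | hx
  · obtain ⟨t, rfl⟩ := mem_sphere_iff_exists_exp.1 hx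
    obtain ⟨s, hs, hst⟩ := Circle.periodic_exp.exists_mem_Ico₀ Real.two_pi_pos t
    refine ⟨Sum.inr (⟨0, le_rfl, zero_le_one⟩, ⟨s, Set.Ico_subset_Icc_self hs⟩), ?_⟩
    simp only [stepPoint, Sum.elim_inr, add_zero, hst]
  · obtain ⟨j, t, ht, rfl⟩ := Set.mem_iUnion.1 hx
    exact ⟨Sum.inl (j, ⟨t, ht⟩), rfl⟩

theorem mem_range_stepPoint_of_half_le {x : ℂ} (h1 : ‖x‖ ≤ 1) (h2 : 1 / 2 ≤ ‖x‖) :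
    ∃ p : Set.Icc (0 : ℝ) 1 × Set.Icc (0 : ℝ) (2 * Real.pi), P.stepPoint (Sum.inr p) = x ∧
      (p.1 : ℝ) = 2 * ‖x‖ - 1 ∧ (‖x‖ : ℂ) * (Circle.exp p.2 : ℂ) = x := by
  obtain ⟨s, hs, hst⟩ := Circle.periodic_exp.exists_mem_Ico₀ Real.two_pi_pos x.arg
  have h3 : (‖x‖ : ℂ) * (Circle.exp s : ℂ) = x := by
    rw [← hst]
    simp
  refine ⟨(⟨2 * ‖x‖ - 1, by linarith, by linarith⟩, ⟨s, Set.Ico_subset_Icc_self hs⟩), ?_, rfl, h3⟩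
  simp only [stepPoint, Sum.elim_inr]
  rw [show (1 + (2 * ‖x‖ - 1)) / 2 = ‖x‖ by ring]
  exact h3

theorem mem_sphere_of_mem_range_stepPoint (i : Fin P.numPieces) {x : ℂ}
    (hx : x ∈ Metric.closedBall (0 : ℂ) 1)
    (h : ((1 / 2 : ℝ) : ℂ) * P.cell i x ∈ Set.range P.stepPoint) :
    x ∈ Metric.sphere (0 : ℂ) 1 := by
  refine mem_sphere_of_cell_mem_skeleton i hx ?_
  obtain ⟨⟨j, t⟩ | ⟨s, θ⟩, hp⟩ := h
  · have h1 : P.edge j t = P.cell i x := mul_left_cancel₀ (by norm_num) hp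
    rw [← h1]
    exact P.edge_mem_skeleton j t.2
  · refine P.sphere_subset_skeleton ?_
    have hn := congrArg norm hp
    simp only [stepPoint, Sum.elim_inr] at hn
    rw [norm_annulus s.2.1, norm_mul, Complex.norm_real] at hn
    have h1 := mem_closedBall_zero_iff.1 (P.cell_mem i hx)
    rw [mem_sphere_zero_iff_norm]
    norm_num at hn
    linarith [s.2.1]

/-- The image of the boundary of a piece, as a loop in `X`. -/
noncomputable def stepLoop (n : ℕ) (i : Fin P.numPieces) : C(Circle, X) where
  toFun z := stepMap c M (L n) (((1 / 2 : ℝ) : ℂ) * P.cell i z)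
  continuous_toFun := by
    refine (continuousOn_stepMap c M (L n)).comp_continuous
      (continuous_const.mul ((P.cell_continuousOn i).comp_continuous continuous_subtype_val
        fun z => by simp [Circle.norm_coe])) fun z => ?_
    exact half_mul_skeleton_mem (Set.mem_iUnion.2 ⟨i, _, by simp [Circle.norm_coe], rfl⟩)

theorem isLoopSeq_stepLoop (hl : 0 ≤ l) (hα : IsLoopSeq e d l α)
    (hlen : ∀ n, loopLength (α n) ≤ ENNReal.ofReal (l * d.seq n))
    (hI : ∀ i (F : ℂ → X), P.pieceLength F i =
      ∑ c ∈ I i, eVariationOn (fun t => F (M.arcSystem.arc c t)) (Set.Icc 0 1))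
    (i : Fin P.numPieces) : IsLoopSeq e d (l / 2) fun n => stepLoop M c L n i where
  equicontinuous := by
    refine (asympEquicontinuousOn_stepMap M c L hl hα.equicontinuous hlen).comp
      (h := fun z : Circle => ((1 / 2 : ℝ) : ℂ) * P.cell i z) ?_ ?_
    · exact continuous_const.mul ((P.cell_continuousOn i).comp_continuous continuous_subtype_val
        fun z => by simp [Circle.norm_coe])
    · exact fun z => half_mul_skeleton_mem (Set.mem_iUnion.2 ⟨i, _, by simp [Circle.norm_coe], rfl⟩)
  isConeSeq := by
    refine hα.isConeSeq.of_dist_le (r := (3 * P.numPieces + 1) * l) (Eventually.of_forall fun n => ?_)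
    rw [mul_assoc]
    exact dist_stepMap_le c M (L n) (mul_nonneg hl (d.pos n).le) (hlen n) _
  length_le := Eventually.of_forall fun n => by
    refine (pieceLength_stepMap_le c M (L n) hI i).trans ?_
    rw [show l / 2 * d.seq n = l * d.seq n / 2 by ring, ENNReal.ofReal_div_of_pos two_pos,
      ENNReal.ofReal_ofNat]
    gcongr
    exact hlen n

/-- If the loops `α n` all admit labellings of the combinatorial type of one partition, then this
partition divides their limit. -/
theorem exists_fillStep (hl : 0 ≤ l) (hα : IsLoopSeq e d l α)
    (hlen : ∀ n, loopLength (α n) ≤ ENNReal.ofReal (l * d.seq n))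
    (hI : ∀ i (F : ℂ → X), P.pieceLength F i =
      ∑ c ∈ I i, eVariationOn (fun t => F (M.arcSystem.arc c t)) (Set.Icc 0 1))
    (hX : IsGeodesicSpace X) (L : ∀ n, (P.combType M I).Labelling (α n)) :
    ∃ T : FillStep discBoundary (ℕ → C(Circle, X)) (AsymptoticCone ω e d),
      (∀ x ∈ discBoundary, T.F x = limitLoop e d α x) ∧
      (∀ x, dist (T.F x) (coneMk e d fun n => α n 1) ≤ (3 * P.numPieces + 1) * l) ∧
      ∀ i, IsLoopSeq e d (l / 2) (T.child i) ∧ dist (coneMk e d fun n => T.child i n 1)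
        (coneMk e d fun n => α n 1) ≤ (3 * P.numPieces + 1) * l ∧
        ∀ y ∈ discBoundary, limitLoop e d (T.child i) y = T.F (T.c i y) := by
  obtain ⟨c⟩ := hX.nonempty_geodesicChoice
  have hcs : CompactSpace (Metric.closedBall (0 : ℂ) 1) :=
    isCompact_iff_compactSpace.1 (isCompact_closedBall 0 1)
  have hdist : ∀ x, ∀ n, dist (stepMap c M (L n) x) (α n 1) ≤
      (3 * P.numPieces + 1) * l * d.seq n := fun x n => by
    rw [mul_assoc]
    exact dist_stepMap_le c M (L n) (mul_nonneg hl (d.pos n).le) (hlen n) _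
  have hcone : ∀ x, IsConeSeq e d fun n => stepMap c M (L n) x := fun x =>
    hα.isConeSeq.of_dist_le (Eventually.of_forall (hdist x))
  refine ⟨{
    k := P.numPieces
    A := {x | (x : ℂ) ∈ Set.range P.stepPoint}
    F := fun x => coneMk e d fun n => stepMap c M (L n) x
    c := fun i x => ⟨((1 / 2 : ℝ) : ℂ) * P.cell i x, half_mul_mem _ (P.cell_mem i x.2)⟩
    child := fun i n => stepLoop M c L n i
    isClosed_A := (isCompact_range P.continuous_stepPoint).isClosed.preimage continuous_subtype_val
    continuousOn_F := ?_
    isEmbedding_c := fun i => ?_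
    cover := fun x => ?_
    bd_subset := fun x hx => ?_
    c_mem_A := fun i y => ⟨fun h => ?_, fun h => ?_⟩
    overlap := fun i i' y y' hne h => ?_ }, fun x hx => ?_, fun x => ?_, fun i => ⟨?_, ?_, ?_⟩⟩
  · exact ((asympEquicontinuousOn_stepMap M c L hl hα.equicontinuous hlen).continuousOn_coneMk
      fun z _ => hcone z).comp continuous_subtype_val.continuousOn fun x hx => hx
  · refine Continuous.isClosedEmbedding (Continuous.subtype_mk (continuous_const.mul
      (continuousOn_iff_continuous_domRestrict.1 (P.cell_continuousOn i))) _) fun x y h => ?_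
    have h1 : P.cell i x = P.cell i y := mul_left_cancel₀ (by norm_num) (congrArg Subtype.val h)
    exact Subtype.ext (P.cell_injOn i x.2 y.2 h1)
  · have hx := mem_closedBall_zero_iff.1 x.2
    by_cases h : 1 / 2 ≤ ‖(x : ℂ)‖
    · obtain ⟨p, hp, -⟩ := P.mem_range_stepPoint_of_half_le hx h
      exact Or.inl ⟨_, hp⟩
    · right
      have h2 : (2 : ℂ) * x ∈ Metric.closedBall (0 : ℂ) 1 := by
        rw [mem_closedBall_zero_iff, norm_mul]
        norm_num
        linarith
      obtain ⟨i, y, hy, hyx⟩ := Set.mem_iUnion.1 (P.iUnion_cell.superset h2)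
      refine ⟨i, ⟨y, hy⟩, Subtype.ext ?_⟩
      simp only [hyx]
      push_cast
      ring
  · have hx' : ‖(x : ℂ)‖ = 1 := hx
    obtain ⟨p, hp, -⟩ := P.mem_range_stepPoint_of_half_le hx'.le (by rw [hx']; norm_num)
    exact ⟨_, hp⟩
  · exact mem_sphere_zero_iff_norm.1 (mem_sphere_of_mem_range_stepPoint i y.2 h)
  · exact half_mul_skeleton_mem
      (Set.mem_iUnion.2 ⟨i, _, mem_sphere_zero_iff_norm.2 h, rfl⟩)
  · have h1 : P.cell i y = P.cell i' y' := mul_left_cancel₀ (by norm_num) (congrArg Subtype.val h)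
    exact mem_sphere_zero_iff_norm.1 (cell_eq_cell hne y.2 y'.2 h1)
  · have hx' : ‖(x : ℂ)‖ = 1 := hx
    obtain ⟨p, hp, hp1, hp2⟩ := P.mem_range_stepPoint_of_half_le hx'.le (by rw [hx']; norm_num)
    have h1 : (p.1 : ℝ) = 1 := by rw [hp1, hx']; norm_num
    have h2 : toCircle x = Circle.exp p.2 := by
      rw [hx', Complex.ofReal_one, one_mul] at hp2
      rw [← hp2, toCircle_coe]
    have h3 : ∀ n, stepMap c M (L n) x = α n (toCircle x) := by
      intro n
      rw [← hp, stepMap_stepPoint, hp, h2]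
      simp only [stepValue, Sum.elim_inr, h1]
      congr 2
      ring
    simp only [limitLoop, h3]
  · exact dist_coneMk_le (hcone x) hα.isConeSeq (Eventually.of_forall (hdist x))
  · exact isLoopSeq_stepLoop M c L hl hα hlen hI i
  · exact dist_coneMk_le (hcone _) hα.isConeSeq (Eventually.of_forall (hdist _))
  · intro y hy
    simp only [limitLoop, stepLoop, ContinuousMap.coe_mk, coe_toCircle hy]

end DiscPartition

/-- A loop of finite length has a partition into at most `K` pieces of mesh less than
half its length, if the divisibility function is at most `K` at its length, rounded up. -/
theorem exists_partition_of_divisibility_le {γ : C(Circle, X)} {K : ℕ}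
    (h1 : loopLength γ ≠ ⊤) (h : divisibility X ⌈(loopLength γ).toReal⌉₊ ≤ K) :
    ∃ (P : DiscPartition) (φ : P.vertices → X) (F : ℂ → X), P.numPieces ≤ K ∧
      P.IsGeodesicExtension γ φ F ∧ P.mesh F < loopLength γ / 2 := by
  have h2 : partitionNumber γ (loopLength γ / 2) ≤ K := by
    refine le_trans ?_ h
    refine le_iSup₂_of_le (f := fun (α : C(Circle, X)) (_ : _ ∧ _) =>
      partitionNumber α (loopLength α / 2)) γ ⟨?_, ?_⟩ le_rfl
    · have h3 := Nat.ceil_lt_add_one (ENNReal.toReal_nonneg (a := loopLength γ))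
      rw [← ENNReal.ofReal_toReal h1, ← ENNReal.ofReal_one, ← ENNReal.ofReal_add
        ENNReal.toReal_nonneg zero_le_one, ← ENNReal.ofReal_natCast]
      simp only [ENNReal.toReal_ofReal ENNReal.toReal_nonneg]
      exact (ENNReal.ofReal_lt_ofReal_iff (by positivity)).2 h3
    · calc loopLength γ = ENNReal.ofReal (loopLength γ).toReal := (ENNReal.ofReal_toReal h1).symm
        _ ≤ ENNReal.ofReal (⌈(loopLength γ).toReal⌉₊ : ℝ) :=
          ENNReal.ofReal_le_ofReal (Nat.le_ceil _)
        _ = _ := ENNReal.ofReal_natCast _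
  have h3 : partitionNumber γ (loopLength γ / 2) < (K + 1 : ℕ) :=
    h2.trans_lt (by exact_mod_cast Nat.lt_succ_self K)
  obtain ⟨k, ⟨P, φ, F, -, hF, hmesh, rfl⟩, hk⟩ := sInf_lt_iff.1 h3
  exact ⟨P, φ, F, Nat.lt_succ_iff.1 (by exact_mod_cast hk), hF, hmesh⟩

end LoopSeq

/-! ### Filling limits of loops in divisible spaces -/

open Filter Topology

section FillLoop

variable {X : Type*} [MetricSpace X] {ω : Ultrafilter ℕ} {e : ℕ → X} {d : ScalingSequence ω}

theorem loopLength_const (x : X) : loopLength (ContinuousMap.const Circle x) = 0 :=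
  eVariationOn.constant_on (by rintro _ ⟨_, _, rfl⟩ _ ⟨_, _, rfl⟩; rfl)

/-- A constant loop admits a labelling of the combinatorial type of any partition. -/
theorem DiscPartition.nonempty_labelling_const (P : DiscPartition) {b : ℕ} (M : P.Marking b)
    (I : Fin P.numPieces → Finset (Fin P.numEdges ⊕ Fin b)) (x : X) :
    Nonempty ((P.combType M I).Labelling (ContinuousMap.const Circle x)) := by
  refine ⟨⟨M.mark, M.strictMono.monotone, M.mark_zero, M.mark_last, fun _ => x,
    fun _ _ _ => rfl, fun _ _ _ => rfl, fun i => ?_, fun _ => by simp⟩⟩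
  refine (Finset.sum_eq_zero fun y _ => ?_).trans_le zero_le
  rcases y with j | a
  · simp
  · rw [Sum.elim_inr]
    exact eVariationOn.constant_on (by rintro _ ⟨_, _, rfl⟩ _ ⟨_, _, rfl⟩; rfl)

theorem IsLoopSeq.congr {l : ℝ} {α β : ℕ → C(Circle, X)} (h : IsLoopSeq e d l α)
    (hαβ : ∀ᶠ n in (ω : Filter ℕ), α n = β n) : IsLoopSeq e d l β where
  equicontinuous z w hw hz hzw := by
    refine (h.equicontinuous z w hw hz hzw).congr' ?_
    filter_upwards [hαβ] with n hn
    rw [hn]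
  isConeSeq := h.isConeSeq.of_dist_le (r := 0) <| by
    filter_upwards [hαβ] with n hn
    simp [hn]
  length_le := by
    filter_upwards [hαβ, h.length_le] with n hn h1
    rwa [← hn]

/-- The combinatorial types of the partitions of `α n` are `ω`-almost surely constant, because the
numbers of edges and vertices are bounded in terms of the number of pieces. -/
theorem exists_common_combType {α : ℕ → C(Circle, X)} {K : ℕ}
    (h : ∀ᶠ n in (ω : Filter ℕ), ∃ (P : DiscPartition) (φ : P.vertices → X) (F : ℂ → X),
      P.numPieces ≤ K ∧ P.IsGeodesicExtension (α n) φ F ∧ P.mesh F < loopLength (α n) / 2) :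
    ∃ (P : DiscPartition) (b : ℕ) (M : P.Marking b)
      (I : Fin P.numPieces → Finset (Fin P.numEdges ⊕ Fin b)), P.numPieces ≤ K ∧
      (∀ i (F : ℂ → X), P.pieceLength F i =
        ∑ c ∈ I i, eVariationOn (fun t => F (M.arcSystem.arc c t)) (Set.Icc 0 1)) ∧
      ∀ᶠ n in (ω : Filter ℕ), Nonempty ((P.combType M I).Labelling (α n)) := by
  let N := 6 * K + 2
  let R : CombType → ℕ → Prop := fun τ n =>
    (∃ (P : DiscPartition) (b : ℕ) (M : P.Marking b)
      (I : Fin P.numPieces → Finset (Fin P.numEdges ⊕ Fin b)), P.numPieces ≤ K ∧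
      (∀ i (F : ℂ → X), P.pieceLength F i =
        ∑ c ∈ I i, eVariationOn (fun t => F (M.arcSystem.arc c t)) (Set.Icc 0 1)) ∧
      P.combType M I = τ) ∧ Nonempty (τ.Labelling (α n))
  have hR : ∀ᶠ n in (ω : Filter ℕ),
      ∃ τ ∈ {τ : CombType | τ.pieces ≤ N ∧ τ.edges ≤ N ∧ τ.arcs ≤ N}, R τ n := by
    filter_upwards [h] with n hn
    obtain ⟨P, φ, F, hK, hF, hmesh⟩ := hn
    obtain ⟨b, hb, ⟨M⟩⟩ := P.exists_marking
    obtain ⟨I, hI⟩ := M.exists_incidence X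
    have h1 := P.numEdges_le_three_mul
    have h2 := P.card_vertices_le
    refine ⟨P.combType M I, ⟨?_, ?_, ?_⟩, ⟨P, b, M, I, hK, hI, rfl⟩,
      P.nonempty_labelling M hI hF hmesh⟩
    · show P.numPieces ≤ 6 * K + 2
      omega
    · show P.numEdges ≤ 6 * K + 2
      omega
    · show b ≤ 6 * K + 2
      omega
  -- an ultrafilter that contains a finite union contains one of the sets
  obtain ⟨τ, -, hτ⟩ := (Ultrafilter.eventually_exists_mem_iff (CombType.finite_setOf_le N)).1 hR
  obtain ⟨n, ⟨P, b, M, I, hK, hI, rfl⟩, -⟩ := hτ.exists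
  exact ⟨P, b, M, I, hK, hI, hτ.mono fun n hn => hn.2⟩

/-- In a loop divisible space, limits of loops of length `l < ε` are divided into limits of loops
of length `l / 2`. -/
theorem exists_fillStep_of_divisible (hX : IsGeodesicSpace X) {ε : ℝ}
    (hdiv : UniformlyCoarselyLoopDivisible X ω d ε) :
    ∃ R : ℝ, 0 ≤ R ∧ ∀ l, 0 ≤ l → l < ε → ∀ α, IsLoopSeq e d l α →
    ∃ T : FillStep discBoundary (ℕ → C(Circle, X)) (AsymptoticCone ω e d),
      (∀ x ∈ discBoundary, T.F x = limitLoop e d α x) ∧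
      (∀ x, dist (T.F x) (coneMk e d fun n => α n 1) ≤ R * l) ∧
      ∀ i, IsLoopSeq e d (l / 2) (T.child i) ∧ dist (coneMk e d fun n => T.child i n 1)
        (coneMk e d fun n => α n 1) ≤ R * l ∧
        ∀ y ∈ discBoundary, limitLoop e d (T.child i) y = T.F (T.c i y) := by
  classical
  obtain ⟨K, hK⟩ := hdiv
  refine ⟨3 * K + 1, by positivity, fun l hl hlε α hα => ?_⟩
  by_cases hsmall : ∀ δ > 0, ∀ᶠ n in (ω : Filter ℕ), loopLength (α n) ≤ ENNReal.ofReal (δ * d.seq n)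
  · -- the limit loop is constant, and no pieces are needed
    refine ⟨{
      k := 0
      A := Set.univ
      F := fun _ => coneMk e d fun n => α n 1
      c := fun i => i.elim0
      child := fun i => i.elim0
      isClosed_A := isClosed_univ
      continuousOn_F := continuousOn_const
      isEmbedding_c := fun i => i.elim0
      cover := fun x => Or.inl (Set.mem_univ x)
      bd_subset := Set.subset_univ _
      c_mem_A := fun i => i.elim0
      overlap := fun i => i.elim0 }, fun x _ => ?_, fun x => ?_, fun i => i.elim0⟩
    · refine dist_le_zero.1 (le_of_forall_pos_le_add fun δ hδ => ?_)
      rw [zero_add]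
      refine dist_coneMk_le hα.isConeSeq (hα.isConeSeq' hl _) ?_
      filter_upwards [hsmall δ hδ] with n hn
      exact dist_le_of_edist_le_ofReal (mul_nonneg hδ.le (d.pos n).le)
        ((edist_le_loopLength _ _ _).trans hn)
    · rw [dist_self]
      positivity
  push Not at hsmall
  obtain ⟨δ, hδ, hlarge⟩ := hsmall
  have hδl : δ < l := by
    obtain ⟨n, h1, h2⟩ := (hlarge.and hα.length_le).exists
    have h3 := (ENNReal.ofReal_lt_ofReal_iff_of_nonneg (mul_nonneg hδ.le (d.pos n).le)).1
      (h1.trans_le h2)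
    exact lt_of_mul_lt_mul_right h3 (d.pos n).le
  -- otherwise the lengths are in the range `[δ d n, ε d n]` of the divisibility hypothesis
  obtain ⟨A, hA, hAK⟩ := hK δ ⟨hδ, hδl.trans hlε⟩
  have hpart : ∀ᶠ n in (ω : Filter ℕ), ∃ (P : DiscPartition) (φ : P.vertices → X) (F : ℂ → X),
      P.numPieces ≤ K ∧ P.IsGeodesicExtension (α n) φ F ∧
        P.mesh F < loopLength (α n) / 2 := by
    filter_upwards [hlarge, hα.length_le, hA,
      d.divergent.eventually_ge_atTop (1 / (ε - l))] with n h1 h2 h3 h4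
    have htop : loopLength (α n) ≠ ⊤ := ne_top_of_le_ne_top ENNReal.ofReal_ne_top h2
    refine exists_partition_of_divisibility_le htop (hAK n h3 _ ?_ ?_)
    · refine le_trans ?_ (Nat.le_ceil _)
      exact (ENNReal.ofReal_le_iff_le_toReal htop).1 h1.le
    · have h5 := (Nat.ceil_lt_add_one (ENNReal.toReal_nonneg (a := loopLength (α n)))).le
      have h6 := ENNReal.toReal_le_of_le_ofReal (mul_nonneg hl (d.pos n).le) h2
      rw [div_le_iff₀ (sub_pos.2 hlε)] at h4
      linarith
  obtain ⟨P, b, M, I, hPK, hI, hL⟩ := exists_common_combType hpart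
  have hgood := hL.and hα.length_le
  -- the loops without a labelling, or of excessive length, are replaced by constant loops; the
  -- limit does not change
  let β : ℕ → C(Circle, X) := fun n =>
    if Nonempty ((P.combType M I).Labelling (α n)) ∧
      loopLength (α n) ≤ ENNReal.ofReal (l * d.seq n) then α n
    else ContinuousMap.const Circle (α n 1)
  have hαβ : ∀ᶠ n in (ω : Filter ℕ), α n = β n := by
    filter_upwards [hgood] with n hn
    exact (if_pos hn).symm
  have hβ1 : ∀ n, β n 1 = α n 1 := fun n => by
    simp only [β]
    split_ifs <;> rfl
  have hβL : ∀ n, Nonempty ((P.combType M I).Labelling (β n)) := fun n => by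
    simp only [β]
    split_ifs with h
    · exact h.1
    · exact P.nonempty_labelling_const M I _
  have hβlen : ∀ n, loopLength (β n) ≤ ENNReal.ofReal (l * d.seq n) := fun n => by
    simp only [β]
    split_ifs with h
    · exact h.2
    · rw [loopLength_const]
      exact zero_le
  obtain ⟨T, h1, h2, h3⟩ := DiscPartition.exists_fillStep M hl (hα.congr hαβ) hβlen hI hX
    fun n => (hβL n).some
  have hle : (3 * (P.numPieces : ℝ) + 1) * l ≤ (3 * K + 1) * l := by gcongr
  simp only [hβ1] at h2 h3
  refine ⟨T, fun x hx => (h1 x hx).trans (coneMk_congr ?_), fun x => (h2 x).trans hle,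
    fun i => ⟨(h3 i).1, (h3 i).2.1.trans hle, (h3 i).2.2⟩⟩
  filter_upwards [hαβ] with n hn
  rw [hn]

/-- In a loop divisible space, limits of loops of length `l < ε` bound discs of diameter at most a
multiple of `l`. -/
theorem exists_disc_of_isLoopSeq (hX : IsGeodesicSpace X) {ε : ℝ}
    (hdiv : UniformlyCoarselyLoopDivisible X ω d ε) :
    ∃ R : ℝ, 0 ≤ R ∧ ∀ l, 0 ≤ l → l < ε → ∀ α, IsLoopSeq e d l α →
      ∃ f : C(Metric.closedBall (0 : ℂ) 1, AsymptoticCone ω e d),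
        (∀ x ∈ discBoundary, f x = limitLoop e d α x) ∧
        ∀ x, dist (f x) (coneMk e d fun n => α n 1) ≤ R * l := by
  obtain ⟨R, hR, hstep⟩ := exists_fillStep_of_divisible (e := e) hX hdiv
  refine ⟨2 * R, by positivity, fun l hl hlε α hα => ?_⟩
  have hcomp : CompleteSpace (AsymptoticCone ω e d) := completeSpace_asymptoticCone
  -- radii of nested balls that contain the images of the pieces of level `j`
  let r : ℕ → ℝ := fun j => 2 * R * (l / 2 ^ j)
  have hr : Tendsto r atTop (𝓝 0) := by
    have h1 : Tendsto (fun j : ℕ => 2 * R * (l * (1 / 2 : ℝ) ^ j)) atTop (𝓝 (2 * R * (l * 0))) :=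
      ((tendsto_pow_atTop_nhds_zero_of_lt_one (by norm_num) (by norm_num)).const_mul l).const_mul _
    rw [mul_zero, mul_zero] at h1
    refine h1.congr fun j => ?_
    simp only [r, div_eq_mul_inv, one_mul, inv_pow]
  obtain ⟨f, hf, hfB⟩ : ∃ f : C(Metric.closedBall (0 : ℂ) 1, AsymptoticCone ω e d),
      (∀ x ∈ discBoundary, f x = limitLoop e d α x) ∧
      ∀ x, f x ∈ closure (Metric.closedBall (coneMk e d fun n => α n 1) (r 0)) := by
    refine exists_filling_of_steps
      (fun j (σ : ℕ → C(Circle, X)) => IsLoopSeq e d (l / 2 ^ j) σ) (limitLoop e d)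
      (fun j σ => Metric.closedBall (coneMk e d fun n => σ n 1) (r j)) ?_ ?_ (σ := α)
      (by simpa using hα)
    · intro j σ hσ
      have hlj : l / 2 ^ j ≤ l := div_le_self hl (one_le_pow₀ one_le_two)
      have hlj0 : 0 ≤ l / 2 ^ j := by positivity
      obtain ⟨T, h1, h2, h3⟩ := hstep (l / 2 ^ j) hlj0 (hlj.trans_lt hlε) σ hσ
      have hr1 : r (j + 1) = R * (l / 2 ^ j) := by
        simp only [r, pow_succ]
        field_simp
      have hr2 : r j = R * (l / 2 ^ j) + R * (l / 2 ^ j) := by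
        simp only [r]
        ring
      have hnn : 0 ≤ R * (l / 2 ^ j) := by positivity
      refine ⟨T, h1, fun x => ?_, fun i => ⟨?_, fun y hy => ?_, (h3 i).2.2⟩⟩
      · rw [Metric.mem_closedBall, hr2]
        linarith [h2 x]
      · rw [pow_succ, ← div_div]
        exact (h3 i).1
      · rw [Metric.mem_closedBall] at hy ⊢
        refine (dist_triangle _ _ _).trans ((add_le_add hy (h3 i).2.1).trans_eq ?_)
        rw [hr1, hr2]
    · intro η hη
      obtain ⟨M, hM⟩ := eventually_atTop.1 (hr.eventually_lt_const (half_pos hη))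
      refine ⟨M, fun j hj σ _ y hy y' hy' => ?_⟩
      refine (dist_triangle_right y y' (coneMk e d fun n => σ n 1)).trans ?_
      rw [Metric.mem_closedBall] at hy hy'
      linarith [hM j hj]
  refine ⟨f, hf, fun x => ?_⟩
  have h1 := hfB x
  rw [Metric.isClosed_closedBall.closure_eq, Metric.mem_closedBall] at h1
  simpa [r] using h1

end FillLoop

/-! ### Filling triangles -/

open Filter Topology

section Triangle

variable {X : Type*} [MetricSpace X]

namespace GeodesicChoice

variable (c : GeodesicChoice X)

/-- The geodesic, extended to the real line by constants. -/
noncomputable def extPath (x y : X) (t : ℝ) : X := c.path x y (max 0 (min 1 t))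

theorem continuous_extPath (x y : X) : Continuous (c.extPath x y) :=
  (c.continuousOn_path x y).comp_continuous (by fun_prop) fun t =>
    ⟨le_max_left _ _, max_le zero_le_one (min_le_left _ _)⟩

theorem extPath_of_mem (x y : X) {t : ℝ} (ht : t ∈ Set.Icc (0 : ℝ) 1) :
    c.extPath x y t = c.path x y t := by
  rw [extPath, min_eq_right ht.2, max_eq_right ht.1]

theorem _root_.arccos_re_circleExp {θ : ℝ} (h0 : 0 ≤ θ) (h1 : θ ≤ Real.pi) :
    Real.arccos (Circle.exp θ : ℂ).re = θ := by
  rw [Circle.coe_exp, Complex.exp_ofReal_mul_I_re, Real.arccos_cos h0 h1]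

/-- The loop that runs through the geodesics from `p` to `q` and from `q` to `r` on the upper half
circle, and through the geodesic from `p` to `r` on the lower half circle, from right to left. -/
theorem exists_triangle (p q r : X) : ∃ α : C(Circle, X),
    (∀ t ∈ Set.Icc (0 : ℝ) 1, α (Circle.exp (Real.pi / 2 * t)) = c.path p q t) ∧
    (∀ t ∈ Set.Icc (0 : ℝ) 1, α (Circle.exp (Real.pi / 2 * (1 + t))) = c.path q r t) ∧
    ∀ t ∈ Set.Icc (0 : ℝ) 1, α (Circle.exp (-(Real.pi * t))) = c.path p r t := by
  have hpi := Real.pi_pos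
  -- `u` is the common parameter of the two half circles, from `0` on the right to `1` on the left
  let u : Circle → ℝ := fun z => Real.arccos (z : ℂ).re / Real.pi
  have hu : Continuous u := by
    have : Continuous fun z : Circle => (z : ℂ).re := by fun_prop
    exact (Real.continuous_arccos.comp this).div_const _
  let up : ℝ → X := fun t => if t ≤ 1 / 2 then c.extPath p q (2 * t) else c.extPath q r (2 * t - 1)
  have hup : Continuous up := by
    refine Continuous.if_le ((c.continuous_extPath _ _).comp (by fun_prop))
      ((c.continuous_extPath _ _).comp (by fun_prop)) continuous_id continuous_const fun t ht => ?_
    rw [show t = 1 / 2 from ht,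
      c.extPath_of_mem _ _ (by norm_num), c.extPath_of_mem _ _ (by norm_num)]
    norm_num [c.path_one, c.path_zero]
  have hup0 : up 0 = p := by
    simp only [up]
    rw [if_pos (by norm_num), mul_zero, c.extPath_of_mem _ _ (by norm_num), c.path_zero]
  have hup1 : up 1 = r := by
    simp only [up]
    rw [if_neg (by norm_num), c.extPath_of_mem _ _ (by norm_num)]
    norm_num [c.path_one]
  have hexp : ∀ t : ℝ, 0 ≤ t → t ≤ 1 → u (Circle.exp (Real.pi * t)) = t := by
    intro t h0 h1
    simp only [u]
    rw [arccos_re_circleExp (by positivity) (mul_le_of_le_one_right hpi.le h1),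
      mul_div_cancel_left₀ _ hpi.ne']
  have him : ∀ θ : ℝ, (Circle.exp θ : ℂ).im = Real.sin θ := fun θ => by
    rw [Circle.coe_exp, Complex.exp_ofReal_mul_I_im]
  have hdown : ∀ t : ℝ, u (Circle.exp (-(Real.pi * t))) = u (Circle.exp (Real.pi * t)) := by
    intro t
    simp only [u, Circle.coe_exp, Complex.exp_ofReal_mul_I_re, Real.cos_neg]
  have hends : ∀ z : Circle, 0 = (z : ℂ).im → up (u z) = c.extPath p r (u z) := by
    intro z hz
    have h1 := Circle.normSq_coe z
    rw [Complex.normSq_apply, ← hz, mul_zero, add_zero] at h1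
    have h2 : u z = 0 ∨ u z = 1 := by
      rcases mul_self_eq_one_iff.1 h1 with h | h
      · left; simp only [u, h, Real.arccos_one, zero_div]
      · right; simp only [u, h, Real.arccos_neg_one, div_self hpi.ne']
    rcases h2 with h | h <;> rw [h, c.extPath_of_mem _ _ (by norm_num)]
    · rw [hup0, c.path_zero]
    · rw [hup1, c.path_one]
  refine ⟨⟨fun z => if 0 ≤ (z : ℂ).im then up (u z) else c.extPath p r (u z),
    Continuous.if_le (hup.comp hu) ((c.continuous_extPath _ _).comp hu) continuous_const
      (by fun_prop) hends⟩, fun t ht => ?_, fun t ht => ?_, fun t ht => ?_⟩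
  · simp only [ContinuousMap.coe_mk]
    have h2 : Real.pi / 2 * t = Real.pi * (t / 2) := by ring
    rw [h2, hexp _ (by linarith [ht.1]) (by linarith [ht.2]), if_pos]
    · simp only [up]
      rw [if_pos (by linarith [ht.2]), mul_div_cancel₀ t two_ne_zero, c.extPath_of_mem _ _ ht]
    · rw [him]
      refine Real.sin_nonneg_of_nonneg_of_le_pi (mul_nonneg hpi.le (by linarith [ht.1])) ?_
      exact mul_le_of_le_one_right hpi.le (by linarith [ht.2])
  · simp only [ContinuousMap.coe_mk]
    have h2 : Real.pi / 2 * (1 + t) = Real.pi * ((1 + t) / 2) := by ring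
    rw [h2, hexp _ (by linarith [ht.1]) (by linarith [ht.2]), if_pos]
    · simp only [up]
      split_ifs with h
      · have h3 : t = 0 := by linarith [ht.1]
        subst h3
        rw [c.path_zero, c.extPath_of_mem _ _ (by norm_num)]
        norm_num [c.path_one]
      · rw [show 2 * ((1 + t) / 2) - 1 = t by ring, c.extPath_of_mem _ _ ht]
    · rw [him]
      refine Real.sin_nonneg_of_nonneg_of_le_pi (mul_nonneg hpi.le (by linarith [ht.1])) ?_
      exact mul_le_of_le_one_right hpi.le (by linarith [ht.2])
  · simp only [ContinuousMap.coe_mk]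
    rw [← c.extPath_of_mem _ _ ht]
    have hut : u (Circle.exp (-(Real.pi * t))) = t := by rw [hdown, hexp t ht.1 ht.2]
    split_ifs with h
    · rw [hends, hut]
      refine le_antisymm h ?_
      rw [him, Real.sin_neg]
      exact neg_nonpos.2 (Real.sin_nonneg_of_nonneg_of_le_pi (mul_nonneg hpi.le ht.1)
        (mul_le_of_le_one_right hpi.le ht.2))
    · rw [hut]

theorem eVariationOn_le_of_eq_path {f : ℝ → X} {a b : ℝ} (hab : a < b) {x y : X}
    (h : ∀ t ∈ Set.Icc (0 : ℝ) 1, f (a + (b - a) * t) = c.path x y t) :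
    eVariationOn f (Set.Icc a b) ≤ edist x y := by
  have hpos := sub_pos.2 hab
  have h0 : ∀ θ ∈ Set.Icc a b, (θ - a) / (b - a) ∈ Set.Icc (0 : ℝ) 1 := fun θ hθ =>
    ⟨div_nonneg (sub_nonneg.2 hθ.1) hpos.le, (div_le_one hpos).2 (by linarith [hθ.2])⟩
  refine le_trans (le_of_eq ?_) ((eVariationOn.comp_le_of_monotoneOn (c.path x y)
    (fun θ => (θ - a) / (b - a)) (t := Set.Icc a b) (fun s _ t _ hst => ?_) h0).trans
      (c.eVariationOn_path_le x y))
  · refine eVariationOn.congr fun θ hθ => ?_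
    rw [Function.comp_apply, ← h _ (h0 θ hθ), mul_div_cancel₀ _ hpos.ne', add_sub_cancel]
  · exact div_le_div_of_nonneg_right (by linarith) hpos.le

theorem eVariationOn_le_of_eq_path_symm {f : ℝ → X} {a b : ℝ} (hab : a < b) {x y : X}
    (h : ∀ t ∈ Set.Icc (0 : ℝ) 1, f (b - (b - a) * t) = c.path x y t) :
    eVariationOn f (Set.Icc a b) ≤ edist x y := by
  have hpos := sub_pos.2 hab
  have h0 : ∀ θ ∈ Set.Icc a b, (b - θ) / (b - a) ∈ Set.Icc (0 : ℝ) 1 := fun θ hθ =>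
    ⟨div_nonneg (sub_nonneg.2 hθ.2) hpos.le, (div_le_one hpos).2 (by linarith [hθ.1])⟩
  refine le_trans (le_of_eq ?_) ((eVariationOn.comp_le_of_antitoneOn (c.path x y)
    (fun θ => (b - θ) / (b - a)) (t := Set.Icc a b) (fun s _ t _ hst => ?_) h0).trans
      (c.eVariationOn_path_le x y))
  · refine eVariationOn.congr fun θ hθ => ?_
    rw [Function.comp_apply, ← h _ (h0 θ hθ), mul_div_cancel₀ _ hpos.ne', sub_sub_cancel]
  · exact div_le_div_of_nonneg_right (by linarith) hpos.le

theorem loopLength_triangle_le {p q r : X} {α : C(Circle, X)}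
    (h1 : ∀ t ∈ Set.Icc (0 : ℝ) 1, α (Circle.exp (Real.pi / 2 * t)) = c.path p q t)
    (h2 : ∀ t ∈ Set.Icc (0 : ℝ) 1, α (Circle.exp (Real.pi / 2 * (1 + t))) = c.path q r t)
    (h3 : ∀ t ∈ Set.Icc (0 : ℝ) 1, α (Circle.exp (-(Real.pi * t))) = c.path p r t) :
    loopLength α ≤ edist p q + edist q r + edist p r := by
  have hpi := Real.pi_pos
  have e1 := eVariationOn.Icc_add_Icc (fun t : ℝ => α (Circle.exp t)) (s := Set.univ)
    (a := 0) (b := Real.pi) (c := 2 * Real.pi) (by linarith) (by linarith) (Set.mem_univ _)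
  have e2 := eVariationOn.Icc_add_Icc (fun t : ℝ => α (Circle.exp t)) (s := Set.univ)
    (a := 0) (b := Real.pi / 2) (c := Real.pi) (by linarith) (by linarith) (Set.mem_univ _)
  simp only [Set.univ_inter] at e1 e2
  rw [loopLength, ← e1, ← e2]
  refine add_le_add (add_le_add ?_ ?_) ?_
  · refine c.eVariationOn_le_of_eq_path (by linarith) fun t ht => ?_
    rw [← h1 t ht]
    congr 2
    ring
  · refine c.eVariationOn_le_of_eq_path (by linarith) fun t ht => ?_
    rw [← h2 t ht]
    congr 2
    ring
  · refine c.eVariationOn_le_of_eq_path_symm (by linarith) fun t ht => ?_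
    rw [← h3 t ht]
    rw [← Circle.exp_add_two_pi (-(Real.pi * t))]
    congr 2
    ring

end GeodesicChoice

variable {ω : Ultrafilter ℕ} {e : ℕ → X} {d : ScalingSequence ω}

/-- A chosen sequence that represents a point of the asymptotic cone. -/
noncomputable def coneRep (p : AsymptoticCone ω e d) : ℕ → X := (exists_coneMk_eq p).choose

theorem isConeSeq_coneRep (p : AsymptoticCone ω e d) : IsConeSeq e d (coneRep p) :=
  (exists_coneMk_eq p).choose_spec.1

theorem coneMk_coneRep (p : AsymptoticCone ω e d) : coneMk e d (coneRep p) = p :=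
  (exists_coneMk_eq p).choose_spec.2

/-- The limit of the chosen geodesics, which is a geodesic of the cone. -/
noncomputable def conePath (c : GeodesicChoice X) (p q : AsymptoticCone ω e d) (t : ℝ) :
    AsymptoticCone ω e d :=
  coneMk e d fun n => c.path (coneRep p n) (coneRep q n) t

theorem conePath_one (c : GeodesicChoice X) (p q : AsymptoticCone ω e d) :
    conePath c p q 1 = q := by
  simp only [conePath, c.path_one]
  exact coneMk_coneRep q

theorem conePath_self (c : GeodesicChoice X) (p : AsymptoticCone ω e d) {t : ℝ}
    (ht : t ∈ Set.Icc (0 : ℝ) 1) : conePath c p p t = p := by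
  have h : ∀ n, c.path (coneRep p n) (coneRep p n) t = coneRep p n := fun n => by
    have h1 := c.dist_path_left_le (coneRep p n) (coneRep p n) ht
    rw [dist_self] at h1
    exact dist_le_zero.1 h1
  simp only [conePath, h]
  exact coneMk_coneRep p

/-- The rescaled distances of representatives are bounded by any number larger than the distance in
the cone; the factor `4 / 3` makes the perimeter of a triangle with sides `D` at most `4 D`. -/
theorem eventually_dist_coneRep_le {p q : AsymptoticCone ω e d} {D : ℝ} (h : dist p q ≤ D) :
    ∀ᶠ n in (ω : Filter ℕ), dist (coneRep p n) (coneRep q n) ≤ 4 / 3 * D * d.seq n := by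
  rcases eq_or_lt_of_le (dist_nonneg.trans h) with rfl | hD
  · rw [dist_le_zero.1 h]
    simp
  · have h1 := tendsto_dist_coneMk (isConeSeq_coneRep p) (isConeSeq_coneRep q)
    rw [coneMk_coneRep, coneMk_coneRep] at h1
    filter_upwards [h1.eventually_lt_const (by linarith : dist p q < 4 / 3 * D)] with n hn
    exact ((div_lt_iff₀ (d.pos n)).1 hn).le

/-- The map `S` of the square fills the triangle with vertices `p`, `q`, `r` whose sides are given
by the paths `P`: the lower side of the square is mapped to the sides from `p` to `q` and from `q`
to `r`, the upper side to the side from `p` to `r`, and the vertical sides to `p` and `r`. -/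
structure FillsTriangle {Y : Type*} [MetricSpace Y] (P : Y → Y → ℝ → Y) (p q r : Y) (ρ : ℝ)
    (S : C(unitInterval × unitInterval, Y)) : Prop where
  top : ∀ t, S (t, 1) = P p r t
  bottom_left : ∀ s t : unitInterval, (s : ℝ) = t / 2 → S (s, 0) = P p q t
  bottom_right : ∀ s t : unitInterval, (s : ℝ) = (1 + t) / 2 → S (s, 0) = P q r t
  left : ∀ h, S (0, h) = p
  right : ∀ h, S (1, h) = r
  dist_le : ∀ x, dist (S x) p ≤ ρ

/-- The limits of geodesic triangles of small perimeter are filled in proportion to their size. -/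
theorem exists_fillsTriangle (hX : IsGeodesicSpace X) {ε : ℝ}
    (hdiv : UniformlyCoarselyLoopDivisible X ω d ε) (c : GeodesicChoice X) :
    ∃ R : ℝ, 0 ≤ R ∧ ∀ (D : ℝ) (p q r : AsymptoticCone ω e d), 4 * D < ε → dist p q ≤ D →
      dist q r ≤ D → dist p r ≤ D → ∃ S, FillsTriangle (conePath c) p q r (R * D) S := by
  obtain ⟨R, hR, hfill⟩ := exists_disc_of_isLoopSeq (e := e) hX hdiv
  refine ⟨R * 4, by positivity, fun D p q r hD hpq hqr hpr => ?_⟩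
  have hD0 : 0 ≤ D := dist_nonneg.trans hpq
  have hpi := Real.pi_pos
  choose α h1 h2 h3 using fun n => c.exists_triangle (coneRep p n) (coneRep q n) (coneRep r n)
  have hα1 : ∀ n, α n 1 = coneRep p n := fun n => by
    have := h1 n 0 ⟨le_rfl, zero_le_one⟩
    rwa [mul_zero, Circle.exp_zero, c.path_zero] at this
  have hAE : ∀ {x y : AsymptoticCone ω e d} (_ : dist x y ≤ D) (q : unitInterval → Circle)
      (_ : Continuous q) (_ : ∀ n t, α n (q t) = c.path (coneRep x n) (coneRep y n) t),
      AsympEquicontinuousOn d (fun n => α n) (Set.range q) := by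
    intro x y hxy q hq hpath
    refine AsympEquicontinuousOn.of_comp hq fun z w _ _ hzw => ?_
    simp only [hpath]
    have ht : Tendsto (fun n => ((z n : ℝ) - w)) ω (𝓝 0) := by
      have := ((continuous_subtype_val.tendsto _).comp hzw).sub_const (w : ℝ)
      simpa using this
    have h4 := ht.abs.mul_const (4 / 3 * D)
    rw [abs_zero, zero_mul] at h4
    refine squeeze_zero' (Eventually.of_forall fun n => div_nonneg dist_nonneg (d.pos n).le) ?_ h4
    filter_upwards [eventually_dist_coneRep_le hxy] with n hn
    rw [div_le_iff₀ (d.pos n), c.dist_path _ _ _ (z n).2 _ w.2, mul_assoc]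
    gcongr
  have hloop : IsLoopSeq e d (4 * D) α := by
    refine ⟨?_, by simp only [hα1]; exact isConeSeq_coneRep p, ?_⟩
    · -- the circle is covered by the three arcs that run through the sides
      let Q : Fin 3 → unitInterval → Circle := ![fun t => Circle.exp (Real.pi / 2 * t),
        fun t => Circle.exp (Real.pi / 2 * (1 + t)), fun t => Circle.exp (-(Real.pi * t))]
      have hQ : ∀ i, Continuous (Q i) := by
        intro i
        fin_cases i <;> simp only [Q] <;> (show Continuous fun t : unitInterval => Circle.exp _) <;>
          fun_prop
      have hcov : (Set.univ : Set Circle) = ⋃ i, Set.range (Q i) := by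
        refine (Set.eq_univ_of_forall fun z => ?_).symm
        have hz := Circle.exp_arg z
        have hle := Complex.arg_le_pi (z : ℂ)
        have hgt := Complex.neg_pi_lt_arg (z : ℂ)
        set θ := Complex.arg (z : ℂ) with hθ
        rw [Set.mem_iUnion]
        by_cases c1 : θ ≤ 0
        · refine ⟨2, ⟨-θ / Real.pi, div_nonneg (by linarith) hpi.le,
            (div_le_one hpi).2 (by linarith)⟩, ?_⟩
          show Circle.exp (-(Real.pi * (-θ / Real.pi))) = z
          rw [mul_div_cancel₀ _ hpi.ne', neg_neg, hz]
        · by_cases c2 : θ ≤ Real.pi / 2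
          · refine ⟨0, ⟨θ / (Real.pi / 2), div_nonneg (by linarith) (by linarith),
              (div_le_one (by linarith)).2 c2⟩, ?_⟩
            show Circle.exp (Real.pi / 2 * (θ / (Real.pi / 2))) = z
            rw [mul_div_cancel₀ _ (by positivity), hz]
          · refine ⟨1, ⟨θ / (Real.pi / 2) - 1, ?_, ?_⟩, ?_⟩
            · rw [sub_nonneg, one_le_div (by linarith)]
              linarith
            · rw [sub_le_iff_le_add, div_le_iff₀ (by linarith)]
              linarith
            · show Circle.exp (Real.pi / 2 * (1 + (θ / (Real.pi / 2) - 1))) = z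
              rw [add_sub_cancel, mul_div_cancel₀ _ (by positivity), hz]
      rw [hcov]
      refine AsympEquicontinuousOn.iUnion (fun i => (isCompact_range (hQ i)).isClosed) fun i => ?_
      fin_cases i
      · exact hAE hpq _ (hQ 0) fun n t => h1 n t t.2
      · exact hAE hqr _ (hQ 1) fun n t => h2 n t t.2
      · exact hAE hpr _ (hQ 2) fun n t => h3 n t t.2
    · filter_upwards [eventually_dist_coneRep_le hpq, eventually_dist_coneRep_le hqr,
        eventually_dist_coneRep_le hpr] with n a1 a2 a3
      refine (c.loopLength_triangle_le (h1 n) (h2 n) (h3 n)).trans ?_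
      rw [edist_dist, edist_dist, edist_dist, ← ENNReal.ofReal_add dist_nonneg dist_nonneg,
        ← ENNReal.ofReal_add (by positivity) dist_nonneg]
      refine ENNReal.ofReal_le_ofReal ?_
      linarith
  obtain ⟨f, hf, hfR⟩ := hfill (4 * D) (by positivity) hD α hloop
  -- the square is mapped to the disc by vertical segments between the two half circles
  let ψ : unitInterval × unitInterval → ℂ := fun x =>
    ((x.2 : ℝ) : ℂ) * Circle.exp (-(Real.pi * x.1)) + ((1 - x.2 : ℝ) : ℂ) * Circle.exp (Real.pi * x.1)
  have hψ : Continuous ψ := by fun_prop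
  have hψm : ∀ x, ψ x ∈ Metric.closedBall (0 : ℂ) 1 := by
    intro x
    rw [mem_closedBall_zero_iff]
    refine (norm_add_le _ _).trans ?_
    rw [norm_mul, norm_mul, Circle.norm_coe, Circle.norm_coe, Complex.norm_real, Complex.norm_real,
      Real.norm_eq_abs, Real.norm_eq_abs, abs_of_nonneg x.2.2.1,
      abs_of_nonneg (sub_nonneg.2 x.2.2.2)]
    linarith
  have hval : ∀ x (θ : ℝ), ψ x = Circle.exp θ →
      f ⟨ψ x, hψm x⟩ = coneMk e d fun n => α n (Circle.exp θ) := by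
    intro x θ hx
    rw [hf _ (show ‖ψ x‖ = 1 by rw [hx, Circle.norm_coe])]
    simp only [limitLoop, hx, toCircle_coe]
  refine ⟨⟨fun x => f ⟨ψ x, hψm x⟩, f.continuous.comp (hψ.subtype_mk _)⟩, fun t => ?_,
    fun s t hst => ?_, fun s t hst => ?_, fun h => ?_, fun h => ?_, fun x => ?_⟩
  · refine (hval (t, 1) (-(Real.pi * t)) (by simp [ψ])).trans ?_
    simp only [h3 _ t t.2]
    rfl
  · refine (hval (s, 0) (Real.pi * s) (by simp [ψ])).trans ?_
    rw [hst, show Real.pi * ((t : ℝ) / 2) = Real.pi / 2 * t by ring]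
    simp only [h1 _ t t.2]
    rfl
  · refine (hval (s, 0) (Real.pi * s) (by simp [ψ])).trans ?_
    rw [hst, show Real.pi * ((1 + (t : ℝ)) / 2) = Real.pi / 2 * (1 + t) by ring]
    simp only [h2 _ t t.2]
    rfl
  · refine (hval (0, h) 0 (by simp [ψ])).trans ?_
    rw [Circle.exp_zero]
    simp only [hα1]
    exact coneMk_coneRep p
  · refine (hval (1, h) (Real.pi / 2 * (1 + 1)) ?_).trans ?_
    · have hm : (Circle.exp (-Real.pi) : ℂ) = Circle.exp Real.pi := by
        rw [← Circle.exp_add_two_pi (-Real.pi)]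
        congr 2
        ring
      simp only [ψ, Set.Icc.coe_one, mul_one, hm]
      rw [← add_mul, show Real.pi / 2 * (1 + 1) = Real.pi by ring]
      push_cast
      ring
    · simp only [h2 _ 1 ⟨zero_le_one, le_rfl⟩, c.path_one]
      exact coneMk_coneRep r
  · have h4 := hfR ⟨ψ x, hψm x⟩
    simp only [hα1] at h4
    rw [coneMk_coneRep] at h4
    rw [mul_assoc]
    exact h4

end Triangle

/-! ### Filling loops -/

open Filter Topology

section Loop

variable {Y : Type*} [MetricSpace Y]

/-- The boundary of the unit square. -/
def squareBoundary : Set (unitInterval × unitInterval) :=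
  {x | x.2 = 1 ∨ x.2 = 0 ∨ x.1 = 0 ∨ x.1 = 1}

/-- The points of `Y` whose distance to the path `γ` over `[a, b]` is at most `R` times the
diameter of that path. -/
def pathNhd (γ : ℝ → Y) (R a b : ℝ) : Set Y :=
  {y | ∃ t ∈ Set.Icc a b, dist y (γ t) ≤ R * Metric.diam (γ '' Set.Icc a b)}

theorem dist_le_diam_image_Icc {γ : ℝ → Y} (hγ : Continuous γ) {a b s t : ℝ}
    (hs : s ∈ Set.Icc a b) (ht : t ∈ Set.Icc a b) :
    dist (γ s) (γ t) ≤ Metric.diam (γ '' Set.Icc a b) :=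
  Metric.dist_le_diam_of_mem (isCompact_Icc.image hγ).isBounded ⟨s, hs, rfl⟩ ⟨t, ht, rfl⟩

theorem diam_image_Icc_mono {γ : ℝ → Y} (hγ : Continuous γ) {a b a' b' : ℝ} (ha : a' ≤ a)
    (hb : b ≤ b') : Metric.diam (γ '' Set.Icc a b) ≤ Metric.diam (γ '' Set.Icc a' b') :=
  Metric.diam_mono (Set.image_mono (Set.Icc_subset_Icc ha hb))
    (isCompact_Icc.image hγ).isBounded

theorem pathNhd_mono {γ : ℝ → Y} (hγ : Continuous γ) {R a b a' b' : ℝ} (hR : 0 ≤ R) (ha : a' ≤ a)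
    (hb : b ≤ b') : pathNhd γ R a b ⊆ pathNhd γ R a' b' := by
  rintro y ⟨t, ht, hy⟩
  exact ⟨t, Set.Icc_subset_Icc ha hb ht,
    hy.trans (mul_le_mul_of_nonneg_left (diam_image_Icc_mono hγ ha hb) hR)⟩

theorem dist_le_of_mem_pathNhd {γ : ℝ → Y} (hγ : Continuous γ) {R a b : ℝ} {y y' : Y}
    (hy : y ∈ pathNhd γ R a b) (hy' : y' ∈ pathNhd γ R a b) :
    dist y y' ≤ (2 * R + 1) * Metric.diam (γ '' Set.Icc a b) := by
  obtain ⟨t, ht, h⟩ := hy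
  obtain ⟨t', ht', h'⟩ := hy'
  have h1 := dist_triangle4_right y y' (γ t) (γ t')
  have h2 := dist_le_diam_image_Icc hγ ht ht'
  linarith

/-- The boundary values of the filling of the square over the parameter interval `[a, b]`: the top
side is mapped to the path `P` between the ends, and the rest follows `γ`. -/
noncomputable def squareBoundaryValue (P : Y → Y → ℝ → Y) (γ : ℝ → Y) (ab : ℝ × ℝ)
    (x : unitInterval × unitInterval) : Y :=
  if x.2 = 1 then P (γ ab.1) (γ ab.2) x.1 else γ (ab.1 + x.1 * (ab.2 - ab.1))

/-- The left and the right lower quarter of the unit square. -/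
noncomputable def quarter (i : Fin 2) (x : unitInterval × unitInterval) :
    unitInterval × unitInterval :=
  (⟨((i : ℕ) + (x.1 : ℝ)) / 2, by
    have hi : ((i : ℕ) : ℝ) ≤ 1 := by exact_mod_cast Nat.le_of_lt_succ i.2
    constructor <;> linarith [x.1.2.1, x.1.2.2, Nat.cast_nonneg (α := ℝ) (i : ℕ)]⟩,
   ⟨(x.2 : ℝ) / 2, by constructor <;> linarith [x.2.2.1, x.2.2.2]⟩)

theorem isClosedEmbedding_quarter (i : Fin 2) : Topology.IsClosedEmbedding (quarter i) := by
  refine Continuous.isClosedEmbedding ?_ fun x y h => ?_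
  · unfold quarter
    fun_prop
  · have h1 := congrArg (fun z => (z.1 : ℝ)) h
    have h2 := congrArg (fun z => (z.2 : ℝ)) h
    simp only [quarter] at h1 h2
    ext <;> linarith

/-- The upper half of the square is filled by a triangle with vertices `γ a`, `γ ((a + b) / 2)` and
`γ b`; the two lower quarters are left to the next steps. -/
theorem exists_fillStep_of_fillsTriangle {P : Y → Y → ℝ → Y}
    (hP1 : ∀ p q, P p q 1 = q) {γ : ℝ → Y} (hγ : Continuous γ) {R a b : ℝ} (hR : 0 ≤ R)
    (hab : a ≤ b) {S : C(unitInterval × unitInterval, Y)}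
    (hS : FillsTriangle P (γ a) (γ ((a + b) / 2)) (γ b)
      (R * Metric.diam (γ '' Set.Icc a b)) S) :
    ∃ T : FillStep squareBoundary (ℝ × ℝ) Y,
      (∀ x ∈ squareBoundary, T.F x = squareBoundaryValue P γ (a, b) x) ∧
      (∀ x, T.F x ∈ pathNhd γ R a b) ∧
      ∀ i, (T.child i = (a, (a + b) / 2) ∨ T.child i = ((a + b) / 2, b)) ∧
        ∀ y ∈ squareBoundary, squareBoundaryValue P γ (T.child i) y = T.F (T.c i y) := by
  -- `F` is used on the upper half and, below it, on the lower side and three vertical segments;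
  -- elsewhere its values only matter for being in the neighbourhood of the path
  let F : unitInterval × unitInterval → Y := fun x =>
    if (1 / 2 : ℝ) ≤ x.2 then S (x.1, Set.projIcc 0 1 zero_le_one (2 * (x.2 : ℝ) - 1))
    else γ (a + x.1 * (b - a))
  let A₁ : Set (unitInterval × unitInterval) := {x | (1 / 2 : ℝ) ≤ x.2}
  let A₂ : Set (unitInterval × unitInterval) := {x | (x.2 : ℝ) ≤ 1 / 2 ∧
    ((x.2 : ℝ) = 0 ∨ (x.1 : ℝ) = 0 ∨ (x.1 : ℝ) = 1 / 2 ∨ (x.1 : ℝ) = 1)}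
  have hA₁ : IsClosed A₁ := isClosed_le (by fun_prop) (by fun_prop)
  have hA₂ : IsClosed A₂ := by
    have hc : ∀ (g : unitInterval × unitInterval → ℝ) (r : ℝ), Continuous g →
        IsClosed {x | g x = r} := fun g r hg => isClosed_eq hg continuous_const
    have hle : IsClosed {x : unitInterval × unitInterval | (x.2 : ℝ) ≤ 1 / 2} :=
      isClosed_le (by fun_prop) (by fun_prop)
    exact hle.inter ((hc (fun x => x.2) 0 (by fun_prop)).union
      ((hc (fun x => x.1) 0 (by fun_prop)).union ((hc (fun x => x.1) (1 / 2) (by fun_prop)).union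
        (hc (fun x => x.1) 1 (by fun_prop)))))
  have hleft : ∀ x : unitInterval × unitInterval, (x.1 : ℝ) = 0 → ∀ h, S (x.1, h) = γ a := by
    intro x hx h
    rw [show x.1 = 0 from Subtype.ext hx, hS.left]
  have hright : ∀ x : unitInterval × unitInterval, (x.1 : ℝ) = 1 → ∀ h, S (x.1, h) = γ b := by
    intro x hx h
    rw [show x.1 = 1 from Subtype.ext hx, hS.right]
  have hF₂ : ∀ x ∈ A₂, F x = γ (a + x.1 * (b - a)) := by
    rintro x ⟨hx, hx'⟩
    simp only [F]
    split_ifs with h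
    · have h2 : (x.2 : ℝ) = 1 / 2 := le_antisymm hx h
      rcases hx' with h3 | h3 | h3 | h3
      · norm_num [h2] at h3
      · rw [hleft x h3, h3]
        ring_nf
      · rw [h2, show Set.projIcc (0 : ℝ) 1 zero_le_one (2 * (1 / 2) - 1) = 0 by
          norm_num [Set.projIcc_left], hS.bottom_left x.1 1 (by rw [h3]; simp)]
        rw [Set.Icc.coe_one, hP1, h3]
        ring_nf
      · rw [hright x h3, h3]
        ring_nf
    · rfl
  have hcont : ContinuousOn F (A₁ ∪ A₂) := by
    refine ContinuousOn.union_of_isClosed ?_ ?_ hA₁ hA₂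
    · refine ContinuousOn.congr (f := fun x : unitInterval × unitInterval =>
        S (x.1, Set.projIcc 0 1 zero_le_one (2 * (x.2 : ℝ) - 1))) ?_ fun x hx => if_pos hx
      have := continuous_projIcc (a := (0 : ℝ)) (b := 1) (h := zero_le_one)
      exact Continuous.continuousOn (by fun_prop)
    · refine ContinuousOn.congr (f := fun x : unitInterval × unitInterval =>
        γ (a + x.1 * (b - a))) (Continuous.continuousOn (by fun_prop)) hF₂
  have hc2 : ∀ i y, ((quarter i y).2 : ℝ) = y.2 / 2 := fun i y => rfl
  have hc1 : ∀ y, ((quarter 0 y).1 : ℝ) = y.1 / 2 := fun y => by simp [quarter]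
  have hc1' : ∀ y, ((quarter 1 y).1 : ℝ) = (1 + y.1) / 2 := fun y => by simp [quarter]
  have hbd : ∀ y : unitInterval × unitInterval, y ∈ squareBoundary ↔
      (y.2 : ℝ) = 1 ∨ (y.2 : ℝ) = 0 ∨ (y.1 : ℝ) = 0 ∨ (y.1 : ℝ) = 1 := fun y => by
    show (y.2 = 1 ∨ y.2 = 0 ∨ y.1 = 0 ∨ y.1 = 1) ↔ _
    simp only [Subtype.ext_iff]
    rfl
  have hcA : ∀ i y, quarter i y ∈ A₁ ∪ A₂ ↔ y ∈ squareBoundary := by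
    intro i y
    have hy1 := y.1.2.1
    have hy2 := y.1.2.2
    have hy3 := y.2.2.1
    have hy4 := y.2.2.2
    rw [hbd]
    simp only [A₁, A₂, Set.mem_union, Set.mem_ofPred_eq, hc2]
    fin_cases i
    · simp only [Fin.zero_eta, hc1]
      constructor
      · rintro (h | ⟨-, h | h | h | h⟩)
        · left; linarith
        · right; left; linarith
        · right; right; left; linarith
        · right; right; right; linarith
        · exfalso; linarith
      · rintro (h | h | h | h)
        · left; linarith
        · right; exact ⟨by linarith, by left; linarith⟩
        · right; exact ⟨by linarith, by right; left; linarith⟩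
        · right; exact ⟨by linarith, by right; right; left; linarith⟩
    · simp only [Fin.mk_one, hc1']
      constructor
      · rintro (h | ⟨-, h | h | h | h⟩)
        · left; linarith
        · right; left; linarith
        · exfalso; linarith
        · right; right; left; linarith
        · right; right; right; linarith
      · rintro (h | h | h | h)
        · left; linarith
        · right; exact ⟨by linarith, by left; linarith⟩
        · right; exact ⟨by linarith, by right; right; left; linarith⟩
        · right; exact ⟨by linarith, by right; right; right; linarith⟩
  -- the values on the boundaries of the two quarters
  have htop : ∀ i y, y ∈ squareBoundary → (y.2 : ℝ) = 1 →
      F (quarter i y) = S ((quarter i y).1, 0) := by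
    intro i y _ hy
    simp only [F]
    rw [if_pos (by rw [hc2, hy]), hc2, hy, show Set.projIcc (0 : ℝ) 1 zero_le_one (2 * (1 / 2) - 1)
      = 0 by norm_num [Set.projIcc_left]]
  have hlow : ∀ i y, y ∈ squareBoundary → (y.2 : ℝ) ≠ 1 →
      F (quarter i y) = γ (a + (quarter i y).1 * (b - a)) := by
    intro i y hy hy1
    rcases (hcA i y).2 hy with h | h
    · refine absurd ?_ hy1
      have h1 : (1 / 2 : ℝ) ≤ (quarter i y).2 := h
      rw [hc2] at h1
      linarith [y.2.2.2]
    · exact hF₂ _ h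
  refine ⟨{
    k := 2
    A := A₁ ∪ A₂
    F := F
    c := quarter
    child := ![(a, (a + b) / 2), ((a + b) / 2, b)]
    isClosed_A := hA₁.union hA₂
    continuousOn_F := hcont
    isEmbedding_c := isClosedEmbedding_quarter
    cover := fun x => ?_
    bd_subset := fun x hx => ?_
    c_mem_A := hcA
    overlap := fun i i' y y' hne h => ?_ }, fun x hx => ?_, fun x => ?_, fun i => ⟨?_, fun y hy => ?_⟩⟩
  · have h1 := x.1.2.1
    have h2 := x.1.2.2
    have h3 := x.2.2.1
    by_cases h : (1 / 2 : ℝ) ≤ x.2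
    · exact Or.inl (Or.inl h)
    · right
      by_cases h' : (x.1 : ℝ) ≤ 1 / 2
      · refine ⟨0, (⟨2 * x.1, by linarith, by linarith⟩, ⟨2 * x.2, by linarith, by linarith⟩), ?_⟩
        ext <;> simp [quarter]
      · refine ⟨1, (⟨2 * x.1 - 1, by linarith, by linarith⟩,
          ⟨2 * x.2, by linarith, by linarith⟩), ?_⟩
        ext <;> simp [quarter]
  · rw [hbd] at hx
    by_cases h : (1 / 2 : ℝ) ≤ x.2
    · exact Or.inl h
    · refine Or.inr ⟨by linarith, ?_⟩
      rcases hx with h1 | h1 | h1 | h1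
      · exact absurd (by rw [h1]; norm_num) h
      · exact Or.inl h1
      · exact Or.inr (Or.inl h1)
      · exact Or.inr (Or.inr (Or.inr h1))
  · have h1 := congrArg (fun z => (z.1 : ℝ)) h
    rw [hbd]
    have hy := y.1.2
    have hy' := y'.1.2
    fin_cases i <;> fin_cases i'
    · exact absurd rfl hne
    · simp only [Fin.zero_eta, Fin.mk_one, hc1, hc1'] at h1
      right; right; right
      linarith [hy.1, hy.2, hy'.1, hy'.2]
    · simp only [Fin.zero_eta, Fin.mk_one, hc1, hc1'] at h1
      right; right; left
      linarith [hy.1, hy.2, hy'.1, hy'.2]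
    · exact absurd rfl hne
  · rw [hbd] at hx
    simp only [squareBoundaryValue]
    split_ifs with h1
    · simp only [F]
      rw [h1, Set.Icc.coe_one, if_pos (by norm_num), show Set.projIcc (0 : ℝ) 1 zero_le_one
        (2 * 1 - 1) = 1 by norm_num [Set.projIcc_right], hS.top]
    · simp only [F]
      split_ifs with h2
      · rcases hx with h | h | h | h
        · exact absurd (Subtype.ext h) h1
        · norm_num [h] at h2
        · rw [hleft x h, h]
          ring_nf
        · rw [hright x h, h]
          ring_nf
      · rfl
  · simp only [F]
    split_ifs with h
    · exact ⟨a, ⟨le_rfl, hab⟩, hS.dist_le _⟩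
    · refine ⟨_, ⟨?_, ?_⟩, (dist_self _).le.trans (mul_nonneg hR Metric.diam_nonneg)⟩
      · linarith [mul_nonneg x.1.2.1 (sub_nonneg.2 hab)]
      · linarith [mul_le_of_le_one_left (sub_nonneg.2 hab) x.1.2.2]
  · fin_cases i
    · exact Or.inl rfl
    · exact Or.inr rfl
  · simp only [squareBoundaryValue]
    by_cases h : y.2 = 1
    · rw [if_pos h, htop i y hy (by rw [h]; rfl)]
      fin_cases i
      · exact (hS.bottom_left _ y.1 (hc1 y)).symm
      · exact (hS.bottom_right _ y.1 (hc1' y)).symm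
    · rw [if_neg h, hlow i y hy fun h' => h (Subtype.ext h')]
      fin_cases i
      · show γ (a + y.1 * ((a + b) / 2 - a)) = γ (a + (quarter 0 y).1 * (b - a))
        rw [hc1]
        ring_nf
      · show γ ((a + b) / 2 + y.1 * (b - (a + b) / 2)) = γ (a + (quarter 1 y).1 * (b - a))
        rw [hc1']
        ring_nf

/-- Subdividing the parameter interval dyadically and filling the triangles that appear, the
square is filled so that its lower side is mapped to the path `γ`. -/
theorem exists_square_of_fillsTriangle [CompleteSpace Y] {P : Y → Y → ℝ → Y}
    (hP1 : ∀ p q, P p q 1 = q) {γ : ℝ → Y} (hγ : Continuous γ) {R : ℝ}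
    (hR : 0 ≤ R)
    (hfill : ∀ p q r : Y, ∀ D ≤ Metric.diam (γ '' Set.Icc 0 1), dist p q ≤ D → dist q r ≤ D →
      dist p r ≤ D → ∃ S, FillsTriangle P p q r (R * D) S) :
    ∃ f : C(unitInterval × unitInterval, Y),
      (∀ x ∈ squareBoundary, f x = squareBoundaryValue P γ (0, 1) x) ∧
      ∀ x y, dist (f x) (f y) ≤ (2 * R + 1) * Metric.diam (γ '' Set.Icc 0 1) := by
  have key := exists_filling_of_steps (bd := squareBoundary)
    (fun j (ab : ℝ × ℝ) => 0 ≤ ab.1 ∧ ab.2 = ab.1 + (1 / 2) ^ j ∧ ab.2 ≤ 1)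
    (squareBoundaryValue P γ) (fun _ ab => pathNhd γ R ab.1 ab.2) ?_ ?_
    (σ := ((0, 1) : ℝ × ℝ)) (by norm_num)
  · obtain ⟨f, hf, hfB⟩ := key
    exact ⟨f, hf, fun x y => dist_le_of_mem_closure
      (fun _ hy _ hy' => dist_le_of_mem_pathNhd hγ hy hy') (hfB x) (hfB y)⟩
  · rintro j ⟨a, b⟩ ⟨h0, hb, h1⟩
    dsimp only at h0 hb h1
    have hpos : (0 : ℝ) < (1 / 2) ^ j := by positivity
    have hab : a ≤ b := by linarith
    obtain ⟨S, hS⟩ := hfill (γ a) (γ ((a + b) / 2)) (γ b) _ (diam_image_Icc_mono hγ h0 h1)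
      (dist_le_diam_image_Icc hγ ⟨le_rfl, hab⟩ ⟨by linarith, by linarith⟩)
      (dist_le_diam_image_Icc hγ ⟨by linarith, by linarith⟩ ⟨hab, le_rfl⟩)
      (dist_le_diam_image_Icc hγ ⟨le_rfl, hab⟩ ⟨hab, le_rfl⟩)
    obtain ⟨T, hT, hTB, hTc⟩ := exists_fillStep_of_fillsTriangle hP1 hγ hR hab hS
    refine ⟨T, hT, hTB, fun i => ⟨?_, ?_, (hTc i).2⟩⟩
    · rcases (hTc i).1 with h | h <;> rw [h] <;> dsimp only <;> rw [pow_succ] <;>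
        refine ⟨?_, ?_, ?_⟩ <;> linarith
    · rcases (hTc i).1 with h | h <;> rw [h] <;> exact pathNhd_mono hγ hR (by dsimp only; linarith)
        (by dsimp only; linarith)
  · intro η hη
    have hu := (isCompact_Icc (a := (0 : ℝ)) (b := 1)).uniformContinuousOn_of_continuous
      hγ.continuousOn
    obtain ⟨δ, hδ, hu⟩ := Metric.uniformContinuousOn_iff_le.1 hu (η / (2 * R + 1)) (by positivity)
    obtain ⟨M, hM⟩ := exists_pow_lt_of_lt_one hδ (by norm_num : (1 / 2 : ℝ) < 1)
    refine ⟨M, ?_⟩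
    rintro j hj ⟨a, b⟩ ⟨h0, hb, h1⟩ y hy y' hy'
    dsimp only at h0 hb h1 hy hy'
    refine (dist_le_of_mem_pathNhd hγ hy hy').trans ?_
    rw [← le_div_iff₀' (by positivity)]
    refine Metric.diam_le_of_forall_dist_le (by positivity) ?_
    rintro _ ⟨s, hs, rfl⟩ _ ⟨t, ht, rfl⟩
    refine hu s ⟨h0.trans hs.1, hs.2.trans h1⟩ t ⟨h0.trans ht.1, ht.2.trans h1⟩ ?_
    have h2 : (1 / 2 : ℝ) ^ j ≤ (1 / 2) ^ M := pow_le_pow_of_le_one (by norm_num) (by norm_num) hj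
    rw [Real.dist_eq, abs_le]
    constructor <;> linarith [hs.1, hs.2, ht.1, ht.2]

/-- A map of the square that is `t ↦ γ (exp (2πit))` on the lower side and constant on the union of
the other sides descends to the disc, the quotient of the square by the polar coordinates. -/
theorem exists_disc_of_square {γ : C(Circle, Y)} {f : C(unitInterval × unitInterval, Y)}
    (hbot : ∀ t : unitInterval, f (t, 0) = γ (Circle.exp (2 * Real.pi * t)))
    (htop : ∀ t, f (t, 1) = γ 1) (hleft : ∀ h, f (0, h) = γ 1) (hright : ∀ h, f (1, h) = γ 1) :
    ∃ F : C(Metric.closedBall (0 : ℂ) 1, Y), BoundsDisc γ F ∧ Set.range F ⊆ Set.range f := by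
  have hpi := Real.pi_pos
  let π : unitInterval × unitInterval → Metric.closedBall (0 : ℂ) 1 := fun x =>
    ⟨((1 - x.2 : ℝ) : ℂ) * Circle.exp (2 * Real.pi * x.1), by
      rw [mem_closedBall_zero_iff, norm_mul, Circle.norm_coe, Complex.norm_real, Real.norm_eq_abs,
        abs_of_nonneg (sub_nonneg.2 x.2.2.2)]
      linarith [x.2.2.1]⟩
  have hnorm : ∀ x, ‖(π x : ℂ)‖ = 1 - x.2 := fun x => by
    simp only [π]
    rw [norm_mul, Circle.norm_coe, Complex.norm_real, Real.norm_eq_abs,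
      abs_of_nonneg (sub_nonneg.2 x.2.2.2), mul_one]
  have hπ : Continuous π := by
    simp only [π]
    fun_prop
  have hsurj : Function.Surjective π := by
    rintro ⟨z, hz⟩
    rw [mem_closedBall_zero_iff] at hz
    have hmem : Int.fract (z.arg / (2 * Real.pi)) ∈ Set.Icc (0 : ℝ) 1 :=
      ⟨Int.fract_nonneg _, (Int.fract_lt_one _).le⟩
    refine ⟨(⟨_, hmem⟩, ⟨1 - ‖z‖, by linarith, by linarith [norm_nonneg z]⟩), Subtype.ext ?_⟩
    have h1 : Circle.exp (2 * Real.pi * Int.fract (z.arg / (2 * Real.pi))) = Circle.exp z.arg := by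
      rw [Circle.exp_eq_exp]
      refine ⟨-⌊z.arg / (2 * Real.pi)⌋, ?_⟩
      rw [Int.fract]
      push_cast
      field_simp
      ring
    simp only [π, h1, sub_sub_cancel, Circle.coe_exp]
    exact Complex.norm_mul_exp_arg_mul_I z
  -- the polar coordinates identify only points of the top side, and points of the vertical sides
  have hfib : ∀ x y, π x = π y → f x = f y := by
    rintro ⟨t, h⟩ ⟨t', h'⟩ hxy
    have hh : h = h' := by
      have h1 := hnorm (t, h)
      rw [hxy, hnorm] at h1
      exact Subtype.ext (by dsimp only at h1; linarith)
    subst hh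
    by_cases h1 : h = 1
    · rw [h1, htop, htop]
    have h2 : (1 - h : ℝ) ≠ 0 := fun h3 => h1 (Subtype.ext (by rw [Set.Icc.coe_one]; linarith))
    have h3 : Circle.exp (2 * Real.pi * t) = Circle.exp (2 * Real.pi * t') :=
      Subtype.ext (mul_left_cancel₀ (Complex.ofReal_ne_zero.2 h2) (congrArg Subtype.val hxy))
    obtain ⟨m, hm⟩ := Circle.exp_eq_exp.1 h3
    have hm' : (t : ℝ) = t' + m := by
      have : (2 * Real.pi) * (t : ℝ) = (2 * Real.pi) * (t' + m) := by linarith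
      exact mul_left_cancel₀ (by positivity) this
    have hmle : m ≤ 1 := by exact_mod_cast (by linarith [t.2.2, t'.2.1] : (m : ℝ) ≤ 1)
    have hmge : -1 ≤ m := by exact_mod_cast (by linarith [t.2.1, t'.2.2] : (-1 : ℝ) ≤ m)
    obtain rfl | rfl | rfl : m = -1 ∨ m = 0 ∨ m = 1 := by omega
    · push_cast at hm'
      rw [show t = 0 from Subtype.ext (by rw [Set.Icc.coe_zero]; linarith [t.2.1, t'.2.2]),
        show t' = 1 from Subtype.ext (by rw [Set.Icc.coe_one]; linarith [t.2.1, t'.2.2]), hleft,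
        hright]
    · rw [show t = t' from Subtype.ext (by rw [hm']; simp)]
    · push_cast at hm'
      rw [show t = 1 from Subtype.ext (by rw [Set.Icc.coe_one]; linarith [t.2.2, t'.2.1]),
        show t' = 0 from Subtype.ext (by rw [Set.Icc.coe_zero]; linarith [t.2.2, t'.2.1]), hleft,
        hright]
  have hquot : Topology.IsQuotientMap π := hπ.isClosedMap.isQuotientMap hπ hsurj
  choose s hs using hsurj
  have hF : ∀ x, f (s (π x)) = f x := fun x => hfib _ _ (hs _)
  refine ⟨⟨fun z => f (s z), ?_⟩, fun z => ?_, ?_⟩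
  · rw [hquot.continuous_iff]
    exact f.continuous.congr fun x => (hF x).symm
  · obtain ⟨x, hx⟩ : ∃ x, π x = ⟨z, by simp [Circle.norm_coe]⟩ := ⟨_, hs _⟩
    have h0 : x.2 = 0 := by
      have h1 := hnorm x
      rw [hx] at h1
      exact Subtype.ext (by rw [Circle.norm_coe] at h1; rw [Set.Icc.coe_zero]; linarith)
    have h1 : Circle.exp (2 * Real.pi * x.1) = z := by
      have h2 := congrArg Subtype.val hx
      simp only [π, h0, Set.Icc.coe_zero, sub_zero, Complex.ofReal_one, one_mul] at h2
      exact Subtype.ext h2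
    show f (s _) = γ z
    rw [← hx, hF, ← h1, ← hbot, ← h0]
  · rintro _ ⟨z, rfl⟩
    exact ⟨s z, rfl⟩

variable {X : Type*} [MetricSpace X] {ω : Ultrafilter ℕ} {e : ℕ → X} {d : ScalingSequence ω}

/-- The loops of small diameter in the cone bound discs of proportional diameter. -/
theorem exists_boundsDisc_of_divisible (hX : IsGeodesicSpace X) {ε : ℝ}
    (hdiv : UniformlyCoarselyLoopDivisible X ω d ε) : ∃ C : ℝ, 0 < C ∧
      ∀ γ : C(Circle, AsymptoticCone ω e d), 4 * Metric.diam (Set.range γ) < ε →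
        ∃ f : C(Metric.closedBall (0 : ℂ) 1, AsymptoticCone ω e d),
          BoundsDisc γ f ∧ Metric.diam (Set.range f) ≤ C * Metric.diam (Set.range γ) := by
  obtain ⟨c⟩ := hX.nonempty_geodesicChoice
  obtain ⟨R, hR, hfill⟩ := exists_fillsTriangle (e := e) hX hdiv c
  refine ⟨2 * R + 1, by positivity, fun γ hγ => ?_⟩
  have : CompleteSpace (AsymptoticCone ω e d) := completeSpace_asymptoticCone
  let γ' : ℝ → AsymptoticCone ω e d := fun t => γ (Circle.exp (2 * Real.pi * t))
  have hγ' : Continuous γ' := by fun_prop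
  have hdiam : Metric.diam (γ' '' Set.Icc 0 1) ≤ Metric.diam (Set.range γ) := by
    refine Metric.diam_mono ?_ (isCompact_range γ.continuous).isBounded
    rintro _ ⟨t, -, rfl⟩
    exact ⟨_, rfl⟩
  obtain ⟨f, hf, hfd⟩ := exists_square_of_fillsTriangle (conePath_one c) hγ' hR
    fun p q r D hD => hfill D p q r (by linarith)
  have h0 : γ' 0 = γ 1 := by simp [γ']
  have h1 : γ' 1 = γ 1 := by simp [γ']
  have htop : ∀ t, f (t, 1) = γ 1 := fun t => by
    rw [hf _ (Or.inl rfl), squareBoundaryValue, if_pos rfl, h0, h1, conePath_self c _ t.2]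
  have hlow : ∀ x ∈ squareBoundary, x.2 ≠ 1 → f x = γ' x.1 := fun x hx hx1 => by
    rw [hf _ hx, squareBoundaryValue, if_neg hx1, sub_zero, mul_one, zero_add]
  obtain ⟨F, hF, hFr⟩ := exists_disc_of_square (γ := γ) (f := f)
    (fun t => hlow (t, 0) (Or.inr (Or.inl rfl)) zero_ne_one) htop
    (fun h => by
      by_cases hh : h = 1
      · rw [hh, htop]
      · rw [hlow (0, h) (Or.inr (Or.inr (Or.inl rfl))) hh, Set.Icc.coe_zero, h0])
    (fun h => by
      by_cases hh : h = 1
      · rw [hh, htop]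
      · rw [hlow (1, h) (Or.inr (Or.inr (Or.inr rfl))) hh, Set.Icc.coe_one, h1])
  refine ⟨F, hF, Metric.diam_le_of_forall_dist_le (by positivity) fun y hy y' hy' => ?_⟩
  obtain ⟨x, rfl⟩ := hFr hy
  obtain ⟨x', rfl⟩ := hFr hy'
  exact (hfd x x').trans (mul_le_mul_of_nonneg_left hdiam (by positivity))

end Loop

theorem mainTheorem4 {X : Type*} [MetricSpace X] [CompleteSpace X] (hX : IsGeodesicSpace X)
    (ω : Ultrafilter ℕ) (d : ScalingSequence ω) (e : ℕ → X) (ε : ℝ) (hε : 0 < ε)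
    (hdiv : UniformlyCoarselyLoopDivisible X ω d ε) :
    UniformlyLocallySimplyConnected (AsymptoticCone ω e d) ∧
      ∃ K : ℝ, ∀ γ : C(Circle, AsymptoticCone ω e d),
        Metric.diam (Set.range γ) < ε / 8 →
          ∃ f : C(Metric.closedBall (0 : ℂ) 1, AsymptoticCone ω e d),
            BoundsDisc γ f ∧ Metric.diam (Set.range f) < K * ε := by
  obtain ⟨C, hC, h⟩ := exists_boundsDisc_of_divisible (e := e) hX hdiv
  refine ⟨fun η hη => ⟨min (ε / 8) (η / C), by positivity, fun γ hγ => ?_⟩, C, fun γ hγ => ?_⟩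
  · obtain ⟨f, hf, hfd⟩ := h γ (by linarith [hγ.trans (min_le_left _ _)])
    refine ⟨f, hf, hfd.trans ?_⟩
    rw [← le_div_iff₀' hC]
    exact hγ.trans (min_le_right _ _)
  · obtain ⟨f, hf, hfd⟩ := h γ (by linarith)
    exact ⟨f, hf, hfd.trans_lt (mul_lt_mul_of_pos_left (by linarith) hC)⟩
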